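/- Let $\Omega\subset\mathbb R^3$ be a nonempty compact set with smooth boundary (a bounded body), let $n$ be the unit normal on $\partial\Omega$ pointing out of $\Omega$, and let $S$ be the area of $\partial\Omega$. Let $k>0$, $\theta_0\in S^2$, $\gamma\in C(\partial\Omega)$ with $\operatorname{Im}\gamma\ge\gamma_0$ on $\partial\Omega$ for a constant $\gamma_0>0$, and $\Gamma=\max_{\partial\Omega}|\gamma|$. Let $u\in C^2(\mathbb R^3\setminus\Omega)\cap C^1(\overline{\mathbb R^3\setminus\Omega})$ be the field scattered by $\Omega$ from the plane wave $e^{ik r\cdot\theta_0}$ under the impedance boundary condition, that is, $$\Delta u+k^2u=0\ \text{ in }\mathbb R^3\setminus\Omega,\qquad \int_{|r|=R}\Bigl|\frac{\partial u}{\partial |r|}-iku\Bigr|^2dS\to0\quad(R\to\infty),$$ $$\Bigl(\frac{\partial}{\partial n}+k\gamma\Bigr)u=-\Bigl(\frac{\partial}{\partial n}+k\gamma\Bigr)e^{ik r\cdot\theta_0}\ \text{ on }\partial\Omega .$$ Then $u$ has a square-integrable scattering amplitude $f_\gamma$ on $S^2$, i.e. $u(r)=\frac{e^{ik|r|}}{|r|}f_\gamma(r/|r|)+o(1/|r|)$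 as $|r|\to\infty$, and the total cross section $\sigma_\gamma=\int_{S^2}|f_\gamma(\theta)|^2\,d\theta$ and the transport cross section $R_\gamma=\int_{S^2}(1-\theta\cdot\theta_0)|f_\gamma(\theta)|^2\,d\theta$ satisfy $$R_\gamma>\frac1{2\pi}\Bigl(\frac{\sigma_\gamma\gamma_0}{kS}\Bigr)^2\frac1{(1+\Gamma)^2(1+\Gamma+\gamma_0)^2}.$$ Consequently $R_\gamma$ has a positive infimum over obstacles with fixed total cross section and uniformly bounded area: for all $k,\gamma_0>0$ and all real $\Gamma_0,\sigma,A$ there is $c>0$ such that $R_\gamma\ge c$ for all $\Omega,\gamma,\theta_0,u$ as above (with these $k$ and $\gamma_0$) that satisfy $\max_{\partial\Omega}|\gamma|\le\Gamma_0$, $\sigma_\gamma=\sigma$ and $S\le A$. -/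

import Mathlib

open MeasureTheory Filter Topology Set
open scoped ContDiff Gradient

noncomputable section

namespace ImpedanceScattering

/-- Euclidean three-space. -/
abbrev E3 : Type := EuclideanSpace ℝ (Fin 3)

/-- `ρ` is a smooth defining function of `Ω` near the boundary point `x`: close to `x`, the set
`Ω` is `{ρ ≤ 0}`, and the gradient of `ρ` does not vanish at `x`. -/
structure IsDefiningFunctionAt (Ω : Set E3) (x : E3) (ρ : E3 → ℝ) : Prop where
  contDiff : ContDiff ℝ ∞ ρ
  eq_zero : ρ x = 0
  gradient_ne : ∇ ρ x ≠ 0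
  mem_iff : ∀ᶠ y in 𝓝 x, y ∈ Ω ↔ ρ y ≤ 0

/-- An obstacle: a (nonempty, closed and) bounded body in three-space with smooth boundary. -/
structure IsObstacle (Ω : Set E3) : Prop where
  isCompact : IsCompact Ω
  nonempty : Ω.Nonempty
  smooth_boundary : ∀ x ∈ frontier Ω, ∃ ρ : E3 → ℝ, IsDefiningFunctionAt Ω x ρ

open Classical in
/-- The unit normal of `∂Ω` at `x`, pointing out of `Ω`: the normalized gradient of a local
defining function (it does not depend on the choice, see `outwardNormal_eq`). -/
def outwardNormal (Ω : Set E3) (x : E3) : E3 :=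
  if h : ∃ ρ : E3 → ℝ, IsDefiningFunctionAt Ω x ρ then
    ‖∇ h.choose x‖⁻¹ • ∇ h.choose x
  else 0

theorem eventually_pos_of_inner_gradient_pos {ρ : E3 → ℝ} {x v : E3} (hρ : ContDiff ℝ ∞ ρ)
    (h0 : ρ x = 0) (hv : 0 < inner ℝ (∇ ρ x) v) :
    ∀ᶠ t : ℝ in 𝓝[>] 0, 0 < ρ (x + t • v) := by
  have hd : HasFDerivAt ρ (fderiv ℝ ρ x) x := (hρ.differentiable (by simp)).differentiableAt.hasFDerivAt
  have hl : HasDerivAt (fun t : ℝ => x + t • v) v 0 := by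
    simpa using ((hasDerivAt_id (0 : ℝ)).smul_const v).const_add x
  have hd' : HasFDerivAt ρ (fderiv ℝ ρ x) (x + (0 : ℝ) • v) := by simpa using hd
  have hg : HasDerivAt (fun t : ℝ => ρ (x + t • v)) (fderiv ℝ ρ x v) 0 :=
    hd'.comp_hasDerivAt (0 : ℝ) hl
  have hpos : 0 < fderiv ℝ ρ x v := by
    have : inner ℝ (∇ ρ x) v = fderiv ℝ ρ x v := by
      simp [gradient]
    rwa [← this]
  have hs := (hasDerivAt_iff_tendsto_slope.1 hg).mono_left
    (nhdsWithin_mono (0 : ℝ) (fun t (ht : 0 < t) => ne_of_gt ht))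
  filter_upwards [hs.eventually (lt_mem_nhds hpos), self_mem_nhdsWithin] with t ht ht0
  have ht0' : (0 : ℝ) < t := ht0
  simp only [slope, vsub_eq_sub, sub_zero, zero_smul, add_zero, h0, smul_eq_mul] at ht
  exact (pos_iff_pos_of_mul_pos ht).1 (inv_pos.2 ht0')

/-- Two local defining functions have the same normalized gradient. -/
theorem normalized_gradient_unique {Ω : Set E3} {x : E3} {ρ₁ ρ₂ : E3 → ℝ}
    (h₁ : IsDefiningFunctionAt Ω x ρ₁) (h₂ : IsDefiningFunctionAt Ω x ρ₂) :
    ‖∇ ρ₁ x‖⁻¹ • ∇ ρ₁ x = ‖∇ ρ₂ x‖⁻¹ • ∇ ρ₂ x := by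
  set a := ‖∇ ρ₁ x‖⁻¹ • ∇ ρ₁ x with ha
  set b := ‖∇ ρ₂ x‖⁻¹ • ∇ ρ₂ x with hb
  have n₁ : 0 < ‖∇ ρ₁ x‖ := norm_pos_iff.2 h₁.gradient_ne
  have n₂ : 0 < ‖∇ ρ₂ x‖ := norm_pos_iff.2 h₂.gradient_ne
  have ea : ∇ ρ₁ x = ‖∇ ρ₁ x‖ • a := by rw [ha, smul_smul, mul_inv_cancel₀ n₁.ne', one_smul]
  have eb : ∇ ρ₂ x = ‖∇ ρ₂ x‖ • b := by rw [hb, smul_smul, mul_inv_cancel₀ n₂.ne', one_smul]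
  have na : ‖a‖ = 1 := by rw [ha, norm_smul, norm_inv, norm_norm, inv_mul_cancel₀ n₁.ne']
  have nb : ‖b‖ = 1 := by rw [hb, norm_smul, norm_inv, norm_norm, inv_mul_cancel₀ n₂.ne']
  by_contra hne
  have hlt : inner ℝ a b < 1 := (inner_lt_one_iff_real_of_norm_eq_one na nb).2 hne
  have aa : inner ℝ a a = (1 : ℝ) := by simp [na]
  have bb : inner ℝ b b = (1 : ℝ) := by simp [nb]
  have p₁ : 0 < inner ℝ (∇ ρ₁ x) (a - b) := by
    rw [ea, real_inner_smul_left, inner_sub_right, aa]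
    exact mul_pos n₁ (by linarith)
  have p₂ : 0 < inner ℝ (∇ (fun y => - ρ₂ y) x) (a - b) := by
    have hneg : ∇ (fun y => - ρ₂ y) x = - ∇ ρ₂ x := by simp [gradient]
    rw [hneg, inner_neg_left, eb, real_inner_smul_left, inner_sub_right, bb,
      real_inner_comm]
    nlinarith
  have q₁ := eventually_pos_of_inner_gradient_pos h₁.contDiff h₁.eq_zero p₁
  have q₂ := eventually_pos_of_inner_gradient_pos h₂.contDiff.neg (by simp [h₂.eq_zero]) p₂
  have hc : Tendsto (fun t : ℝ => x + t • (a - b)) (𝓝[>] 0) (𝓝 x) := by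
    have : Continuous (fun t : ℝ => x + t • (a - b)) := by fun_prop
    simpa using (this.tendsto 0).mono_left nhdsWithin_le_nhds
  obtain ⟨t, ht₁, ht₂, hm₁, hm₂⟩ :=
    (q₁.and (q₂.and ((hc.eventually h₁.mem_iff).and (hc.eventually h₂.mem_iff)))).exists
  exact absurd (hm₁.1 (hm₂.2 (by linarith))) (not_le.2 ht₁)

theorem outwardNormal_eq {Ω : Set E3} {x : E3} {ρ : E3 → ℝ} (h : IsDefiningFunctionAt Ω x ρ) :
    outwardNormal Ω x = ‖∇ ρ x‖⁻¹ • ∇ ρ x := by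
  have hex : ∃ ρ : E3 → ℝ, IsDefiningFunctionAt Ω x ρ := ⟨ρ, h⟩
  rw [outwardNormal, dif_pos hex]
  exact normalized_gradient_unique hex.choose_spec h

/-- The area of `∂Ω`, as two-dimensional Hausdorff measure normalized so that it is Lebesgue
measure on planes. -/
def surfaceArea (Ω : Set E3) : ℝ := (μHE[2] (frontier Ω)).toReal

/-- The derivative `∂u/∂n` of an exterior field at a boundary point, along the unit normal
that points into the exterior. -/
def normalDeriv (Ω : Set E3) (u : E3 → ℂ) (x : E3) : ℂ :=
  fderivWithin ℝ u (closure Ωᶜ) x (outwardNormal Ω x)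

/-- The impedance boundary operator `∂/∂n + k γ`. -/
def impedanceOp (k : ℝ) (Ω : Set E3) (γ : E3 → ℂ) (u : E3 → ℂ) (x : E3) : ℂ :=
  normalDeriv Ω u x + k * γ x * u x

/-- The plane wave `exp (i k r·θ₀)`. -/
def planeWave (k : ℝ) (θ₀ : E3) (r : E3) : ℂ :=
  Complex.exp (Complex.I * k * (inner ℝ r θ₀ : ℝ))

/-- The radiation condition `∫_{|r| = R} |∂u/∂|r| - i k u|² dS → 0` as `R → ∞`; the integral over
the sphere of radius `R` is written as `R²` times an integral over the unit sphere. -/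
def IsRadiating (k : ℝ) (u : E3 → ℂ) : Prop :=
  Tendsto (fun R : ℝ => R ^ 2 * ∫ θ : Metric.sphere (0 : E3) 1,
      ‖fderiv ℝ u (R • (θ : E3)) (θ : E3) - Complex.I * k * u (R • (θ : E3))‖ ^ 2
        ∂(volume : Measure E3).toSphere)
    atTop (𝓝 0)

/-- `u` is the field scattered by the obstacle `Ω` with impedance `γ` when the plane wave with
direction `θ₀` and wave number `k` comes in. It is `C²` outside `Ω` and `C¹` up to the boundary. -/
structure IsScatteredField (k : ℝ) (Ω : Set E3) (γ : E3 → ℂ) (θ₀ : E3) (u : E3 → ℂ) :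
    Prop where
  contDiffOn_exterior : ContDiffOn ℝ 2 u Ωᶜ
  contDiffOn_closure : ContDiffOn ℝ 1 u (closure Ωᶜ)
  helmholtz : ∀ x ∈ Ωᶜ, Laplacian.laplacian u x + (k : ℂ) ^ 2 * u x = 0
  radiating : IsRadiating k u
  boundary : ∀ x ∈ frontier Ω,
    impedanceOp k Ω γ u x = - impedanceOp k Ω γ (planeWave k θ₀) x

/-- The scattering amplitude `f(θ) = lim_{R → ∞} R e^{-ikR} u(Rθ)` of a field `u`, for unit
vectors `θ`. -/
def scatteringAmplitude (k : ℝ) (u : E3 → ℂ) (θ : E3) : ℂ :=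
  limUnder atTop (fun R : ℝ => (R : ℂ) * Complex.exp (-(Complex.I * k * R)) * u (R • θ))

/-- The asymptotics `u(r) = e^{ik|r|} / |r| · f(r/|r|) + o(1/|r|)` as `|r| → ∞`. -/
def HasFarField (k : ℝ) (u : E3 → ℂ) (f : E3 → ℂ) : Prop :=
  (fun r : E3 => u r - Complex.exp (Complex.I * k * ‖r‖) / ‖r‖ * f (‖r‖⁻¹ • r))
    =o[Bornology.cobounded E3] (fun r : E3 => 1 / ‖r‖)

/-- The total cross section `∫_{S²} |f|²`. -/
def totalCrossSection (k : ℝ) (u : E3 → ℂ) : ℝ :=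
  ∫ θ : Metric.sphere (0 : E3) 1, ‖scatteringAmplitude k u θ‖ ^ 2
    ∂(volume : Measure E3).toSphere

/-- The transport cross section `∫_{S²} (1 - θ·θ₀) |f(θ)|² dθ`. -/
def transportCrossSection (k : ℝ) (θ₀ : E3) (u : E3 → ℂ) : ℝ :=
  ∫ θ : Metric.sphere (0 : E3) 1,
    (1 - inner ℝ (θ : E3) θ₀) * ‖scatteringAmplitude k u θ‖ ^ 2
    ∂(volume : Measure E3).toSphere

/-- The sup norm of `γ` on `∂Ω`. -/
def boundarySup (Ω : Set E3) (γ : E3 → ℂ) : ℝ := sSup ((fun x => ‖γ x‖) '' frontier Ω)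

/-- The values of the transport cross section over all obstacles with total cross section `σ`
and area at most `A`, all impedances with `Im γ ≥ γ₀` and `‖γ‖ ≤ Γ`, and all incident
directions, at wave number `k`. -/
def transportValues (k γ₀ Γ σ A : ℝ) : Set ℝ :=
  {R | ∃ (Ω : Set E3) (γ : E3 → ℂ) (θ₀ : E3) (u : E3 → ℂ),
    IsObstacle Ω ∧ ContinuousOn γ (frontier Ω) ∧ (∀ x ∈ frontier Ω, γ₀ ≤ (γ x).im) ∧
    boundarySup Ω γ ≤ Γ ∧ ‖θ₀‖ = 1 ∧ IsScatteredField k Ω γ θ₀ u ∧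
    totalCrossSection k u = σ ∧ surfaceArea Ω ≤ A ∧ R = transportCrossSection k θ₀ u}

end ImpedanceScattering

end

/-! Write w for the incident wave, v = u + w for the total field, f for the amplitude, σ for its
total cross section and Γ for the maximum of |γ|. The point is that f is bounded in terms of k, γ₀,
Γ and the area, and a bounded density of mass σ on the sphere cannot sit arbitrarily close to the
single direction θ₀.

Bounding f. Green's representation expresses f(θ) through the Cauchy data of u on ∂Ω against
exp(-ikθ·y)/4π. The incident wave contributes nothing, by Green's identity inside Ω, so u may be
replaced by v; the impedance condition then removes the normal derivative of v, and |f| ≤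
k(1+Γ)/(4π) ∫|v| (`norm_farField_le_integral`). The optical theorem `optical`, kσ + k∫ Im γ |v|² =
4π Im f(θ₀), gives k γ₀ ∫|v|² ≤ 4π |f(θ₀)| ≤ k(1+Γ) ∫|v|. This is quadratic on the left and linear
on the right, so Cauchy–Schwarz bounds ∫|v| by (1+Γ)/γ₀ times the mass of the boundary
(`integral_norm_total_le`). Hence |f| ≤ M with M explicit (`norm_farField_le`).

From M to the transport cross section. The cap 1 - θ·θ₀ < t has area at most 6πt, so the transport
cross section is at least tσ - 6πt²M². The best t gives σ²/(24πM²) (`transport_lower_bound`).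

Strictness. The computation ends with the constant π/6 in place of 1/(2π), and it remains to know σ
> 0. If f(θ₀) = 0, the energy bound forces v = 0 on ∂Ω, hence its normal derivative vanishes too,
the representation gives u = 0 outside Ω, and v = w has modulus one on ∂Ω, a contradiction
(`farField_ne_zero`).

Room in the constant is what permits a light treatment of surfaces. The divergence theorem is proved
for some measure on ∂Ω that is at most twice the area measure (`exists_isSurfaceMeasure`); it is
never identified with the area measure.

The scattering theory avoids singular and spherical integrals. Large spheres are replaced by shells
R ≤ |x| ≤ R+1 with weight `stepDeriv (‖x‖ - R)`, and the fundamental solution is cut off near its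
pole, which turns the delta source into a smeared one. Conservation of the flux Im(ū ∂u), together
with the radiation condition, bounds the energy of u on shells (`exists_shell_energy_le`). This
kills the shell term in Green's formula (`representation`). Expanding the fundamental solution far
away then yields the amplitude with an error O(|r|⁻²).

The uniform statement follows because the lower bound decreases in Γ and in the area. -/

noncomputable section

namespace ImpedanceScattering

/-! ### Adapted coordinates, uniqueness of boundary derivatives, continuity of the normal -/

section

/-- The Euclidean plane. -/
abbrev E2 : Type := EuclideanSpace ℝ (Fin 2)

/-- Adjoining a first coordinate to a point of the plane. -/
def consEquiv : (ℝ × E2) ≃L[ℝ] E3 :=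
  LinearEquiv.toContinuousLinearEquiv
    { toFun := fun p => WithLp.toLp 2 (Fin.cons p.1 p.2.ofLp)
      invFun := fun x => (x 0, WithLp.toLp 2 (Fin.tail x.ofLp))
      map_add' := fun p q => by
        ext i
        refine Fin.cases ?_ (fun j => ?_) i <;> simp
      map_smul' := fun c p => by
        ext i
        refine Fin.cases ?_ (fun j => ?_) i <;> simp
      left_inv := fun p => by simp
      right_inv := fun x => by simp }

theorem consEquiv_apply (p : ℝ × E2) :
    consEquiv p = WithLp.toLp 2 (Fin.cons p.1 p.2.ofLp) := rfl

theorem norm_sq_consEquiv (t : ℝ) (y : E2) : ‖consEquiv (t, y)‖ ^ 2 = t ^ 2 + ‖y‖ ^ 2 := by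
  rw [EuclideanSpace.real_norm_sq_eq, EuclideanSpace.real_norm_sq_eq, Fin.sum_univ_succ]
  simp [consEquiv_apply]

theorem measurePreserving_consEquiv : MeasurePreserving consEquiv volume volume := by
  have h1 : MeasurePreserving (MeasurableEquiv.piFinSuccAbove (fun _ : Fin 3 => ℝ) 0).symm
      volume volume := (volume_preserving_piFinSuccAbove (fun _ : Fin 3 => ℝ) 0).symm
  have h2 : MeasurePreserving (Prod.map id WithLp.ofLp : ℝ × E2 → ℝ × (Fin 2 → ℝ))
      volume volume :=
    (MeasurePreserving.id volume).prod (PiLp.volume_preserving_ofLp (Fin 2))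
  have h3 := (PiLp.volume_preserving_toLp (Fin 3)).comp (h1.comp h2)
  have h4 : (consEquiv : ℝ × E2 → E3) = WithLp.toLp 2 ∘
      (MeasurableEquiv.piFinSuccAbove (fun _ : Fin 3 => ℝ) 0).symm ∘
        Prod.map id WithLp.ofLp := by
    funext p
    ext i
    refine Fin.cases ?_ (fun j => ?_) i <;> rfl
  rw [h4]
  exact h3

/-- A linear isometry (for the Euclidean norms) of `ℝ × ℝ²` and `ℝ³` that takes the first axis to
a given direction. -/
theorem exists_adapted_coordinates {n : E3} (hn : ‖n‖ = 1) :
    ∃ Q : (ℝ × E2) ≃L[ℝ] E3, Q (1, 0) = n ∧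
      (∀ t y, ‖Q (t, y)‖ ^ 2 = t ^ 2 + ‖y‖ ^ 2) ∧ MeasurePreserving Q volume volume := by
  set e : E3 := consEquiv (1, 0) with he
  have hen : ‖e‖ = ‖n‖ := by
    have := norm_sq_consEquiv 1 0
    rw [hn]
    nlinarith [norm_nonneg e, this, norm_zero (E := E2)]
  -- Reflection in the hyperplane orthogonal to e - n exchanges the two vectors e and n of equal
  -- length.
  let L : E3 ≃ₗᵢ[ℝ] E3 := (ℝ ∙ (e - n))ᗮ.reflection
  refine ⟨consEquiv.trans L.toContinuousLinearEquiv, ?_, fun t y => ?_, ?_⟩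
  · exact Submodule.reflection_sub hen
  · have : (consEquiv.trans L.toContinuousLinearEquiv) (t, y) = L (consEquiv (t, y)) := rfl
    rw [this, L.norm_map, norm_sq_consEquiv]
  · exact L.measurePreserving.comp measurePreserving_consEquiv

/-- At a boundary point every direction v with ⟨∇ρ, v⟩ > 0 enters the exterior, so the tangent cone
contains an open half space, and this spans. It makes `fderivWithin` on the closed exterior a
well-determined boundary derivative, continuous for fields that are C¹ up to the boundary. -/
theorem uniqueDiffOn_closure_compl {Ω : Set E3} (hΩ : IsObstacle Ω) :
    UniqueDiffOn ℝ (closure Ωᶜ) := by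
  have hcl : IsClosed Ω := hΩ.isCompact.isClosed
  intro x hx
  rw [uniqueDiffWithinAt_closure]
  by_cases hxΩ : x ∈ Ω
  swap
  · exact hcl.isOpen_compl.uniqueDiffWithinAt hxΩ
  have hxf : x ∈ frontier Ω := by
    rw [frontier_eq_closure_inter_closure]
    exact ⟨subset_closure hxΩ, hx⟩
  obtain ⟨ρ, h⟩ := hΩ.smooth_boundary x hxf
  have hcone : ∀ v : E3, 0 < inner ℝ (∇ ρ x) v → v ∈ tangentConeAt ℝ Ωᶜ x := by
    intro v hv
    have hpos := eventually_pos_of_inner_gradient_pos h.contDiff h.eq_zero hv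
    have hc : Tendsto (fun t : ℝ => x + t • v) (𝓝[>] 0) (𝓝 x) := by
      have : Continuous (fun t : ℝ => x + t • v) := by fun_prop
      simpa using (this.tendsto 0).mono_left nhdsWithin_le_nhds
    refine mem_tangentConeAt_of_add_smul_mem (l := 𝓝[>] (0 : ℝ)) (c := fun t => t) ?_ ?_
    · exact tendsto_id'.mpr (nhdsGT_le_nhdsNE 0)
    · filter_upwards [hpos, hc.eventually h.mem_iff] with t h1 h2 h3
      exact absurd (h2.1 h3) (not_le.2 h1)
  refine ⟨?_, hx⟩
  suffices hs : (Submodule.span ℝ (tangentConeAt ℝ Ωᶜ x)) = ⊤ by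
    rw [hs]; exact dense_univ
  rw [eq_top_iff]
  intro v _
  set g := ∇ ρ x with hg
  have hgpos : 0 < inner ℝ g g := real_inner_self_pos.2 h.gradient_ne
  have hgm : g ∈ Submodule.span ℝ (tangentConeAt ℝ Ωᶜ x) := Submodule.subset_span (hcone g hgpos)
  -- Chosen so that v + c • g has inner product 1 with g; then v is a difference of two tangent
  -- directions.
  set c : ℝ := (1 - inner ℝ g v) / inner ℝ g g with hcdef
  have hvc : v + c • g ∈ Submodule.span ℝ (tangentConeAt ℝ Ωᶜ x) := by
    refine Submodule.subset_span (hcone _ ?_)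
    rw [inner_add_right, inner_smul_right, hcdef, div_mul_cancel₀ _ hgpos.ne']
    linarith
  have := Submodule.sub_mem _ hvc (Submodule.smul_mem _ c hgm)
  simpa using this

/-- A function that is nonpositive exactly on `Ω`, near a frontier point, vanishes there. -/
theorem eq_zero_of_mem_frontier {Ω : Set E3} {y : E3} {ρ : E3 → ℝ} (hρ : ContinuousAt ρ y)
    (hev : ∀ᶠ z in 𝓝 y, z ∈ Ω ↔ ρ z ≤ 0) (hy : y ∈ frontier Ω) : ρ y = 0 := by
  rw [frontier_eq_closure_inter_closure] at hy
  apply le_antisymm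
  · by_contra hlt
    push Not at hlt
    obtain ⟨z, hz1, hz2, hz3⟩ := (mem_closure_iff_frequently.1 hy.1).and_eventually
      (hev.and (hρ.eventually (lt_mem_nhds hlt))) |>.exists
    exact absurd (hz2.1 hz1) (not_le.2 hz3)
  · by_contra hlt
    push Not at hlt
    obtain ⟨z, hz1, hz2, hz3⟩ := (mem_closure_iff_frequently.1 hy.2).and_eventually
      (hev.and (hρ.eventually (gt_mem_nhds hlt))) |>.exists
    exact hz1 (hz2.2 hz3.le)

/-- One defining function serves all nearby boundary points, which is why the normal, defined by a
pointwise choice, is continuous. -/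
theorem IsDefiningFunctionAt.eventually {Ω : Set E3} {x : E3} {ρ : E3 → ℝ}
    (h : IsDefiningFunctionAt Ω x ρ) :
    ∀ᶠ y in 𝓝 x, y ∈ frontier Ω → IsDefiningFunctionAt Ω y ρ := by
  have hcg : Continuous (fun y => ∇ ρ y) := by
    have : Continuous (fderiv ℝ ρ) := h.contDiff.continuous_fderiv (by simp)
    exact (InnerProductSpace.toDual ℝ E3).symm.continuous.comp this
  filter_upwards [h.mem_iff.eventually_nhds, hcg.continuousAt.eventually_ne h.gradient_ne]
    with y hy hgy hyf
  exact ⟨h.contDiff, eq_zero_of_mem_frontier h.contDiff.continuous.continuousAt hy hyf, hgy, hy⟩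

theorem continuous_gradient {ρ : E3 → ℝ} (h : ContDiff ℝ 1 ρ) : Continuous (fun y => ∇ ρ y) := by
  have : Continuous (fderiv ℝ ρ) := h.continuous_fderiv (by simp)
  exact (InnerProductSpace.toDual ℝ E3).symm.continuous.comp this

theorem continuousOn_outwardNormal {Ω : Set E3} (hΩ : IsObstacle Ω) :
    ContinuousOn (outwardNormal Ω) (frontier Ω) := by
  intro x hx
  obtain ⟨ρ, h⟩ := hΩ.smooth_boundary x hx
  have hcg := continuous_gradient (h.contDiff.of_le (by simp))
  have hc : ContinuousAt (fun y => ‖∇ ρ y‖⁻¹ • ∇ ρ y) x :=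
    ((hcg.norm.continuousAt).inv₀ (norm_ne_zero_iff.2 h.gradient_ne)).smul hcg.continuousAt
  refine hc.continuousWithinAt.congr_of_eventuallyEq ?_ (outwardNormal_eq h)
  filter_upwards [nhdsWithin_le_nhds h.eventually, self_mem_nhdsWithin] with y hy hyf
  exact outwardNormal_eq (hy hyf)

theorem norm_outwardNormal {Ω : Set E3} (hΩ : IsObstacle Ω) {x : E3} (hx : x ∈ frontier Ω) :
    ‖outwardNormal Ω x‖ = 1 := by
  obtain ⟨ρ, h⟩ := hΩ.smooth_boundary x hx
  rw [outwardNormal_eq h, norm_smul, norm_inv, norm_norm,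
    inv_mul_cancel₀ (norm_ne_zero_iff.2 h.gradient_ne)]

end

/-! ### The boundary as a Lipschitz graph in local patches -/

section

theorem norm_gradient (ρ : E3 → ℝ) (x : E3) : ‖∇ ρ x‖ = ‖fderiv ℝ ρ x‖ := by
  simp [gradient]

/-- In the coordinates `Q` on the box `[a, b] × B`, the set `Ω` is the sublevel set of `ρ`, and
`ρ` increases along the first axis, at a speed comparable to the length of its gradient. -/
structure IsGraphPatch (Ω : Set E3) (Q : (ℝ × E2) ≃L[ℝ] E3) (ρ : E3 → ℝ) (a b : ℝ)
    (B : Set E2) : Prop where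
  contDiff : ContDiff ℝ ∞ ρ
  isOpen : IsOpen B
  convex : Convex ℝ B
  bounded : Bornology.IsBounded B
  lt : a < b
  norm_sq : ∀ t y, ‖Q (t, y)‖ ^ 2 = t ^ 2 + ‖y‖ ^ 2
  measurePreserving : MeasurePreserving Q volume volume
  mem_iff : ∀ t ∈ Icc a b, ∀ y ∈ B, Q (t, y) ∈ Ω ↔ ρ (Q (t, y)) ≤ 0
  slope_pos : ∀ t ∈ Icc a b, ∀ y ∈ B, 0 < fderiv ℝ ρ (Q (t, y)) (Q (1, 0))
  gradient_le : ∀ t ∈ Icc a b, ∀ y ∈ B,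
    ‖∇ ρ (Q (t, y))‖ ≤ 2 * fderiv ℝ ρ (Q (t, y)) (Q (1, 0))
  neg : ∀ y ∈ B, ρ (Q (a, y)) < 0
  pos : ∀ y ∈ B, 0 < ρ (Q (b, y))

theorem hasDerivAt_comp_coordinates {Q : (ℝ × E2) ≃L[ℝ] E3} {ρ : E3 → ℝ} (h : ContDiff ℝ ∞ ρ)
    (t : ℝ) (y : E2) :
    HasDerivAt (fun t => ρ (Q (t, y))) (fderiv ℝ ρ (Q (t, y)) (Q (1, 0))) t := by
  have h1 : HasDerivAt (fun t : ℝ => Q (t, y)) (Q (1, 0)) t :=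
    (Q : (ℝ × E2) →L[ℝ] E3).hasFDerivAt.comp_hasDerivAt t
      ((hasDerivAt_id' t).prodMk (hasDerivAt_const t y))
  have h2 : HasFDerivAt ρ (fderiv ℝ ρ (Q (t, y))) (Q (t, y)) :=
    (h.differentiable (by simp)).differentiableAt.hasFDerivAt
  exact h2.comp_hasDerivAt t h1

/-- With the first axis along the normal, the slope of ρ at x equals |∇ρ|; by continuity it stays
positive and above |∇ρ|/2 on a small box, which is the source of every factor 2 in the surface
estimates. Monotonicity along the axis through x makes ρ negative below and positive above. -/
theorem exists_isGraphPatch {Ω : Set E3} {x : E3} {ρ : E3 → ℝ}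
    (hρ : IsDefiningFunctionAt Ω x ρ) :
    ∃ Q : (ℝ × E2) ≃L[ℝ] E3, ∃ a b B, IsGraphPatch Ω Q ρ a b B ∧
      ∃ t ∈ Ioo a b, ∃ y ∈ B, Q (t, y) = x := by
  have ng : 0 < ‖∇ ρ x‖ := norm_pos_iff.2 hρ.gradient_ne
  set n : E3 := ‖∇ ρ x‖⁻¹ • ∇ ρ x with hn
  have hn1 : ‖n‖ = 1 := by rw [hn, norm_smul, norm_inv, norm_norm, inv_mul_cancel₀ ng.ne']
  obtain ⟨Q, hQ1, hQn, hQm⟩ := exists_adapted_coordinates hn1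
  have hd : fderiv ℝ ρ x n = ‖∇ ρ x‖ := by
    have h1 : fderiv ℝ ρ x n = inner ℝ (∇ ρ x) n := by simp [gradient]
    rw [h1, hn, inner_smul_right, real_inner_self_eq_norm_sq]
    field_simp
  obtain ⟨p0, hp0⟩ := Q.surjective x
  obtain ⟨t0, y0⟩ := p0
  have hfd : Continuous (fun p : ℝ × E2 => fderiv ℝ ρ (Q p) (Q (1, 0))) := by
    have : Continuous (fderiv ℝ ρ) := hρ.contDiff.continuous_fderiv (by simp)
    exact (this.comp Q.continuous).clm_apply continuous_const
  have hgc : Continuous (fun p : ℝ × E2 => ‖∇ ρ (Q p)‖) :=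
    ((continuous_gradient (hρ.contDiff.of_le (by simp))).comp Q.continuous).norm
  have hgood : ∀ᶠ p : ℝ × E2 in 𝓝 (t0, y0), (Q p ∈ Ω ↔ ρ (Q p) ≤ 0) ∧
      0 < fderiv ℝ ρ (Q p) (Q (1, 0)) ∧ ‖∇ ρ (Q p)‖ < 2 * fderiv ℝ ρ (Q p) (Q (1, 0)) := by
    refine Filter.Eventually.and ?_ (Filter.Eventually.and ?_ ?_)
    · exact (Q.continuous.tendsto' (t0, y0) x hp0).eventually hρ.mem_iff
    · refine hfd.continuousAt.eventually (lt_mem_nhds ?_)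
      simp only [hp0, hQ1, hd]; exact ng
    · refine hgc.continuousAt.eventually_lt (hfd.const_mul 2).continuousAt ?_
      simp only [hp0, hQ1, hd]; linarith
  obtain ⟨δ, hδ, hball⟩ := Metric.eventually_nhds_iff_ball.1 hgood
  have hin : ∀ t ∈ Icc (t0 - δ / 2) (t0 + δ / 2), ∀ y ∈ Metric.ball y0 δ,
      (t, y) ∈ Metric.ball (t0, y0) δ := by
    intro t ht y hy
    rw [Metric.mem_ball, Prod.dist_eq, max_lt_iff]
    refine ⟨?_, hy⟩
    rw [Real.dist_eq, abs_lt]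
    constructor <;> linarith [ht.1, ht.2]
  have hy0 : y0 ∈ Metric.ball y0 δ := Metric.mem_ball_self hδ
  have hmono : StrictMonoOn (fun t => ρ (Q (t, y0))) (Icc (t0 - δ / 2) (t0 + δ / 2)) := by
    refine strictMonoOn_of_deriv_pos (convex_Icc _ _) ?_ ?_
    · exact fun t _ => (hasDerivAt_comp_coordinates hρ.contDiff t y0).continuousAt.continuousWithinAt
    · intro t ht
      rw [interior_Icc] at ht
      rw [(hasDerivAt_comp_coordinates hρ.contDiff t y0).deriv]
      exact (hball _ (hin t (Ioo_subset_Icc_self ht) y0 hy0)).2.1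
  have hz : ρ (Q (t0, y0)) = 0 := by rw [hp0, hρ.eq_zero]
  have hm : ∀ t : ℝ, Continuous fun y : E2 => ρ (Q (t, y)) := fun t =>
    hρ.contDiff.continuous.comp (Q.continuous.comp (by fun_prop))
  have hneg : ρ (Q (t0 - δ / 2, y0)) < 0 := by
    have := hmono (a := t0 - δ / 2) (b := t0) ⟨by linarith, by linarith⟩
      ⟨by linarith, by linarith⟩ (by linarith)
    simpa [hz] using this
  have hpos : 0 < ρ (Q (t0 + δ / 2, y0)) := by
    have := hmono (a := t0) (b := t0 + δ / 2) ⟨by linarith, by linarith⟩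
      ⟨by linarith, by linarith⟩ (by linarith)
    simpa [hz] using this
  -- The signs at the two ends of the axis through x persist for nearby base points, so only the
  -- base is shrunk while the height interval is kept.
  obtain ⟨r, hr, hrb⟩ := Metric.eventually_nhds_iff_ball.1
    (((hm (t0 - δ / 2)).continuousAt.eventually (gt_mem_nhds hneg)).and
      (((hm (t0 + δ / 2)).continuousAt.eventually (lt_mem_nhds hpos)).and
        (Metric.ball_mem_nhds y0 hδ)))
  refine ⟨Q, t0 - δ / 2, t0 + δ / 2, Metric.ball y0 r, ?_, t0, ⟨by linarith, by linarith⟩,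
    y0, Metric.mem_ball_self hr, hp0⟩
  exact
    { contDiff := hρ.contDiff
      isOpen := Metric.isOpen_ball
      convex := convex_ball _ _
      bounded := Metric.isBounded_ball
      lt := by linarith
      norm_sq := hQn
      measurePreserving := hQm
      mem_iff := fun t ht y hy => (hball _ (hin t ht y (hrb y hy).2.2)).1
      slope_pos := fun t ht y hy => (hball _ (hin t ht y (hrb y hy).2.2)).2.1
      gradient_le := fun t ht y hy => (hball _ (hin t ht y (hrb y hy).2.2)).2.2.le
      neg := fun y hy => (hrb y hy).1
      pos := fun y hy => (hrb y hy).2.1 }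

namespace IsGraphPatch

variable {Ω : Set E3} {Q : (ℝ × E2) ≃L[ℝ] E3} {ρ : E3 → ℝ} {a b : ℝ} {B : Set E2}

theorem strictMonoOn (P : IsGraphPatch Ω Q ρ a b B) {y : E2} (hy : y ∈ B) :
    StrictMonoOn (fun t => ρ (Q (t, y))) (Icc a b) := by
  refine strictMonoOn_of_deriv_pos (convex_Icc _ _) ?_ ?_
  · exact fun t _ => (hasDerivAt_comp_coordinates P.contDiff t y).continuousAt.continuousWithinAt
  · intro t ht
    rw [interior_Icc] at ht
    rw [(hasDerivAt_comp_coordinates P.contDiff t y).deriv]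
    exact P.slope_pos t (Ioo_subset_Icc_self ht) y hy

/-- The boundary is the graph of a Lipschitz function. -/
theorem exists_height (P : IsGraphPatch Ω Q ρ a b B) :
    ∃ h : E2 → ℝ, LipschitzOnWith 2 h B ∧ ∀ y ∈ B, h y ∈ Ioo a b ∧ ρ (Q (h y, y)) = 0 := by
  have hex : ∀ y ∈ B, ∃ t ∈ Ioo a b, ρ (Q (t, y)) = 0 := by
    intro y hy
    have hc : ContinuousOn (fun t => ρ (Q (t, y))) (Icc a b) := fun t _ =>
      (hasDerivAt_comp_coordinates P.contDiff t y).continuousAt.continuousWithinAt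
    exact intermediate_value_Ioo P.lt.le hc ⟨P.neg y hy, P.pos y hy⟩
  choose! h hab hzero using hex
  refine ⟨h, ?_, fun y hy => ⟨hab y hy, hzero y hy⟩⟩
  refine LipschitzOnWith.of_dist_le_mul fun y hy z hz => ?_
  set c : ℝ →ᵃ[ℝ] ℝ × E2 := AffineMap.lineMap (h y, y) (h z, z) with hc
  have hcb : ∀ s ∈ Icc (0 : ℝ) 1, c s ∈ Icc a b ×ˢ B := fun s hs =>
    ((convex_Icc a b).prod P.convex).lineMap_mem
      ⟨Ioo_subset_Icc_self (hab y hy), hy⟩ ⟨Ioo_subset_Icc_self (hab z hz), hz⟩ hs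
  have hder : ∀ s, HasDerivAt (fun s => ρ (Q (c s)))
      (fderiv ℝ ρ (Q (c s)) (Q ((h z, z) - (h y, y)))) s := by
    intro s
    have h2 : HasFDerivAt ρ (fderiv ℝ ρ (Q (c s))) (Q (c s)) :=
      (P.contDiff.differentiable (by simp)).differentiableAt.hasFDerivAt
    have h1 : HasDerivAt (fun s : ℝ => Q (c s)) (Q ((h z, z) - (h y, y))) s :=
      (Q : (ℝ × E2) →L[ℝ] E3).hasFDerivAt.comp_hasDerivAt s AffineMap.hasDerivAt_lineMap
    exact h2.comp_hasDerivAt s h1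
  -- Rolle on the chord between two points of the graph: somewhere the height difference times the
  -- slope cancels the derivative of ρ along the base displacement. That derivative is at most |∇ρ|
  -- ≤ 2 · slope times the displacement, whence the Lipschitz constant 2.
  obtain ⟨s, hs, hs0⟩ := exists_hasDerivAt_eq_zero (f := fun s => ρ (Q (c s)))
    (f' := fun s => fderiv ℝ ρ (Q (c s)) (Q ((h z, z) - (h y, y)))) (zero_lt_one)
    (fun s _ => (hder s).continuousAt.continuousWithinAt)
    (by simp [hc, hzero y hy, hzero z hz]) (fun s _ => hder s)
  have hm := hcb s (Ioo_subset_Icc_self hs)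
  have hpos := P.slope_pos _ hm.1 _ hm.2
  have hle := P.gradient_le _ hm.1 _ hm.2
  have hsplit : Q ((h z, z) - (h y, y)) = (h z - h y) • Q (1, 0) + Q (0, z - y) := by
    rw [← map_smul, ← map_add]
    congr 1
    simp
  change 0 < fderiv ℝ ρ (Q (c s)) (Q (1, 0)) at hpos
  change ‖∇ ρ (Q (c s))‖ ≤ 2 * fderiv ℝ ρ (Q (c s)) (Q (1, 0)) at hle
  rw [hsplit, map_add, map_smul, smul_eq_mul] at hs0
  have hQ0 : ‖Q (0, z - y)‖ = ‖z - y‖ := by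
    have := P.norm_sq 0 (z - y)
    rw [zero_pow two_ne_zero, zero_add] at this
    exact (pow_left_inj₀ (norm_nonneg _) (norm_nonneg _) two_ne_zero).1 this
  have hb : |fderiv ℝ ρ (Q (c s)) (Q (0, z - y))| ≤
      2 * fderiv ℝ ρ (Q (c s)) (Q (1, 0)) * ‖z - y‖ := by
    have := (fderiv ℝ ρ (Q (c s))).le_opNorm (Q (0, z - y))
    rw [hQ0, ← norm_gradient, Real.norm_eq_abs] at this
    exact this.trans (by gcongr)
  rw [Real.dist_eq, abs_sub_comm, dist_comm, dist_eq_norm]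
  have h3 : |h z - h y| * fderiv ℝ ρ (Q (c s)) (Q (1, 0)) =
      |fderiv ℝ ρ (Q (c s)) (Q (0, z - y))| := by
    rw [← abs_of_pos hpos, ← abs_mul, eq_neg_of_add_eq_zero_left hs0, abs_neg]
  have h4 : |h z - h y| * fderiv ℝ ρ (Q (c s)) (Q (1, 0)) ≤
      (2 * ‖z - y‖) * fderiv ℝ ρ (Q (c s)) (Q (1, 0)) := by
    rw [h3]; linarith
  simpa using le_of_mul_le_mul_right h4 hpos

theorem eq_of_zero (P : IsGraphPatch Ω Q ρ a b B) {y : E2} (hy : y ∈ B) {s t : ℝ}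
    (hs : s ∈ Icc a b) (ht : t ∈ Icc a b) (h0 : ρ (Q (s, y)) = 0) (h1 : ρ (Q (t, y)) = 0) :
    s = t :=
  (P.strictMonoOn hy).injOn hs ht (h0.trans h1.symm)

theorem isOpen_box (P : IsGraphPatch Ω Q ρ a b B) : IsOpen (Q '' (Ioo a b ×ˢ B)) :=
  Q.toHomeomorph.isOpenMap _ (isOpen_Ioo.prod P.isOpen)

theorem isDefiningFunctionAt (P : IsGraphPatch Ω Q ρ a b B) {t : ℝ} {y : E2} (ht : t ∈ Ioo a b)
    (hy : y ∈ B) (h0 : ρ (Q (t, y)) = 0) : IsDefiningFunctionAt Ω (Q (t, y)) ρ where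
  contDiff := P.contDiff
  eq_zero := h0
  gradient_ne := by
    intro hg
    have h1 := P.slope_pos t (Ioo_subset_Icc_self ht) y hy
    have h2 : fderiv ℝ ρ (Q (t, y)) = 0 := by
      rw [← norm_eq_zero, ← norm_gradient, hg, norm_zero]
    simp [h2] at h1
  mem_iff := by
    filter_upwards [P.isOpen_box.mem_nhds (mem_image_of_mem Q (mk_mem_prod ht hy))] with z hz
    obtain ⟨⟨s, v⟩, ⟨hs, hv⟩, rfl⟩ := hz
    exact P.mem_iff s (Ioo_subset_Icc_self hs) v hv

theorem mem_frontier (P : IsGraphPatch Ω Q ρ a b B) {t : ℝ} {y : E2} (ht : t ∈ Ioo a b)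
    (hy : y ∈ B) (h0 : ρ (Q (t, y)) = 0) : Q (t, y) ∈ frontier Ω := by
  rw [frontier_eq_closure_inter_closure]
  refine ⟨subset_closure ((P.mem_iff t (Ioo_subset_Icc_self ht) y hy).2 h0.le), ?_⟩
  have hc : Tendsto (fun s : ℝ => Q (s, y)) (𝓝[>] t) (𝓝 (Q (t, y))) := by
    have : Continuous (fun s : ℝ => Q (s, y)) := Q.continuous.comp (by fun_prop)
    exact (this.tendsto t).mono_left nhdsWithin_le_nhds
  refine mem_closure_of_tendsto hc ?_
  filter_upwards [Ioo_mem_nhdsGT ht.2] with s hs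
  have hs' : s ∈ Icc a b := ⟨(ht.1.trans hs.1).le, hs.2.le⟩
  have := P.strictMonoOn hy (Ioo_subset_Icc_self ht) hs' hs.1
  simp only [h0] at this
  exact fun hmem => absurd ((P.mem_iff s hs' y hy).1 hmem) (not_le.2 this)

theorem zero_of_mem_frontier (P : IsGraphPatch Ω Q ρ a b B) {t : ℝ} {y : E2} (ht : t ∈ Ioo a b)
    (hy : y ∈ B) (hf : Q (t, y) ∈ frontier Ω) : ρ (Q (t, y)) = 0 := by
  have hnb := P.isOpen_box.mem_nhds (mem_image_of_mem Q (mk_mem_prod ht hy))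
  have hev : ∀ᶠ z in 𝓝 (Q (t, y)), z ∈ Ω ↔ ρ z ≤ 0 := by
    filter_upwards [hnb] with z hz
    obtain ⟨⟨s, v⟩, ⟨hs, hv⟩, rfl⟩ := hz
    exact P.mem_iff s (Ioo_subset_Icc_self hs) v hv
  exact eq_zero_of_mem_frontier P.contDiff.continuous.continuousAt hev hf

end IsGraphPatch

end

/-! ### The smooth step and the divergence on the whole space -/

section

/-- The derivative of the smooth step function: a bump of mass one on `[0, 1]`. -/
def stepDeriv : ℝ → ℝ := deriv Real.smoothTransition

theorem hasDerivAt_smoothTransition (s : ℝ) :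
    HasDerivAt Real.smoothTransition (stepDeriv s) s :=
  ((Real.smoothTransition.contDiff (n := 1)).differentiable (by simp)).differentiableAt.hasDerivAt

theorem contDiff_stepDeriv : ContDiff ℝ ∞ stepDeriv := by
  have h : ContDiff ℝ (∞ + 1) Real.smoothTransition := Real.smoothTransition.contDiff (n := ⊤)
  exact (contDiff_succ_iff_deriv.1 h).2.2

theorem continuous_stepDeriv : Continuous stepDeriv := contDiff_stepDeriv.continuous

theorem stepDeriv_nonneg (s : ℝ) : 0 ≤ stepDeriv s := Real.smoothTransition.monotone.deriv_nonneg

theorem stepDeriv_of_neg {s : ℝ} (hs : s < 0) : stepDeriv s = 0 := by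
  have : Real.smoothTransition =ᶠ[𝓝 s] fun _ => 0 := by
    filter_upwards [gt_mem_nhds hs] with t ht using Real.smoothTransition.zero_of_nonpos ht.le
  rw [stepDeriv, this.deriv_eq, deriv_const]

theorem stepDeriv_of_one_lt {s : ℝ} (hs : 1 < s) : stepDeriv s = 0 := by
  have : Real.smoothTransition =ᶠ[𝓝 s] fun _ => 1 := by
    filter_upwards [lt_mem_nhds hs] with t ht using Real.smoothTransition.one_of_one_le ht.le
  rw [stepDeriv, this.deriv_eq, deriv_const]

theorem stepDeriv_of_nonpos {s : ℝ} (hs : s ≤ 0) : stepDeriv s = 0 := by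
  have h : IsClosed {s : ℝ | stepDeriv s = 0} := isClosed_eq continuous_stepDeriv continuous_const
  have h2 : closure (Iio (0 : ℝ)) ⊆ {s : ℝ | stepDeriv s = 0} :=
    h.closure_subset_iff.2 fun t ht => stepDeriv_of_neg ht
  rw [closure_Iio] at h2
  exact h2 hs

theorem stepDeriv_of_one_le {s : ℝ} (hs : 1 ≤ s) : stepDeriv s = 0 := by
  have h : IsClosed {s : ℝ | stepDeriv s = 0} := isClosed_eq continuous_stepDeriv continuous_const
  have h2 : closure (Ioi (1 : ℝ)) ⊆ {s : ℝ | stepDeriv s = 0} :=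
    h.closure_subset_iff.2 fun t ht => stepDeriv_of_one_lt ht
  rw [closure_Ioi] at h2
  exact h2 hs

variable {V : Type*} [NormedAddCommGroup V] [NormedSpace ℝ V]

/-- The standard basis of `ℝ³`. -/
def stdB : OrthonormalBasis (Fin 3) ℝ E3 := EuclideanSpace.basisFun (Fin 3) ℝ

/-- The divergence of a vector-valued field of linear forms on `ℝ³`. -/
def divg (F : E3 → E3 →L[ℝ] V) (x : E3) : V := ∑ j, fderiv ℝ F x (stdB j) (stdB j)

theorem sum_fderiv_smul (φ : E3 → ℝ) (A : E3 →L[ℝ] V) (x : E3) :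
    ∑ j, fderiv ℝ φ x (stdB j) • A (stdB j) = A (∇ φ x) := by
  have h : ∇ φ x = ∑ j, fderiv ℝ φ x (stdB j) • stdB j := by
    conv_lhs => rw [← stdB.sum_repr' (∇ φ x)]
    refine Finset.sum_congr rfl fun j _ => ?_
    rw [real_inner_comm]
    simp [gradient]
  rw [h, map_sum]
  simp only [map_smul]

theorem divg_congr {F G : E3 → E3 →L[ℝ] V} {x : E3} (h : F =ᶠ[𝓝 x] G) : divg F x = divg G x := by
  simp only [divg, h.fderiv_eq]

theorem divg_zero (x : E3) : divg (fun _ => (0 : E3 →L[ℝ] V)) x = 0 := by simp [divg]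

theorem divg_smul {φ : E3 → ℝ} {F : E3 → E3 →L[ℝ] V} {x : E3} (hφ : DifferentiableAt ℝ φ x)
    (hF : DifferentiableAt ℝ F x) :
    divg (fun y => φ y • F y) x = φ x • divg F x + F x (∇ φ x) := by
  simp only [divg]
  rw [fderiv_fun_smul hφ hF, ← sum_fderiv_smul, Finset.smul_sum, ← Finset.sum_add_distrib]
  simp

theorem divg_sum {ι : Type*} {s : Finset ι} {F : ι → E3 → E3 →L[ℝ] V} {x : E3}
    (hF : ∀ i ∈ s, DifferentiableAt ℝ (F i) x) :
    divg (fun y => ∑ i ∈ s, F i y) x = ∑ i ∈ s, divg (F i) x := by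
  simp only [divg]
  rw [fderiv_fun_sum hF, Finset.sum_comm]
  simp

theorem continuousOn_divg {F : E3 → E3 →L[ℝ] V} {U : Set E3} (hU : IsOpen U)
    (hF : ContDiffOn ℝ 1 F U) : ContinuousOn (divg F) U := by
  have h := hF.continuousOn_fderiv_of_isOpen hU le_rfl
  unfold divg
  refine continuousOn_finsetSum _ fun j _ => ?_
  exact (h.clm_apply continuousOn_const).clm_apply continuousOn_const

theorem divg_eq_zero_of_notMem_tsupport {F : E3 → E3 →L[ℝ] V} {x : E3} (hx : x ∉ tsupport F) :
    divg F x = 0 := by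
  rw [divg_congr (notMem_tsupport_iff_eventuallyEq.1 hx)]
  exact divg_zero x

theorem integrable_divg {F : E3 → E3 →L[ℝ] V} (hF : ContDiff ℝ 1 F) (hc : HasCompactSupport F) :
    Integrable (divg F) := by
  have h : Continuous (divg F) := continuousOn_univ.1 (continuousOn_divg isOpen_univ hF.contDiffOn)
  exact h.integrable_of_hasCompactSupport
    (hc.mono' fun x hx => by_contra fun hx' => hx (divg_eq_zero_of_notMem_tsupport hx'))

theorem integral_divg_eq_zero {F : E3 → E3 →L[ℝ] V} (hF : ContDiff ℝ 1 F)
    (hc : HasCompactSupport F) : ∫ x, divg F x = 0 := by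
  have hd : Differentiable ℝ F := hF.differentiable (by simp)
  have hfc : Continuous (fderiv ℝ F) := hF.continuous_fderiv (by simp)
  have hint : ∀ j, Integrable fun x => fderiv ℝ F x (stdB j) (stdB j) := fun j =>
    ((hfc.clm_apply continuous_const).clm_apply continuous_const).integrable_of_hasCompactSupport
      (((hc.fderiv ℝ).comp_left (g := fun A : E3 →L[ℝ] E3 →L[ℝ] V => A (stdB j) (stdB j)) (by simp)))
  simp only [divg]
  rw [integral_finsetSum _ fun j _ => hint j]
  refine Finset.sum_eq_zero fun j _ => ?_
  have hg : ∀ x, fderiv ℝ (fun y => F y (stdB j)) x (stdB j) = fderiv ℝ F x (stdB j) (stdB j) := by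
    intro x
    rw [fderiv_clm_apply (hd x) (differentiableAt_const _)]
    simp
  have hgi : Integrable fun x => F x (stdB j) :=
    (hF.continuous.clm_apply continuous_const).integrable_of_hasCompactSupport
      (hc.comp_left (g := fun A : E3 →L[ℝ] V => A (stdB j)) (by simp))
  have key := integral_smul_fderiv_eq_neg_fderiv_smul_of_integrable (μ := (volume : Measure E3))
    (f := fun _ : E3 => (1 : ℝ)) (g := fun x => F x (stdB j)) (v := stdB j)
    (by simp) (by simpa [hg] using hint j) (by simpa using hgi)
    (fun x _ => differentiableAt_const _)
    (fun x _ => (hd x).clm_apply (differentiableAt_const _))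
  simpa [hg] using key

end

/-! ### The divergence theorem for a field supported in one patch -/

section

variable {V : Type*} [NormedAddCommGroup V] [NormedSpace ℝ V]

/-- The integrand is the derivative of S(f/ε - 1), S the smooth step, and S(-1) = 0 removes the
lower limit. The shift by -1 places the layer at ε ≤ f ≤ 2ε, strictly away from the zero of f. -/
theorem integral_stepDeriv_comp {f f' : ℝ → ℝ} {h b ε : ℝ} (hb : h < b)
    (hf : ∀ t, HasDerivAt f (f' t) t) (hf'c : Continuous f') (h0 : f h = 0) :
    ∫ t in Ioo h b, stepDeriv (f t / ε - 1) / ε * f' t =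
      Real.smoothTransition (f b / ε - 1) := by
  have hfc : Continuous f := continuous_iff_continuousAt.2 fun t => (hf t).continuousAt
  rw [← integral_Ioc_eq_integral_Ioo, ← intervalIntegral.integral_of_le hb.le]
  have hd : ∀ t ∈ uIcc h b, HasDerivAt (fun t => Real.smoothTransition (f t / ε - 1))
      (stepDeriv (f t / ε - 1) / ε * f' t) t := by
    intro t _
    have h1 := (hasDerivAt_smoothTransition (f t / ε - 1)).comp t
      (((hf t).div_const ε).sub_const 1)
    exact h1.congr_deriv (by ring)
  rw [intervalIntegral.integral_eq_sub_of_hasDerivAt hd]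
  · simp [h0, Real.smoothTransition.zero_of_nonpos]
  · refine Continuous.intervalIntegrable ?_ _ _
    exact ((continuous_stepDeriv.comp (by fun_prop)).div_const ε).mul hf'c

/-- The densities `(S (f / ε - 1))'` concentrate at the right of the zero `h` of `f`. -/
theorem tendsto_integral_stepDeriv [CompleteSpace V] {f f' : ℝ → ℝ} {h b : ℝ} (hb : h < b)
    (hf : ∀ t, HasDerivAt f (f' t) t) (hf'c : Continuous f') (hpos : ∀ t ∈ Icc h b, 0 < f' t)
    (h0 : f h = 0) {q : ℝ → V} (hq : IntegrableOn q (Ioo h b)) {L : V}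
    (hL : Tendsto q (𝓝[Ioo h b] h) (𝓝 L)) :
    Tendsto (fun ε => ∫ t in Ioo h b, (stepDeriv (f t / ε - 1) / ε * f' t) • q t) (𝓝[>] 0)
      (𝓝 L) := by
  have hfc : Continuous f := continuous_iff_continuousAt.2 fun t => (hf t).continuousAt
  have hmono : StrictMonoOn f (Icc h b) := by
    refine strictMonoOn_of_deriv_pos (convex_Icc _ _) hfc.continuousOn fun t ht => ?_
    rw [interior_Icc] at ht
    rw [(hf t).deriv]
    exact hpos t (Ioo_subset_Icc_self ht)
  -- The kernels are a one-sided approximate identity at h: nonnegative, zero away from h once ε is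
  -- small because f is strictly increasing, and of mass exactly one as soon as 2ε < f b.
  refine tendsto_setIntegral_peak_smul_of_integrableOn_of_tendsto (t := Ioo h b)
    measurableSet_Ioo measurableSet_Ioo subset_rfl self_mem_nhdsWithin (by simp) ?_ ?_ ?_ ?_ hq hL
  · filter_upwards [self_mem_nhdsWithin] with ε (hε : 0 < ε) t ht
    exact mul_nonneg (div_nonneg (stepDeriv_nonneg _) hε.le) (hpos t (Ioo_subset_Icc_self ht)).le
  · intro u hu hhu
    rw [Metric.tendstoUniformlyOn_iff]
    intro e he
    obtain ⟨δ, hδ, hball⟩ := Metric.isOpen_iff.1 hu h hhu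
    set c := min (h + δ / 2) b with hc
    have hhc : h < c := lt_min (by linarith) hb
    have hfcpos : 0 < f c := by
      rw [← h0]
      exact hmono ⟨le_rfl, hb.le⟩ ⟨hhc.le, min_le_right _ _⟩ hhc
    have hev : ∀ᶠ ε : ℝ in 𝓝[>] 0, ε < f c / 2 :=
      nhdsWithin_le_nhds (gt_mem_nhds (by linarith))
    filter_upwards [hev, self_mem_nhdsWithin] with ε hε (hε0 : 0 < ε) t ht
    have htc : c ≤ t := by
      by_contra hlt
      push Not at hlt
      refine ht.2 (hball ?_)
      rw [Metric.mem_ball, Real.dist_eq, abs_lt]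
      have : t < h + δ / 2 := hlt.trans_le (min_le_left _ _)
      constructor <;> linarith [ht.1.1]
    have hft : f c ≤ f t := hmono.monotoneOn ⟨hhc.le, min_le_right _ _⟩
      (Ioo_subset_Icc_self ht.1) htc
    have h2 : 2 ≤ f t / ε := by
      rw [le_div_iff₀ hε0]; linarith
    have h3 : stepDeriv (f t / ε - 1) = 0 := stepDeriv_of_one_le (by linarith)
    simpa [h3] using he
  · have hev : ∀ᶠ ε : ℝ in 𝓝[>] 0, 1 = ∫ t in Ioo h b, stepDeriv (f t / ε - 1) / ε * f' t := by
      have hfb : 0 < f b := by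
        rw [← h0]
        exact hmono ⟨le_rfl, hb.le⟩ ⟨hb.le, le_rfl⟩ hb
      have hev : ∀ᶠ ε : ℝ in 𝓝[>] 0, ε < f b / 2 :=
        nhdsWithin_le_nhds (gt_mem_nhds (by linarith))
      filter_upwards [hev, self_mem_nhdsWithin] with ε hε (hε0 : 0 < ε)
      rw [integral_stepDeriv_comp hb hf hf'c h0]
      have h2 : 2 ≤ f b / ε := by
        rw [le_div_iff₀ hε0]; linarith
      rw [Real.smoothTransition.one_of_one_le (by linarith)]
    exact tendsto_const_nhds.congr' hev
  · refine Eventually.of_forall fun ε => Continuous.aestronglyMeasurable ?_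
    exact ((continuous_stepDeriv.comp (by fun_prop)).div_const ε).mul hf'c

/-- A compactly supported field of linear forms on the closed exterior of `Ω` to which the
divergence theorem applies. -/
structure IsExteriorField (Ω : Set E3) (F : E3 → E3 →L[ℝ] V) : Prop where
  hasCompactSupport : HasCompactSupport F
  continuousOn : ContinuousOn F (closure Ωᶜ)
  contDiffOn : ContDiffOn ℝ 1 F Ωᶜ
  integrableOn : IntegrableOn (divg F) Ωᶜ

theorem IsExteriorField.exists_bound {Ω : Set E3} {F : E3 → E3 →L[ℝ] V}
    (hF : IsExteriorField Ω F) : ∃ M, 0 ≤ M ∧ ∀ x ∈ closure Ωᶜ, ‖F x‖ ≤ M := by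
  obtain ⟨M, hM⟩ := (hF.hasCompactSupport.isCompact.inter_right
    isClosed_closure).exists_bound_of_continuousOn (hF.continuousOn.mono inter_subset_right)
  refine ⟨max M 0, le_max_right _ _, fun x hx => ?_⟩
  by_cases hxs : x ∈ tsupport F
  · exact (hM x ⟨hxs, hx⟩).trans (le_max_left _ _)
  · rw [image_eq_zero_of_notMem_tsupport hxs, norm_zero]
    exact le_max_right _ _

/-- A smooth function that vanishes where `ρ ≤ ε` and equals one where `ρ ≥ 2 ε`. -/
def cutoff (ρ : E3 → ℝ) (ε : ℝ) (x : E3) : ℝ := Real.smoothTransition (ρ x / ε - 1)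

/-- The flux of `F` across the layer where the cutoff varies. -/
def layerFlux (ρ : E3 → ℝ) (F : E3 → E3 →L[ℝ] V) (ε : ℝ) (x : E3) : V :=
  (stepDeriv (ρ x / ε - 1) / ε) • F x (∇ ρ x)

section cutoff

variable {ρ : E3 → ℝ} {ε : ℝ}

theorem contDiff_cutoff (hρ : ContDiff ℝ ∞ ρ) (ε : ℝ) : ContDiff ℝ 1 (cutoff ρ ε) :=
  (Real.smoothTransition.contDiff (n := 1)).comp
    (((hρ.of_le (by simp)).div_const ε).sub contDiff_const)

theorem abs_cutoff_le (ρ : E3 → ℝ) (ε : ℝ) (x : E3) : ‖cutoff ρ ε x‖ ≤ 1 := by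
  rw [cutoff, Real.norm_eq_abs, abs_of_nonneg (Real.smoothTransition.nonneg _)]
  exact Real.smoothTransition.le_one _

theorem gradient_cutoff (hρ : ContDiff ℝ ∞ ρ) (ε : ℝ) (x : E3) :
    ∇ (cutoff ρ ε) x = (stepDeriv (ρ x / ε - 1) / ε) • ∇ ρ x := by
  have h2 : HasFDerivAt ρ (fderiv ℝ ρ x) x :=
    (hρ.differentiable (by simp)).differentiableAt.hasFDerivAt
  have h3 : HasDerivAt (fun s : ℝ => Real.smoothTransition (s / ε - 1))
      (stepDeriv (ρ x / ε - 1) * (1 / ε)) (ρ x) :=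
    HasDerivAt.comp (h := fun s : ℝ => s / ε - 1) (ρ x)
      (hasDerivAt_smoothTransition (ρ x / ε - 1))
      (((hasDerivAt_id' (ρ x)).div_const ε).sub_const 1)
  have h1 : HasFDerivAt (cutoff ρ ε) ((stepDeriv (ρ x / ε - 1) * (1 / ε)) • fderiv ℝ ρ x) x :=
    h3.comp_hasFDerivAt x h2
  simp only [gradient, h1.fderiv, map_smul, div_eq_mul_inv, one_mul]

theorem cutoff_eventuallyEq_zero (hρ : Continuous ρ) (hε : 0 < ε) {x : E3} (hx : ρ x ≤ 0) :
    cutoff ρ ε =ᶠ[𝓝 x] fun _ => 0 := by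
  filter_upwards [hρ.continuousAt.eventually (gt_mem_nhds (hx.trans_lt hε))] with z hz
  refine Real.smoothTransition.zero_of_nonpos ?_
  have : ρ z / ε < 1 := by rwa [div_lt_one hε]
  linarith

theorem eventually_cutoff_eq_one {x : E3} (hx : 0 < ρ x) : ∀ᶠ ε in 𝓝[>] 0, cutoff ρ ε x = 1 := by
  have hev : ∀ᶠ ε : ℝ in 𝓝[>] 0, ε < ρ x / 2 := nhdsWithin_le_nhds (gt_mem_nhds (by linarith))
  filter_upwards [hev, self_mem_nhdsWithin] with ε hε (hε0 : 0 < ε)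
  have h2 : 2 ≤ ρ x / ε := by
    rw [le_div_iff₀ hε0]; linarith
  exact Real.smoothTransition.one_of_one_le (by linarith)

variable {Ω : Set E3} {F : E3 → E3 →L[ℝ] V}

theorem cutoff_smul_eventuallyEq_zero (hρ : Continuous ρ)
    (hpos : ∀ x ∈ tsupport F, (x ∈ Ω ↔ ρ x ≤ 0))
    (hε : 0 < ε) {x : E3} (hx : x ∈ Ω) : (fun y => cutoff ρ ε y • F y) =ᶠ[𝓝 x] fun _ => 0 := by
  by_cases hxs : x ∈ tsupport F
  · filter_upwards [cutoff_eventuallyEq_zero hρ hε ((hpos x hxs).1 hx)] with z hz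
    rw [hz, zero_smul]
  · filter_upwards [notMem_tsupport_iff_eventuallyEq.1 hxs] with z hz
    simp [hz]

theorem integrableOn_cutoff_smul (hF : IsExteriorField Ω F) (hρ : ContDiff ℝ ∞ ρ) (ε : ℝ) :
    IntegrableOn (fun x => cutoff ρ ε x • divg F x) Ωᶜ :=
  Integrable.bdd_smul hF.integrableOn 1
    (contDiff_cutoff hρ ε).continuous.aestronglyMeasurable
    (Eventually.of_forall fun x => abs_cutoff_le ρ ε x)

/-- F is controlled only in the exterior, but the cutoff vanishes in a neighbourhood of every point
of Ω in the support of F, so the product is C¹ on all of space. -/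
theorem contDiff_cutoff_smul (hΩ : IsClosed Ω) (hF : IsExteriorField Ω F) (hρ : ContDiff ℝ ∞ ρ)
    (hpos : ∀ x ∈ tsupport F, (x ∈ Ω ↔ ρ x ≤ 0)) (hε : 0 < ε) :
    ContDiff ℝ 1 (fun y => cutoff ρ ε y • F y) := by
  rw [contDiff_iff_contDiffAt]
  intro x
  by_cases hx : x ∈ Ω
  · exact contDiffAt_const.congr_of_eventuallyEq
      (cutoff_smul_eventuallyEq_zero hρ.continuous hpos hε hx)
  · exact (contDiff_cutoff hρ ε).contDiffAt.smul
      (hF.contDiffOn.contDiffAt (hΩ.isOpen_compl.mem_nhds hx))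

theorem divg_cutoff_smul (hΩ : IsClosed Ω) (hF : IsExteriorField Ω F) (hρ : ContDiff ℝ ∞ ρ)
    {x : E3} (hx : x ∈ Ωᶜ) : divg (fun y => cutoff ρ ε y • F y) x =
      cutoff ρ ε x • divg F x + layerFlux ρ F ε x := by
  rw [divg_smul ((contDiff_cutoff hρ ε).differentiable (by simp)).differentiableAt
    ((hF.contDiffOn.contDiffAt (hΩ.isOpen_compl.mem_nhds hx)).differentiableAt (by simp)),
    gradient_cutoff hρ, map_smul, layerFlux]

theorem integrableOn_layerFlux (hΩ : IsClosed Ω) (hF : IsExteriorField Ω F) (hρ : ContDiff ℝ ∞ ρ)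
    (hpos : ∀ x ∈ tsupport F, (x ∈ Ω ↔ ρ x ≤ 0)) (hε : 0 < ε) :
    IntegrableOn (layerFlux ρ F ε) Ωᶜ := by
  have hGcs : HasCompactSupport (fun y => cutoff ρ ε y • F y) :=
    hF.hasCompactSupport.mono fun y hy hFy => hy (by simp [hFy])
  have h1 := ((integrable_divg (contDiff_cutoff_smul hΩ hF hρ hpos hε) hGcs).integrableOn
    (s := Ωᶜ)).sub (integrableOn_cutoff_smul hF hρ ε)
  refine h1.congr ?_
  filter_upwards [ae_restrict_mem hΩ.isOpen_compl.measurableSet] with x hx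
  rw [Pi.sub_apply, divg_cutoff_smul hΩ hF hρ hx, add_sub_cancel_left]

/-- The cut-off field is C¹ with compact support, so its divergence has total integral zero. By the
product rule that divergence is the cut-off divergence plus the flux through the layer. As ε tends
to 0 the layer flux becomes the boundary term. -/
theorem setIntegral_layerFlux (hΩ : IsClosed Ω) (hF : IsExteriorField Ω F) (hρ : ContDiff ℝ ∞ ρ)
    (hpos : ∀ x ∈ tsupport F, (x ∈ Ω ↔ ρ x ≤ 0)) (hε : 0 < ε) :
    ∫ x in Ωᶜ, layerFlux ρ F ε x = - ∫ x in Ωᶜ, cutoff ρ ε x • divg F x := by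
  have hGcs : HasCompactSupport (fun y => cutoff ρ ε y • F y) :=
    hF.hasCompactSupport.mono fun y hy hFy => hy (by simp [hFy])
  have h1 : ∫ x in Ωᶜ, divg (fun y => cutoff ρ ε y • F y) x = 0 := by
    rw [← integral_divg_eq_zero (contDiff_cutoff_smul hΩ hF hρ hpos hε) hGcs]
    refine setIntegral_eq_integral_of_forall_compl_eq_zero fun x hx => ?_
    rw [divg_congr (cutoff_smul_eventuallyEq_zero hρ.continuous hpos hε (not_not.1 hx)), divg_zero]
  have h2 : ∫ x in Ωᶜ, divg (fun y => cutoff ρ ε y • F y) x =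
      (∫ x in Ωᶜ, cutoff ρ ε x • divg F x) + ∫ x in Ωᶜ, layerFlux ρ F ε x :=
    (setIntegral_congr_fun hΩ.isOpen_compl.measurableSet fun x hx =>
      divg_cutoff_smul hΩ hF hρ hx).trans
    (integral_add (integrableOn_cutoff_smul hF hρ ε) (integrableOn_layerFlux hΩ hF hρ hpos hε))
  exact eq_neg_of_add_eq_zero_right (h2.symm.trans h1)

theorem tendsto_integral_cutoff (hΩ : IsClosed Ω) (hF : IsExteriorField Ω F) (hρ : ContDiff ℝ ∞ ρ)
    (hpos : ∀ x ∈ tsupport F, (x ∈ Ω ↔ ρ x ≤ 0)) :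
    Tendsto (fun ε => ∫ x in Ωᶜ, cutoff ρ ε x • divg F x) (𝓝[>] 0)
      (𝓝 (∫ x in Ωᶜ, divg F x)) := by
  have hmΩ : MeasurableSet Ωᶜ := hΩ.isOpen_compl.measurableSet
  refine tendsto_integral_filter_of_dominated_convergence (fun x => ‖divg F x‖)
    (Eventually.of_forall fun ε => (integrableOn_cutoff_smul hF hρ ε).aestronglyMeasurable) ?_
    hF.integrableOn.norm ?_
  · refine Eventually.of_forall fun ε => Eventually.of_forall fun x => ?_
    rw [norm_smul]
    exact mul_le_of_le_one_left (norm_nonneg _) (abs_cutoff_le ρ ε x)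
  · filter_upwards [ae_restrict_mem hmΩ] with x hx
    by_cases hxs : x ∈ tsupport F
    · have hρx : 0 < ρ x := by
        by_contra hle
        exact hx ((hpos x hxs).2 (not_lt.1 hle))
      refine tendsto_const_nhds.congr' ?_
      filter_upwards [eventually_cutoff_eq_one hρx] with ε hε
      rw [hε, one_smul]
    · simp [divg_eq_zero_of_notMem_tsupport hxs]

end cutoff

namespace IsGraphPatch

variable {Ω : Set E3} {Q : (ℝ × E2) ≃L[ℝ] E3} {ρ : E3 → ℝ} {a b : ℝ} {B : Set E2}
  {F : E3 → E3 →L[ℝ] V} {h : E2 → ℝ}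

theorem mem_iff_of_mem_tsupport (P : IsGraphPatch Ω Q ρ a b B)
    (hs : tsupport F ⊆ Q '' (Ioo a b ×ˢ B)) : ∀ x ∈ tsupport F, (x ∈ Ω ↔ ρ x ≤ 0) := by
  intro x hx
  obtain ⟨⟨t, y⟩, ⟨ht, hy⟩, rfl⟩ := hs hx
  exact P.mem_iff t (Ioo_subset_Icc_self ht) y hy

theorem eq_zero_of_notMem_box (hs : tsupport F ⊆ Q '' (Ioo a b ×ˢ B)) {t : ℝ} {y : E2}
    (hty : ¬ (t ∈ Ioo a b ∧ y ∈ B)) : F (Q (t, y)) = 0 := by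
  by_contra hne
  obtain ⟨⟨s, v⟩, hsv, hQ⟩ := hs (subset_tsupport F hne)
  obtain ⟨rfl, rfl⟩ := Prod.mk.inj (Q.injective hQ)
  exact hty hsv

/-- The flux of `F` through the graph, per unit area of the base. -/
def normalFlux (Q : (ℝ × E2) ≃L[ℝ] E3) (ρ : E3 → ℝ) (F : E3 → E3 →L[ℝ] V) (p : ℝ × E2) : V :=
  F (Q p) ((fderiv ℝ ρ (Q p) (Q (1, 0)))⁻¹ • ∇ ρ (Q p))

theorem continuous_slope (P : IsGraphPatch Ω Q ρ a b B) (y : E2) :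
    Continuous fun t : ℝ => fderiv ℝ ρ (Q (t, y)) (Q (1, 0)) := by
  have h1 : Continuous (fderiv ℝ ρ) := P.contDiff.continuous_fderiv (by simp)
  exact (h1.comp (Q.continuous.comp (by fun_prop))).clm_apply continuous_const

theorem notMem_of_height_lt (P : IsGraphPatch Ω Q ρ a b B)
    (hh : ∀ y ∈ B, h y ∈ Ioo a b ∧ ρ (Q (h y, y)) = 0) {t : ℝ} {y : E2} (hy : y ∈ B)
    (ht : t ∈ Ioc (h y) b) : Q (t, y) ∈ Ωᶜ := by
  have hta : t ∈ Icc a b := ⟨((hh y hy).1.1.trans ht.1).le, ht.2⟩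
  have h1 := P.strictMonoOn hy (Ioo_subset_Icc_self (hh y hy).1) hta ht.1
  simp only [(hh y hy).2] at h1
  exact fun hm => absurd ((P.mem_iff t hta y hy).1 hm) (not_le.2 h1)

theorem norm_normalFlux_le (P : IsGraphPatch Ω Q ρ a b B) {M : ℝ}
    (hM : ∀ x ∈ closure Ωᶜ, ‖F x‖ ≤ M) {t : ℝ} (ht : t ∈ Icc a b) {y : E2} (hy : y ∈ B)
    (hm : Q (t, y) ∈ closure Ωᶜ) : ‖normalFlux Q ρ F (t, y)‖ ≤ M * 2 := by
  have hsl := P.slope_pos t ht y hy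
  refine ((F (Q (t, y))).le_opNorm _).trans ?_
  refine mul_le_mul (hM _ hm) ?_ (norm_nonneg _) ((norm_nonneg _).trans (hM _ hm))
  rw [norm_smul, norm_inv, Real.norm_eq_abs, abs_of_pos hsl, inv_mul_le_iff₀ hsl, mul_comm]
  exact P.gradient_le t ht y hy

theorem continuousOn_normalFlux (P : IsGraphPatch Ω Q ρ a b B)
    (hh : ∀ y ∈ B, h y ∈ Ioo a b ∧ ρ (Q (h y, y)) = 0) (hF : ContinuousOn F (closure Ωᶜ))
    {y : E2} (hy : y ∈ B) : ContinuousOn (fun t => normalFlux Q ρ F (t, y)) (Ico (h y) b) := by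
  have hIcc : ∀ t ∈ Ico (h y) b, t ∈ Icc a b := fun t ht =>
    ⟨((hh y hy).1.1.trans_le ht.1).le, ht.2.le⟩
  have hmaps : MapsTo (fun t : ℝ => Q (t, y)) (Ico (h y) b) (closure Ωᶜ) := by
    intro t ht
    rcases eq_or_lt_of_le ht.1 with h1 | h1
    · have := P.mem_frontier (hh y hy).1 hy (hh y hy).2
      rw [frontier_eq_closure_inter_closure] at this
      rw [← h1]
      exact this.2
    · exact subset_closure (P.notMem_of_height_lt hh hy ⟨h1, ht.2.le⟩)
  have hQc : Continuous (fun t : ℝ => Q (t, y)) := Q.continuous.comp (by fun_prop)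
  have hgc : Continuous (fun x => ∇ ρ x) := continuous_gradient (P.contDiff.of_le (by simp))
  refine (hF.comp hQc.continuousOn hmaps).clm_apply ?_
  have hinv : ContinuousOn (fun t : ℝ => (fderiv ℝ ρ (Q (t, y)) (Q (1, 0)))⁻¹) (Ico (h y) b) :=
    (P.continuous_slope y).continuousOn.inv₀ fun t ht => (P.slope_pos t (hIcc t ht) y hy).ne'
  exact hinv.smul (hgc.comp hQc).continuousOn

/-- Below the graph the line lies in Ω, and outside the box F vanishes, so only the part above the
graph counts. Multiplying and dividing by the slope exhibits the kernel of
`tendsto_integral_stepDeriv`. -/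
theorem integral_layerFlux_fiber (P : IsGraphPatch Ω Q ρ a b B)
    (hh : ∀ y ∈ B, h y ∈ Ioo a b ∧ ρ (Q (h y, y)) = 0)
    (hs : tsupport F ⊆ Q '' (Ioo a b ×ˢ B)) (ε : ℝ) {y : E2} (hy : y ∈ B) :
    ∫ t, Ωᶜ.indicator (layerFlux ρ F ε) (Q (t, y)) =
      ∫ t in Ioo (h y) b, (stepDeriv (ρ (Q (t, y)) / ε - 1) / ε *
        fderiv ℝ ρ (Q (t, y)) (Q (1, 0))) • normalFlux Q ρ F (t, y) := by
  rw [← setIntegral_eq_integral_of_forall_compl_eq_zero (s := Ioo (h y) b)]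
  · refine setIntegral_congr_fun measurableSet_Ioo fun t ht => ?_
    have hsl := P.slope_pos t ⟨((hh y hy).1.1.trans ht.1).le, ht.2.le⟩ y hy
    simp only [indicator_of_mem (P.notMem_of_height_lt hh hy ⟨ht.1, ht.2.le⟩), layerFlux,
      normalFlux, map_smul, smul_smul]
    congr 1
    rw [mul_assoc, mul_inv_cancel₀ hsl.ne', mul_one]
  · intro t ht
    by_cases hta : t ∈ Ioo a b
    · have hle : t ≤ h y := by
        by_contra hlt
        exact ht ⟨not_le.1 hlt, hta.2⟩
      have h1 := (P.strictMonoOn hy).monotoneOn (Ioo_subset_Icc_self hta)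
        (Ioo_subset_Icc_self (hh y hy).1) hle
      simp only [(hh y hy).2] at h1
      refine indicator_of_notMem ?_ _
      exact not_not.2 ((P.mem_iff t (Ioo_subset_Icc_self hta) y hy).2 h1)
    · rw [indicator_apply_eq_zero]
      intro _
      simp [layerFlux, eq_zero_of_notMem_box hs (fun hc => hta hc.1)]

/-- The kernel has mass at most one and ∇ρ divided by the slope has norm at most 2. The bound
depends on neither ε nor y, so it is the dominating constant when the limit ε → 0 is taken under the
integral over the base. -/
theorem norm_integral_layerFlux_fiber_le (P : IsGraphPatch Ω Q ρ a b B)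
    (hh : ∀ y ∈ B, h y ∈ Ioo a b ∧ ρ (Q (h y, y)) = 0)
    (hs : tsupport F ⊆ Q '' (Ioo a b ×ˢ B)) {M : ℝ} (hM0 : 0 ≤ M)
    (hM : ∀ x ∈ closure Ωᶜ, ‖F x‖ ≤ M) {ε : ℝ} (hε : 0 < ε) {y : E2} (hy : y ∈ B) :
    ‖∫ t, Ωᶜ.indicator (layerFlux ρ F ε) (Q (t, y))‖ ≤ M * 2 := by
  rw [P.integral_layerFlux_fiber hh hs ε hy]
  have hint1 : IntegrableOn (fun t => stepDeriv (ρ (Q (t, y)) / ε - 1) / ε *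
      fderiv ℝ ρ (Q (t, y)) (Q (1, 0)) * (M * 2)) (Ioo (h y) b) := by
    have hQc : Continuous (fun t : ℝ => Q (t, y)) := Q.continuous.comp (by fun_prop)
    refine (Continuous.integrableOn_Icc (a := h y) (b := b) ?_).mono_set Ioo_subset_Icc_self
    refine (((continuous_stepDeriv.comp ?_).div_const ε).mul
      (P.continuous_slope y)).mul continuous_const
    exact ((P.contDiff.continuous.comp hQc).div_const ε).sub continuous_const
  refine (norm_integral_le_of_norm_le hint1 ?_).trans ?_
  · filter_upwards [ae_restrict_mem measurableSet_Ioo] with t ht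
    have hta : t ∈ Icc a b := ⟨((hh y hy).1.1.trans ht.1).le, ht.2.le⟩
    have hsl := P.slope_pos t hta y hy
    have hnn : 0 ≤ stepDeriv (ρ (Q (t, y)) / ε - 1) / ε *
        fderiv ℝ ρ (Q (t, y)) (Q (1, 0)) :=
      mul_nonneg (div_nonneg (stepDeriv_nonneg _) hε.le) hsl.le
    rw [norm_smul, Real.norm_eq_abs, abs_of_nonneg hnn]
    exact mul_le_mul_of_nonneg_left (P.norm_normalFlux_le hM hta hy
      (subset_closure (P.notMem_of_height_lt hh hy ⟨ht.1, ht.2.le⟩))) hnn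
  · rw [integral_mul_const, integral_stepDeriv_comp (hh y hy).1.2
      (fun t => hasDerivAt_comp_coordinates P.contDiff t y) (P.continuous_slope y) (hh y hy).2]
    exact mul_le_of_le_one_left (by positivity) (Real.smoothTransition.le_one _)

theorem tendsto_integral_layerFlux_fiber [CompleteSpace V] (P : IsGraphPatch Ω Q ρ a b B)
    (hh : ∀ y ∈ B, h y ∈ Ioo a b ∧ ρ (Q (h y, y)) = 0) (hF : IsExteriorField Ω F)
    (hs : tsupport F ⊆ Q '' (Ioo a b ×ˢ B)) {y : E2} (hy : y ∈ B) :
    Tendsto (fun ε => ∫ t, Ωᶜ.indicator (layerFlux ρ F ε) (Q (t, y))) (𝓝[>] 0)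
      (𝓝 (normalFlux Q ρ F (h y, y))) := by
  obtain ⟨M, -, hM⟩ := hF.exists_bound
  have hcy := P.continuousOn_normalFlux hh hF.continuousOn hy
  have hlt := (hh y hy).1.2
  simp only [P.integral_layerFlux_fiber hh hs _ hy]
  refine tendsto_integral_stepDeriv hlt
    (fun t => hasDerivAt_comp_coordinates P.contDiff t y) (P.continuous_slope y)
    (fun t ht => P.slope_pos t ⟨((hh y hy).1.1.trans_le ht.1).le, ht.2⟩ y hy) (hh y hy).2 ?_ ?_
  · refine IntegrableOn.of_bound (by simp)
      ((hcy.mono Ioo_subset_Ico_self).aestronglyMeasurable measurableSet_Ioo) (M * 2) ?_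
    filter_upwards [ae_restrict_mem measurableSet_Ioo] with t ht
    exact P.norm_normalFlux_le hM ⟨((hh y hy).1.1.trans ht.1).le, ht.2.le⟩ hy
      (subset_closure (P.notMem_of_height_lt hh hy ⟨ht.1, ht.2.le⟩))
  · exact (hcy (h y) ⟨le_rfl, hlt⟩).mono Ioo_subset_Ico_self

/-- The divergence theorem for a field supported in a graph patch. -/
theorem setIntegral_divg [CompleteSpace V] (P : IsGraphPatch Ω Q ρ a b B) (hΩ : IsClosed Ω)
    (hh : ∀ y ∈ B, h y ∈ Ioo a b ∧ ρ (Q (h y, y)) = 0) (hF : IsExteriorField Ω F)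
    (hs : tsupport F ⊆ Q '' (Ioo a b ×ˢ B)) :
    ∫ x in Ωᶜ, divg F x = - ∫ y in B, normalFlux Q ρ F (h y, y) := by
  have hmB : MeasurableSet B := P.isOpen.measurableSet
  have hmΩ : MeasurableSet Ωᶜ := hΩ.isOpen_compl.measurableSet
  have hpos := P.mem_iff_of_mem_tsupport hs
  obtain ⟨M, hM0, hM⟩ := hF.exists_bound
  have hemb : MeasurableEmbedding Q := Q.toHomeomorph.measurableEmbedding
  have hi2 : ∀ ε > 0, Integrable (fun p : ℝ × E2 => Ωᶜ.indicator (layerFlux ρ F ε) (Q p))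
      ((volume : Measure ℝ).prod (volume : Measure E2)) := fun ε hε =>
    (P.measurePreserving.integrable_comp_emb hemb).2
      ((integrable_indicator_iff hmΩ).2 (integrableOn_layerFlux hΩ hF P.contDiff hpos hε))
  have hiter : ∀ ε > 0, ∫ x in Ωᶜ, layerFlux ρ F ε x =
      ∫ y in B, ∫ t, Ωᶜ.indicator (layerFlux ρ F ε) (Q (t, y)) := by
    intro ε hε
    rw [← integral_indicator hmΩ, ← P.measurePreserving.integral_comp hemb,
      Measure.volume_eq_prod, integral_prod_symm _ (hi2 ε hε),
      ← setIntegral_eq_integral_of_forall_compl_eq_zero (s := B)]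
    intro y hy
    refine integral_eq_zero_of_ae (Eventually.of_forall fun t => ?_)
    simp only [Pi.zero_apply]
    rw [indicator_apply_eq_zero]
    intro _
    simp [layerFlux, eq_zero_of_notMem_box hs (fun hc => hy hc.2)]
  have hBvol : volume B < ⊤ := P.bounded.measure_lt_top
  -- Fubini has reduced the layer flux to fibres over the base; the fibrewise limits pass through
  -- the base integral by dominated convergence, the base being bounded.
  have hlim : Tendsto (fun ε => ∫ y in B, ∫ t, Ωᶜ.indicator (layerFlux ρ F ε) (Q (t, y)))
      (𝓝[>] 0) (𝓝 (∫ y in B, normalFlux Q ρ F (h y, y))) := by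
    refine tendsto_integral_filter_of_dominated_convergence (fun _ => M * 2) ?_ ?_ ?_ ?_
    · filter_upwards [self_mem_nhdsWithin] with ε (hε : 0 < ε)
      exact (hi2 ε hε).integral_prod_right.aestronglyMeasurable.restrict
    · filter_upwards [self_mem_nhdsWithin] with ε (hε : 0 < ε)
      filter_upwards [ae_restrict_mem hmB] with y hy
      exact P.norm_integral_layerFlux_fiber_le hh hs hM0 hM hε hy
    · exact integrableOn_const hBvol.ne
    · filter_upwards [ae_restrict_mem hmB] with y hy
      exact P.tendsto_integral_layerFlux_fiber hh hF hs hy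
  have hlim2 := (tendsto_integral_cutoff hΩ hF P.contDiff hpos).neg
  rw [← neg_eq_iff_eq_neg]
  refine tendsto_nhds_unique hlim2 (hlim.congr' ?_)
  filter_upwards [self_mem_nhdsWithin] with ε (hε : 0 < ε)
  rw [← hiter ε hε, setIntegral_layerFlux hΩ hF P.contDiff hpos hε]

end IsGraphPatch

end

/-! ### Surface measure of a patch and its comparison with Hausdorff measure -/

section

open scoped ENNReal NNReal Manifold

variable {V : Type*} [NormedAddCommGroup V] [NormedSpace ℝ V]

theorem ae_mem_frontier {Ω : Set E3} {ν : Measure E3}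
    (hν : ν ≤ (2 : ℝ≥0∞) • (μHE[2] : Measure E3).restrict (frontier Ω)) :
    ∀ᵐ x ∂ν, x ∈ frontier Ω :=
  ((Measure.absolutelyContinuous_of_le hν).trans Measure.smul_absolutelyContinuous).ae_le
    (ae_restrict_mem isClosed_frontier.measurableSet)

theorem integrable_of_continuousOn_frontier {W : Type*} [NormedAddCommGroup W] {Ω : Set E3}
    (hΩ : IsObstacle Ω) {ν : Measure E3} [IsFiniteMeasure ν]
    (hν : ν ≤ (2 : ℝ≥0∞) • (μHE[2] : Measure E3).restrict (frontier Ω))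
    {f : E3 → W} (hf : ContinuousOn f (frontier Ω)) : Integrable f ν := by
  have hfc : IsCompact (frontier Ω) := hΩ.isCompact.of_isClosed_subset isClosed_frontier
    hΩ.isCompact.isClosed.frontier_subset
  rw [← Measure.restrict_eq_self_of_ae_mem (ae_mem_frontier hν)]
  exact hf.integrableOn_compact hfc

theorem euclideanHausdorffMeasure_image_le {X Y : Type*} [MetricSpace X]
    [MeasurableSpace X] [BorelSpace X] [MetricSpace Y] [MeasurableSpace Y] [BorelSpace Y]
    {K : ℝ≥0} {f : X → Y} {s : Set X} (hf : LipschitzOnWith K f s) (d : ℕ) :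
    (μHE[d] : Measure Y) (f '' s) ≤ (K : ℝ≥0∞) ^ d * (μHE[d] : Measure X) s := by
  simp only [Measure.euclideanHausdorffMeasure_def, Measure.smul_apply, ENNReal.smul_def,
    smul_eq_mul]
  rw [mul_left_comm]
  gcongr
  simpa using hf.hausdorffMeasure_image_le (d := d) (by simp)

namespace IsGraphPatch

variable {Ω : Set E3} {Q : (ℝ × E2) ≃L[ℝ] E3} {ρ : E3 → ℝ} {a b : ℝ} {B : Set E2}
  {F : E3 → E3 →L[ℝ] V} {h : E2 → ℝ}

theorem exists_lipschitz_height (P : IsGraphPatch Ω Q ρ a b B) :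
    ∃ h : E2 → ℝ, LipschitzWith 2 h ∧ ∀ y ∈ B, h y ∈ Ioo a b ∧ ρ (Q (h y, y)) = 0 := by
  obtain ⟨h, hL, hh⟩ := P.exists_height
  obtain ⟨g, hg, he⟩ := hL.extend_real
  exact ⟨g, hg, fun y hy => by rw [← he hy]; exact hh y hy⟩

/-- The ratio of the area element of the graph to the area element of its base. -/
def areaDensity (Q : (ℝ × E2) ≃L[ℝ] E3) (ρ : E3 → ℝ) (h : E2 → ℝ) (y : E2) : ℝ :=
  ‖∇ ρ (Q (h y, y))‖ / fderiv ℝ ρ (Q (h y, y)) (Q (1, 0))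

/-- The surface measure of the graph. -/
def patchMeasure (Q : (ℝ × E2) ≃L[ℝ] E3) (ρ : E3 → ℝ) (h : E2 → ℝ) (B : Set E2) : Measure E3 :=
  Measure.map (fun y => Q (h y, y))
    ((volume.restrict B).withDensity fun y => ENNReal.ofReal (areaDensity Q ρ h y))

theorem continuous_graph (Q : (ℝ × E2) ≃L[ℝ] E3) (hL : LipschitzWith 2 h) :
    Continuous fun y => Q (h y, y) :=
  Q.continuous.comp (hL.continuous.prodMk continuous_id)

theorem measurableEmbedding_graph (Q : (ℝ × E2) ≃L[ℝ] E3) (hL : LipschitzWith 2 h) :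
    MeasurableEmbedding fun y => Q (h y, y) :=
  (continuous_graph Q hL).measurableEmbedding fun _ _ hyz => (Prod.mk.inj (Q.injective hyz)).2

theorem measurable_areaDensity (P : IsGraphPatch Ω Q ρ a b B) (hL : LipschitzWith 2 h) :
    Measurable (areaDensity Q ρ h) := by
  have hg := continuous_graph Q hL
  have h1 : Continuous (fderiv ℝ ρ) := P.contDiff.continuous_fderiv (by simp)
  exact ((continuous_gradient (P.contDiff.of_le (by simp))).comp hg).norm.measurable.div
    ((h1.comp hg).clm_apply continuous_const).measurable

theorem areaDensity_le (P : IsGraphPatch Ω Q ρ a b B)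
    (hh : ∀ y ∈ B, h y ∈ Ioo a b ∧ ρ (Q (h y, y)) = 0) {y : E2} (hy : y ∈ B) :
    areaDensity Q ρ h y ≤ 2 := by
  have hab := Ioo_subset_Icc_self (hh y hy).1
  rw [areaDensity, div_le_iff₀ (P.slope_pos _ hab y hy)]
  exact P.gradient_le _ hab y hy

/-- The projection of the graph to its base is 1-Lipschitz in adapted coordinates, so Hausdorff
measure on the graph dominates Lebesgue measure on the base; the area density contributes a factor
of at most 2. The exact area formula would remove this factor, but the final inequality can afford
it. -/
theorem patchMeasure_le (P : IsGraphPatch Ω Q ρ a b B) (hL : LipschitzWith 2 h)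
    (hh : ∀ y ∈ B, h y ∈ Ioo a b ∧ ρ (Q (h y, y)) = 0) :
    patchMeasure Q ρ h B ≤ (2 : ℝ≥0∞) • (μHE[2] : Measure E3).restrict (frontier Ω) := by
  have hg := continuous_graph Q hL
  have hmB : MeasurableSet B := P.isOpen.measurableSet
  refine Measure.le_iff.2 fun A hA => ?_
  have hmA := hg.measurable hA
  rw [patchMeasure, Measure.map_apply hg.measurable hA, withDensity_apply _ hmA,
    Measure.restrict_restrict hmA, Measure.smul_apply, Measure.restrict_apply hA, smul_eq_mul]
  calc ∫⁻ y in (fun y => Q (h y, y)) ⁻¹' A ∩ B, ENNReal.ofReal (areaDensity Q ρ h y)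
      ≤ ∫⁻ _ in (fun y => Q (h y, y)) ⁻¹' A ∩ B, 2 := by
        refine setLIntegral_mono measurable_const fun y hy => ?_
        rw [← ENNReal.ofReal_ofNat]
        exact ENNReal.ofReal_le_ofReal (P.areaDensity_le hh hy.2)
    _ = 2 * volume ((fun y => Q (h y, y)) ⁻¹' A ∩ B) := by rw [setLIntegral_const]
    _ ≤ 2 * (μHE[2] : Measure E3) (A ∩ frontier Ω) := by
        gcongr
        have hproj : LipschitzWith 1 fun x : E3 => (Q.symm x).2 := by
          refine LipschitzWith.of_dist_le_mul fun x z => ?_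
          rw [NNReal.coe_one, one_mul, dist_eq_norm, dist_eq_norm, ← Prod.snd_sub, ← map_sub]
          have h1 := P.norm_sq (Q.symm (x - z)).1 (Q.symm (x - z)).2
          rw [Prod.mk.eta, Q.apply_symm_apply] at h1
          refine abs_le_of_sq_le_sq' ?_ (norm_nonneg _) |>.2
          nlinarith [sq_nonneg (Q.symm (x - z)).1]
        have hsub : (fun y => Q (h y, y)) ⁻¹' A ∩ B ⊆
            (fun x : E3 => (Q.symm x).2) '' (A ∩ frontier Ω) := fun y hy =>
          ⟨Q (h y, y), ⟨hy.1, P.mem_frontier (hh y hy.2).1 hy.2 (hh y hy.2).2⟩, by simp⟩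
        rw [← EuclideanSpace.euclideanHausdorffMeasure_eq_volume 2]
        refine (measure_mono hsub).trans ?_
        simpa using euclideanHausdorffMeasure_image_le (hproj.lipschitzOnWith (s := A ∩ frontier Ω)) 2

theorem isFiniteMeasure_patchMeasure (P : IsGraphPatch Ω Q ρ a b B) (hL : LipschitzWith 2 h)
    (hh : ∀ y ∈ B, h y ∈ Ioo a b ∧ ρ (Q (h y, y)) = 0) :
    IsFiniteMeasure (patchMeasure Q ρ h B) := by
  have hmB : MeasurableSet B := P.isOpen.measurableSet
  refine ⟨?_⟩
  rw [patchMeasure, Measure.map_apply (continuous_graph Q hL).measurable MeasurableSet.univ,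
    preimage_univ, withDensity_apply _ MeasurableSet.univ, Measure.restrict_univ]
  refine (setLIntegral_mono (g := fun _ => 2) measurable_const fun y hy => ?_).trans_lt ?_
  · rw [← ENNReal.ofReal_ofNat]
    exact ENNReal.ofReal_le_ofReal (P.areaDensity_le hh hy)
  · rw [setLIntegral_const]
    exact ENNReal.mul_lt_top (by simp) P.bounded.measure_lt_top

/-- The density |∇ρ| / slope cancels the normalization of the unit normal ∇ρ / |∇ρ| and leaves ∇ρ /
slope, the vector in the fibrewise limit. -/
theorem integral_patchMeasure (P : IsGraphPatch Ω Q ρ a b B) (hL : LipschitzWith 2 h)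
    (hh : ∀ y ∈ B, h y ∈ Ioo a b ∧ ρ (Q (h y, y)) = 0) (F : E3 → E3 →L[ℝ] V) :
    ∫ x, F x (outwardNormal Ω x) ∂patchMeasure Q ρ h B = ∫ y in B, normalFlux Q ρ F (h y, y) := by
  rw [patchMeasure, (measurableEmbedding_graph Q hL).integral_map,
    integral_withDensity_eq_integral_toReal_smul
      (P.measurable_areaDensity hL).ennreal_ofReal (by simp)]
  refine setIntegral_congr_fun P.isOpen.measurableSet fun y hy => ?_
  obtain ⟨hab, h0⟩ := hh y hy
  have hsl := P.slope_pos _ (Ioo_subset_Icc_self hab) y hy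
  have hdef := P.isDefiningFunctionAt hab hy h0
  have hne : ‖∇ ρ (Q (h y, y))‖ ≠ 0 := norm_ne_zero_iff.2 hdef.gradient_ne
  have hnn : 0 ≤ areaDensity Q ρ h y := div_nonneg (norm_nonneg _) hsl.le
  simp only [ENNReal.toReal_ofReal hnn, outwardNormal_eq hdef, normalFlux]
  rw [← map_smul, smul_smul, areaDensity, div_mul_eq_mul_div, mul_inv_cancel₀ hne, one_div]

theorem setIntegral_divg_eq (P : IsGraphPatch Ω Q ρ a b B) [CompleteSpace V] (hΩ : IsClosed Ω)
    (hL : LipschitzWith 2 h) (hh : ∀ y ∈ B, h y ∈ Ioo a b ∧ ρ (Q (h y, y)) = 0)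
    (hF : IsExteriorField Ω F) (hs : tsupport F ⊆ Q '' (Ioo a b ×ˢ B)) :
    ∫ x in Ωᶜ, divg F x = - ∫ x, F x (outwardNormal Ω x) ∂patchMeasure Q ρ h B := by
  rw [P.setIntegral_divg hΩ hh hF hs, P.integral_patchMeasure hL hh]

theorem hausdorffMeasure_lt_top (P : IsGraphPatch Ω Q ρ a b B) :
    (μHE[2] : Measure E3) (frontier Ω ∩ Q '' (Ioo a b ×ˢ B)) < ⊤ := by
  obtain ⟨h, hL, hh⟩ := P.exists_lipschitz_height
  have hsub : frontier Ω ∩ Q '' (Ioo a b ×ˢ B) ⊆ (fun y => Q (h y, y)) '' B := by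
    rintro _ ⟨hx, ⟨t, y⟩, ⟨ht, hy⟩, rfl⟩
    have h0 := P.zero_of_mem_frontier ht hy hx
    have := P.eq_of_zero hy (Ioo_subset_Icc_self ht) (Ioo_subset_Icc_self (hh y hy).1) h0
      (hh y hy).2
    exact ⟨y, hy, congrArg (fun s => Q (s, y)) this.symm⟩
  have hg : LipschitzWith (‖(Q : (ℝ × E2) →L[ℝ] E3)‖₊ * max 2 1) fun y => Q (h y, y) :=
    (Q : (ℝ × E2) →L[ℝ] E3).lipschitz.comp (hL.prodMk LipschitzWith.id)
  refine (measure_mono hsub).trans_lt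
    ((euclideanHausdorffMeasure_image_le (hg.lipschitzOnWith (s := B)) 2).trans_lt ?_)
  rw [EuclideanSpace.euclideanHausdorffMeasure_eq_volume 2]
  exact ENNReal.mul_lt_top (ENNReal.pow_lt_top ENNReal.coe_lt_top) P.bounded.measure_lt_top

end IsGraphPatch

end

/-! ### Gluing the patches: a surface measure for the whole boundary -/

section

open scoped ENNReal NNReal Manifold

variable {V : Type*} [NormedAddCommGroup V] [NormedSpace ℝ V]

theorem integrableOn_of_continuousOn_of_support {W : Type*} [NormedAddCommGroup W] {g : E3 → W}
    {S K : Set E3} (hS : IsClosed S) (hg : ContinuousOn g S) (hK : IsCompact K)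
    (h0 : ∀ x ∉ K, g x = 0) : IntegrableOn g S := by
  have h1 : IntegrableOn g (S ∩ K) :=
    (hg.mono inter_subset_left).integrableOn_compact (hK.inter_left hS)
  exact h1.of_forall_sdiff_eq_zero hS.measurableSet fun x hx => h0 x fun hxK => hx.2 ⟨hx.1, hxK⟩

theorem IsExteriorField.smul {Ω : Set E3} (hΩ : IsClosed Ω) {F : E3 → E3 →L[ℝ] V}
    (hF : IsExteriorField Ω F) {φ : E3 → ℝ} (hφ : ContDiff ℝ 1 φ) {C : ℝ} (hC : ∀ x, ‖φ x‖ ≤ C) :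
    IsExteriorField Ω fun x => φ x • F x where
  hasCompactSupport := hF.hasCompactSupport.mono fun y hy hFy => hy (by simp [hFy])
  continuousOn := hφ.continuous.continuousOn.smul hF.continuousOn
  contDiffOn := hφ.contDiffOn.smul hF.contDiffOn
  integrableOn := by
    have h1 : IntegrableOn (fun x => φ x • divg F x) Ωᶜ :=
      Integrable.bdd_smul hF.integrableOn C hφ.continuous.aestronglyMeasurable
        (Eventually.of_forall hC)
    have h2 : IntegrableOn (fun x => F x (∇ φ x)) Ωᶜ := by
      refine (integrableOn_of_continuousOn_of_support isClosed_closure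
        (hF.continuousOn.clm_apply (continuous_gradient hφ).continuousOn)
        hF.hasCompactSupport.isCompact fun x hx => ?_).mono_set subset_closure
      simp [image_eq_zero_of_notMem_tsupport hx]
    refine (h1.add h2).congr ?_
    filter_upwards [ae_restrict_mem hΩ.isOpen_compl.measurableSet] with x hx
    rw [Pi.add_apply, divg_smul (hφ.differentiable (by simp)).differentiableAt
      ((hF.contDiffOn.contDiffAt (hΩ.isOpen_compl.mem_nhds hx)).differentiableAt (by simp))]

/-- A field that vanishes near ∂Ω, extended by zero into Ω, is C¹ with compact support on the whole
space. This disposes of the part of a field away from the boundary. -/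
theorem setIntegral_divg_eq_zero {Ω : Set E3} (hΩ : IsClosed Ω) {F : E3 → E3 →L[ℝ] V}
    (hF : IsExteriorField Ω F) (h0 : ∀ x ∈ frontier Ω, F =ᶠ[𝓝 x] fun _ => 0) :
    ∫ x in Ωᶜ, divg F x = 0 := by
  classical
  set G : E3 → E3 →L[ℝ] V := Ωᶜ.indicator F with hG
  have hGF : ∀ x ∈ Ωᶜ, G =ᶠ[𝓝 x] F := by
    intro x hx
    filter_upwards [hΩ.isOpen_compl.mem_nhds hx] with z hz
    exact indicator_of_mem hz F
  have hG0 : ∀ x ∈ Ω, G =ᶠ[𝓝 x] fun _ => 0 := by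
    intro x hx
    by_cases hf : x ∈ frontier Ω
    · filter_upwards [h0 x hf] with z hz
      rw [hG, indicator_apply_eq_zero]
      exact fun _ => hz
    · have hi : x ∈ interior Ω := by
        by_contra hi
        exact hf ⟨subset_closure hx, hi⟩
      filter_upwards [isOpen_interior.mem_nhds hi] with z hz
      exact indicator_of_notMem (not_not.2 (interior_subset hz)) F
  have hGC : ContDiff ℝ 1 G := by
    rw [contDiff_iff_contDiffAt]
    intro x
    by_cases hx : x ∈ Ω
    · exact contDiffAt_const.congr_of_eventuallyEq (hG0 x hx)
    · exact (hF.contDiffOn.contDiffAt (hΩ.isOpen_compl.mem_nhds hx)).congr_of_eventuallyEq (hGF x hx)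
  have hGs : HasCompactSupport G := hF.hasCompactSupport.mono fun y hy hFy => hy (by
    rw [hG, indicator_apply_eq_zero]; exact fun _ => hFy)
  have h1 : ∫ x in Ωᶜ, divg F x = ∫ x in Ωᶜ, divg G x :=
    setIntegral_congr_fun hΩ.isOpen_compl.measurableSet fun x hx => (divg_congr (hGF x hx)).symm
  rw [h1, ← integral_divg_eq_zero hGC hGs]
  refine setIntegral_eq_integral_of_forall_compl_eq_zero fun x hx => ?_
  rw [divg_congr (hG0 x (not_not.1 hx)), divg_zero]

/-- Finitely many graph patches cover the boundary of an obstacle. -/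
theorem exists_finite_patches {Ω : Set E3} (hΩ : IsObstacle Ω) :
    ∃ t : Finset E3, ∃ (Q : E3 → (ℝ × E2) ≃L[ℝ] E3) (ρ : E3 → E3 → ℝ) (a b : E3 → ℝ)
      (B : E3 → Set E2), (∀ i ∈ t, IsGraphPatch Ω (Q i) (ρ i) (a i) (b i) (B i)) ∧
      frontier Ω ⊆ ⋃ i ∈ t, Q i '' (Ioo (a i) (b i) ×ˢ B i) := by
  have hex : ∀ x ∈ frontier Ω, ∃ ρ : E3 → ℝ, ∃ Q : (ℝ × E2) ≃L[ℝ] E3, ∃ a b B,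
      IsGraphPatch Ω Q ρ a b B ∧ ∃ t ∈ Ioo a b, ∃ y ∈ B, Q (t, y) = x := fun x hx => by
    obtain ⟨ρ, hρ⟩ := hΩ.smooth_boundary x hx
    exact ⟨ρ, exists_isGraphPatch hρ⟩
  have : Nonempty ((ℝ × E2) ≃L[ℝ] E3) := ⟨consEquiv⟩
  choose! ρ Q a b B hP hx using hex
  have hfc : IsCompact (frontier Ω) := hΩ.isCompact.of_isClosed_subset isClosed_frontier
    hΩ.isCompact.isClosed.frontier_subset
  obtain ⟨t, htf, ht⟩ := hfc.elim_nhds_subcover (fun x => Q x '' (Ioo (a x) (b x) ×ˢ B x))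
    (fun x hxf => by
      refine (hP x hxf).isOpen_box.mem_nhds ?_
      obtain ⟨s, hs, y, hy, h⟩ := hx x hxf
      exact ⟨(s, y), ⟨hs, hy⟩, h⟩)
  exact ⟨t, Q, ρ, a, b, B, fun i hi => hP i (htf i hi), ht⟩

theorem hausdorffMeasure_frontier_lt_top {Ω : Set E3} (hΩ : IsObstacle Ω) :
    (μHE[2] : Measure E3) (frontier Ω) < ⊤ := by
  obtain ⟨t, Q, ρ, a, b, B, hP, hc⟩ := exists_finite_patches hΩ
  have hsub : frontier Ω ⊆ ⋃ i ∈ t, frontier Ω ∩ Q i '' (Ioo (a i) (b i) ×ˢ B i) := by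
    intro z hz
    obtain ⟨i, hi, hzi⟩ := mem_iUnion₂.1 (hc hz)
    exact mem_iUnion₂.2 ⟨i, hi, hz, hzi⟩
  refine (measure_mono hsub).trans_lt ((measure_biUnion_finset_le _ _).trans_lt ?_)
  exact ENNReal.sum_lt_top.2 fun i hi => (hP i hi).hausdorffMeasure_lt_top

/-- A measure on the boundary of `Ω`, bounded by twice the Hausdorff measure, for which the
divergence theorem holds in the exterior of `Ω`. -/
structure IsSurfaceMeasure (V : Type*) [NormedAddCommGroup V] [NormedSpace ℝ V] (Ω : Set E3)
    (ν : Measure E3) : Prop where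
  le : ν ≤ (2 : ℝ≥0∞) • (μHE[2] : Measure E3).restrict (frontier Ω)
  setIntegral_divg : ∀ F : E3 → E3 →L[ℝ] V, IsExteriorField Ω F →
    ∫ x in Ωᶜ, divg F x = - ∫ x, F x (outwardNormal Ω x) ∂ν

theorem IsSurfaceMeasure.isFiniteMeasure {Ω : Set E3} (hΩ : IsObstacle Ω) {ν : Measure E3}
    (h : IsSurfaceMeasure V Ω ν) : IsFiniteMeasure ν := by
  refine ⟨(h.le univ).trans_lt ?_⟩
  rw [Measure.smul_apply, Measure.restrict_apply_univ]
  exact ENNReal.mul_lt_top (by simp) (hausdorffMeasure_frontier_lt_top hΩ)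

theorem frontier_subset_closure_compl (Ω : Set E3) : frontier Ω ⊆ closure Ωᶜ := by
  rw [frontier_eq_closure_inter_closure]
  exact inter_subset_right

/-- A smooth partition of unity splits a field into pieces supported in single patches and one piece
supported off ∂Ω. The surface measure is the sum of the patch measures weighted by the partition
functions; the patch measures need not be shown to agree on overlaps. -/
theorem exists_isSurfaceMeasure [CompleteSpace V] {Ω : Set E3} (hΩ : IsObstacle Ω) :
    ∃ ν : Measure E3, IsSurfaceMeasure V Ω ν := by
  classical
  have hcl : IsClosed Ω := hΩ.isCompact.isClosed
  obtain ⟨t, Q, ρ, a, b, B, hP, hc⟩ := exists_finite_patches hΩ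
  choose! h hL hh using fun i (hi : i ∈ t) => (hP i hi).exists_lipschitz_height
  -- The index `none` stands for the complement of the boundary; with it the open sets cover all of
  -- space.
  set U : Option t → Set E3 := fun i => i.elim (frontier Ω)ᶜ
    fun i => Q i '' (Ioo (a i) (b i) ×ˢ B i) with hU
  obtain ⟨φ, hφ⟩ := SmoothPartitionOfUnity.exists_isSubordinate 𝓘(ℝ, E3) isClosed_univ U
    (by
      rintro (_ | i)
      · exact isClosed_frontier.isOpen_compl
      · exact (hP i i.2).isOpen_box)
    (by
      intro x _
      by_cases hx : x ∈ frontier Ω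
      · obtain ⟨i, hi, hxi⟩ := mem_iUnion₂.1 (hc hx)
        exact mem_iUnion.2 ⟨some ⟨i, hi⟩, hxi⟩
      · exact mem_iUnion.2 ⟨none, hx⟩)
  have hφd : ∀ i, ContDiff ℝ 1 (φ i) := fun i => (φ i).contMDiff.contDiff.of_le (by simp)
  have hφ0 : ∀ i x, 0 ≤ φ i x := fun i x => φ.nonneg i x
  have hφ1 : ∀ i x, ‖φ i x‖ ≤ 1 := fun i x => by
    rw [Real.norm_eq_abs, abs_of_nonneg (hφ0 i x)]
    exact φ.le_one i x
  have hsum : ∀ x, ∑ i, φ i x = 1 := fun x => by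
    rw [← finsum_eq_sum_of_fintype]
    exact φ.sum_eq_one (mem_univ x)
  set ν' : t → Measure E3 := fun i =>
    IsGraphPatch.patchMeasure (Q i) (ρ i) (h i) (B i) with hν'
  have hle : ∀ i, ν' i ≤ (2 : ℝ≥0∞) • (μHE[2] : Measure E3).restrict (frontier Ω) := fun i =>
    (hP i i.2).patchMeasure_le (hL i i.2) (hh i i.2)
  have hfin : ∀ i, IsFiniteMeasure (ν' i) := fun i =>
    (hP i i.2).isFiniteMeasure_patchMeasure (hL i i.2) (hh i i.2)
  have hmeas : ∀ i, Measurable fun x => ENNReal.ofReal (φ i x) := fun i =>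
    (hφd i).continuous.measurable.ennreal_ofReal
  refine ⟨∑ i, (ν' i).withDensity fun x => ENNReal.ofReal (φ (some i) x), ?_, ?_⟩
  · refine Measure.le_iff.2 fun A hA => ?_
    rw [Measure.finsetSum_apply]
    simp only [withDensity_apply _ hA]
    set μ2 := (2 : ℝ≥0∞) • (μHE[2] : Measure E3).restrict (frontier Ω) with hμ2
    -- Each patch measure is below the same measure μ2 and the weights of the patches add up to at
    -- most one, so the factor 2 is not multiplied by the number of patches.
    calc ∑ i : t, ∫⁻ x in A, ENNReal.ofReal (φ (some i) x) ∂ν' i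
        ≤ ∑ i : t, ∫⁻ x in A, ENNReal.ofReal (φ (some i) x) ∂μ2 :=
          Finset.sum_le_sum fun i _ => lintegral_mono' (Measure.restrict_mono le_rfl (hle i)) le_rfl
      _ = ∫⁻ x in A, ∑ i : t, ENNReal.ofReal (φ (some i) x) ∂μ2 :=
          (lintegral_finsetSum _ fun i _ => hmeas (some i)).symm
      _ ≤ ∫⁻ _ in A, 1 ∂μ2 := by
          refine lintegral_mono fun x => ?_
          rw [← ENNReal.ofReal_sum_of_nonneg fun i _ => hφ0 (some i) x, ← ENNReal.ofReal_one]
          refine ENNReal.ofReal_le_ofReal ?_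
          rw [← hsum x, Fintype.sum_option]
          linarith [hφ0 none x]
      _ = μ2 A := by rw [setLIntegral_one]
  · intro F hF
    have hFi : ∀ i, IsExteriorField Ω fun x => φ i x • F x := fun i =>
      hF.smul hcl (hφd i) (hφ1 i)
    have hsplit : ∀ x ∈ Ωᶜ, divg F x = ∑ i, divg (fun y => φ i y • F y) x := by
      intro x hx
      rw [← divg_sum fun i _ => ((hFi i).contDiffOn.contDiffAt
        (hcl.isOpen_compl.mem_nhds hx)).differentiableAt (by simp)]
      congr 1
      funext y
      rw [← Finset.sum_smul, hsum, one_smul]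
    have hnone : ∫ x in Ωᶜ, divg (fun y => φ none y • F y) x = 0 := by
      refine setIntegral_divg_eq_zero hcl (hFi none) fun x hx => ?_
      have hxs : x ∉ tsupport (φ none) := fun hxs => hφ none hxs hx
      filter_upwards [notMem_tsupport_iff_eventuallyEq.1 hxs] with z hz
      simp [hz]
    have hsome : ∀ i : t, ∫ x in Ωᶜ, divg (fun y => φ (some i) y • F y) x =
        - ∫ x, F x (outwardNormal Ω x)
          ∂(ν' i).withDensity fun x => ENNReal.ofReal (φ (some i) x) := by
      intro i
      have hts : tsupport (fun y => φ (some i) y • F y) ⊆ Q i '' (Ioo (a i) (b i) ×ˢ B i) :=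
        (closure_mono (Function.support_smul_subset_left _ _)).trans (hφ (some i))
      rw [(hP i i.2).setIntegral_divg_eq hcl (hL i i.2) (hh i i.2) (hFi (some i)) hts,
        integral_withDensity_eq_integral_toReal_smul (hmeas (some i)) (by simp)]
      congr 1
      refine integral_congr_ae (Eventually.of_forall fun x => ?_)
      simp [ENNReal.toReal_ofReal (hφ0 (some i) x)]
    rw [setIntegral_congr_fun hcl.isOpen_compl.measurableSet hsplit,
      integral_finsetSum _ fun i _ => (hFi i).integrableOn, Fintype.sum_option, hnone, zero_add,
      integral_finsetSum_measure, ← Finset.sum_neg_distrib]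
    · exact Finset.sum_congr rfl fun i _ => hsome i
    · intro i _
      have hcont : ContinuousOn (fun x => F x (outwardNormal Ω x)) (frontier Ω) :=
        (hF.continuousOn.mono (frontier_subset_closure_compl Ω)).clm_apply
          (continuousOn_outwardNormal hΩ)
      rw [integrable_withDensity_iff_integrable_smul' (hmeas (some i)) (by simp)]
      have := hfin i
      refine integrable_of_continuousOn_frontier hΩ (hle i) ?_
      refine ContinuousOn.smul ?_ hcont
      refine ContinuousOn.congr (hφd (some i)).continuous.continuousOn fun x _ => ?_
      exact ENNReal.toReal_ofReal (hφ0 (some i) x)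

end

/-! ### Radial cutoffs, the divergence theorem inside Ω, positivity of the area -/

section

open scoped ENNReal NNReal

section radial

/-- A smooth radial function that equals one on the ball of radius `R` and zero outside the ball
of radius `R + 1`. -/
def radialCutoff (R : ℝ) (x : E3) : ℝ := 1 - Real.smoothTransition (‖x‖ - R)

theorem radialCutoff_of_le {R : ℝ} {x : E3} (hx : ‖x‖ ≤ R) : radialCutoff R x = 1 := by
  rw [radialCutoff, Real.smoothTransition.zero_of_nonpos (by linarith), sub_zero]

theorem radialCutoff_of_ge {R : ℝ} {x : E3} (hx : R + 1 ≤ ‖x‖) : radialCutoff R x = 0 := by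
  rw [radialCutoff, Real.smoothTransition.one_of_one_le (by linarith), sub_self]

theorem contDiff_radialCutoff {R : ℝ} (hR : 0 < R) : ContDiff ℝ 1 (radialCutoff R) := by
  rw [contDiff_iff_contDiffAt]
  intro x
  by_cases hx : x = 0
  · have : radialCutoff R =ᶠ[𝓝 x] fun _ => 1 := by
      have hx' : ‖x‖ < R := by rwa [hx, norm_zero]
      filter_upwards [continuous_norm.continuousAt.eventually (gt_mem_nhds hx')] with z hz
      exact radialCutoff_of_le (le_of_lt hz)
    exact contDiffAt_const.congr_of_eventuallyEq this
  · exact contDiffAt_const.sub ((Real.smoothTransition.contDiffAt (n := 1)).comp x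
      ((contDiffAt_norm ℝ hx).sub contDiffAt_const))

theorem hasCompactSupport_radialCutoff (R : ℝ) : HasCompactSupport (radialCutoff R) := by
  refine HasCompactSupport.intro (isCompact_closedBall (0 : E3) (R + 1)) fun x hx => ?_
  refine radialCutoff_of_ge (le_of_lt ?_)
  simpa using hx

theorem fderiv_norm_apply {x : E3} (hx : x ≠ 0) (v : E3) :
    fderiv ℝ (fun y : E3 => ‖y‖) x v = inner ℝ (‖x‖⁻¹ • x) v := by
  have h1 : HasFDerivAt (fun y : E3 => ‖y‖ ^ 2) (2 • innerSL ℝ x) x :=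
    (hasStrictFDerivAt_norm_sq x).hasFDerivAt
  have h2 : HasFDerivAt (fun y : E3 => ‖y‖) (fderiv ℝ (fun y : E3 => ‖y‖) x) x :=
    ((contDiffAt_norm ℝ hx (n := 1)).differentiableAt (by simp)).hasFDerivAt
  have h4 := congrArg (fun L => L v) ((h2.pow 2).unique h1)
  have hn : ‖x‖ ≠ 0 := norm_ne_zero_iff.2 hx
  simp at h4
  rw [real_inner_smul_left]
  field_simp
  linarith

theorem gradient_norm {x : E3} (hx : x ≠ 0) : ∇ (fun y : E3 => ‖y‖) x = ‖x‖⁻¹ • x := by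
  refine ext_inner_right ℝ fun v => ?_
  rw [← fderiv_norm_apply hx v]
  simp [gradient]

theorem gradient_radialCutoff {R : ℝ} (hR : 0 < R) (x : E3) :
    ∇ (radialCutoff R) x = -(stepDeriv (‖x‖ - R) • (‖x‖⁻¹ • x)) := by
  by_cases hx : x = 0
  · have : radialCutoff R =ᶠ[𝓝 x] fun _ => 1 := by
      have hx' : ‖x‖ < R := by rwa [hx, norm_zero]
      filter_upwards [continuous_norm.continuousAt.eventually (gt_mem_nhds hx')] with z hz
      exact radialCutoff_of_le (le_of_lt hz)
    rw [gradient, this.fderiv_eq]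
    simp [hx]
  · have h2 : HasFDerivAt (fun y : E3 => ‖y‖) (fderiv ℝ (fun y : E3 => ‖y‖) x) x :=
      ((contDiffAt_norm ℝ hx (n := 1)).differentiableAt (by simp)).hasFDerivAt
    have h3 : HasDerivAt (fun s : ℝ => 1 - Real.smoothTransition (s - R))
        (-(stepDeriv (‖x‖ - R) * 1)) ‖x‖ :=
      (HasDerivAt.comp (h := fun s : ℝ => s - R) ‖x‖ (hasDerivAt_smoothTransition (‖x‖ - R))
        ((hasDerivAt_id' ‖x‖).sub_const R)).const_sub 1
    have h1 : HasFDerivAt (radialCutoff R)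
        ((-(stepDeriv (‖x‖ - R) * 1)) • fderiv ℝ (fun y : E3 => ‖y‖) x) x :=
      h3.comp_hasFDerivAt x h2
    have h5 : (InnerProductSpace.toDual ℝ E3).symm (fderiv ℝ (fun y : E3 => ‖y‖) x) = ‖x‖⁻¹ • x :=
      gradient_norm hx
    simp only [gradient, h1.fderiv, mul_one, neg_smul, map_neg, map_smul, h5]

theorem IsObstacle.exists_radius {Ω : Set E3} (hΩ : IsObstacle Ω) :
    ∃ R, 0 < R ∧ ∀ x ∈ Ω, ‖x‖ ≤ R := by
  obtain ⟨R, hR⟩ := hΩ.isCompact.isBounded.exists_norm_le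
  exact ⟨max R 1, by positivity, fun x hx => (hR x hx).trans (le_max_left _ _)⟩

end radial

variable {V : Type*} [NormedAddCommGroup V] [NormedSpace ℝ V]

/-- The divergence theorem in `Ω`. -/
theorem IsSurfaceMeasure.setIntegral_interior [CompleteSpace V] {Ω : Set E3} {ν : Measure E3}
    (hν : IsSurfaceMeasure V Ω ν) (hΩ : IsObstacle Ω) {F : E3 → E3 →L[ℝ] V}
    (hF : ContDiff ℝ 1 F) : ∫ x in Ω, divg F x = ∫ x, F x (outwardNormal Ω x) ∂ν := by
  obtain ⟨R, hR, hΩR⟩ := hΩ.exists_radius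
  have hcl : IsClosed Ω := hΩ.isCompact.isClosed
  -- Ω lies in the ball of radius R, so a cutoff at R + 1 equals one in a neighbourhood of Ω. For
  -- this compactly supported field the integrals of the divergence over Ω and over its complement
  -- cancel, and the exterior theorem applies.
  set G : E3 → E3 →L[ℝ] V := fun x => radialCutoff (R + 1) x • F x with hG
  have hGC : ContDiff ℝ 1 G := (contDiff_radialCutoff (by linarith)).smul hF
  have hGs : HasCompactSupport G :=
    (hasCompactSupport_radialCutoff (R + 1)).mono fun y hy h0 => hy (by simp [hG, h0])
  have hint := integrable_divg hGC hGs
  have hGF : ∀ x ∈ Ω, G =ᶠ[𝓝 x] F := by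
    intro x hx
    have h1 : ‖x‖ < R + 1 := by linarith [hΩR x hx]
    filter_upwards [continuous_norm.continuousAt.eventually (gt_mem_nhds h1)] with z hz
    simp only [hG]
    rw [radialCutoff_of_le (le_of_lt hz), one_smul]
  have hext : IsExteriorField Ω G :=
    ⟨hGs, hGC.continuous.continuousOn, hGC.contDiffOn, hint.integrableOn⟩
  have h1 := hν.setIntegral_divg G hext
  have h2 := integral_add_compl hcl.measurableSet hint
  rw [integral_divg_eq_zero hGC hGs, h1, setIntegral_congr_fun hcl.measurableSet
    fun x hx => divg_congr (hGF x hx), ← sub_eq_add_neg, sub_eq_zero] at h2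
  rw [h2]
  refine integral_congr_ae ?_
  filter_upwards [ae_mem_frontier hν.le] with x hx
  rw [(hGF x (hcl.frontier_subset hx)).self_of_nhds]

/-- A nonempty compact set in ℝ³ has a boundary point, and the part of a patch there with ρ < 0 is
open, nonempty and contained in Ω. -/
theorem volume_pos {Ω : Set E3} (hΩ : IsObstacle Ω) : 0 < volume Ω := by
  have hne : (frontier Ω).Nonempty := by
    rw [nonempty_iff_ne_empty, Ne, frontier_eq_empty_iff, not_or]
    refine ⟨hΩ.nonempty.ne_empty, fun h => ?_⟩
    exact noncompact_univ E3 (h ▸ hΩ.isCompact)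
  obtain ⟨x, hx⟩ := hne
  obtain ⟨ρ, hρ⟩ := hΩ.smooth_boundary x hx
  obtain ⟨Q, a, b, B, P, t, ht, y, hy, rfl⟩ := exists_isGraphPatch hρ
  have hop : IsOpen (Q '' (Ioo a b ×ˢ B) ∩ {z | ρ z < 0}) :=
    P.isOpen_box.inter (isOpen_lt P.contDiff.continuous continuous_const)
  refine (hop.measure_pos volume ?_).trans_le (measure_mono ?_)
  · refine ⟨Q ((a + t) / 2, y), mem_image_of_mem Q ⟨⟨?_, ?_⟩, hy⟩, ?_⟩
    · simp only; linarith [ht.1]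
    · simp only; linarith [ht.1, ht.2]
    · have hs : (a + t) / 2 ∈ Icc a b := ⟨by linarith [ht.1], by linarith [ht.1, ht.2]⟩
      have h1 := P.strictMonoOn hy hs (Ioo_subset_Icc_self ht) (by linarith [ht.1])
      simp only [hρ.eq_zero] at h1
      exact h1
  · rintro _ ⟨⟨⟨s, v⟩, ⟨hs, hv⟩, rfl⟩, h0⟩
    exact (P.mem_iff s (Ioo_subset_Icc_self hs) v hv).2 (le_of_lt h0)

/-- The field x ↦ ⟨x, ·⟩ v has constant divergence 3v, so its flux through the boundary is 3 |Ω| v,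
which is not zero. -/
theorem IsSurfaceMeasure.ne_zero [CompleteSpace V] [Nontrivial V] {Ω : Set E3} {ν : Measure E3}
    (hν : IsSurfaceMeasure V Ω ν) (hΩ : IsObstacle Ω) : ν ≠ 0 := by
  rintro rfl
  obtain ⟨v, hv⟩ := exists_ne (0 : V)
  set L : E3 →L[ℝ] E3 →L[ℝ] V :=
    ((ContinuousLinearMap.smulRightL ℝ E3 V).flip v).comp (innerSL ℝ) with hL
  have h1 := hν.setIntegral_interior hΩ (F := fun x => L x) L.contDiff
  have h2 : ∀ x, divg (fun x => L x) x = (3 : ℝ) • v := by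
    intro x
    simp only [divg, L.fderiv]
    have : ∀ j, L (stdB j) (stdB j) = v := fun j => by simp [hL]
    simp only [this, Finset.sum_const, Finset.card_univ, Fintype.card_fin]
    rw [← Nat.cast_smul_eq_nsmul ℝ]
    norm_num
  simp only [h2, integral_zero_measure, setIntegral_const, smul_smul] at h1
  rcases smul_eq_zero.1 h1 with h | h
  · have h3 : volume.real Ω ≠ 0 :=
      (ENNReal.toReal_pos (volume_pos hΩ).ne' hΩ.isCompact.measure_lt_top.ne).ne'
    exact (mul_ne_zero h3 (by norm_num)) h
  · exact hv h

theorem surfaceArea_pos {Ω : Set E3} (hΩ : IsObstacle Ω) : 0 < surfaceArea Ω := by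
  obtain ⟨ν, hν⟩ := exists_isSurfaceMeasure (V := ℝ) hΩ
  refine ENNReal.toReal_pos (fun h0 => hν.ne_zero hΩ ?_) (hausdorffMeasure_frontier_lt_top hΩ).ne
  refine Measure.measure_univ_eq_zero.1 (le_antisymm ((hν.le univ).trans ?_) zero_le)
  rw [Measure.smul_apply, Measure.restrict_apply_univ, h0, smul_zero]

theorem IsSurfaceMeasure.real_univ_le {Ω : Set E3} {ν : Measure E3}
    (hν : IsSurfaceMeasure V Ω ν) (hΩ : IsObstacle Ω) : ν.real univ ≤ 2 * surfaceArea Ω := by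
  have h := hν.le univ
  rw [Measure.smul_apply, Measure.restrict_apply_univ, smul_eq_mul] at h
  have h2 := ENNReal.toReal_mono
    (ENNReal.mul_ne_top (by simp) (hausdorffMeasure_frontier_lt_top hΩ).ne) h
  rwa [ENNReal.toReal_mul] at h2

end

/-! ### Green's second identity outside and inside the obstacle -/

section

open scoped ENNReal NNReal

variable {A : Type*} [NormedField A] [NormedAlgebra ℝ A]

theorem laplacian_eq_divg {V : Type*} [NormedAddCommGroup V] [NormedSpace ℝ V] (f : E3 → V)
    (x : E3) : Laplacian.laplacian f x = divg (fderiv ℝ f) x := by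
  rw [InnerProductSpace.laplacian_eq_iteratedFDeriv_orthonormalBasis f stdB, divg]
  simp only [iteratedFDeriv_two_apply]
  simp

/-- A function that is `C²` in the exterior of `Ω` and `C¹` up to the boundary. -/
structure IsExteriorSmooth (Ω : Set E3) (f : E3 → A) : Prop where
  contDiffOn_exterior : ContDiffOn ℝ 2 f Ωᶜ
  contDiffOn_closure : ContDiffOn ℝ 1 f (closure Ωᶜ)

theorem IsExteriorSmooth.of_contDiff {Ω : Set E3} {f : E3 → A} (hf : ContDiff ℝ 2 f) :
    IsExteriorSmooth Ω f :=
  ⟨hf.contDiffOn, (hf.of_le (by norm_num)).contDiffOn⟩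

/-- The derivative of an exterior field, up to the boundary. -/
abbrev extDeriv (Ω : Set E3) (f : E3 → A) (x : E3) : E3 →L[ℝ] A :=
  fderivWithin ℝ f (closure Ωᶜ) x

/-- The field of linear forms `f dg - g df`. -/
def wronskian (Ω : Set E3) (f g : E3 → A) (x : E3) : E3 →L[ℝ] A :=
  f x • extDeriv Ω g x - g x • extDeriv Ω f x

theorem wronskian_apply (Ω : Set E3) (f g : E3 → A) (x v : E3) :
    wronskian Ω f g x v = f x * extDeriv Ω g x v - g x * extDeriv Ω f x v := rfl

variable {Ω : Set E3} {f g : E3 → A}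

theorem extDeriv_eq_fderiv (hΩ : IsClosed Ω) {x : E3} (hx : x ∈ Ωᶜ) :
    extDeriv Ω f x = fderiv ℝ f x :=
  fderivWithin_of_mem_nhds (mem_of_superset (hΩ.isOpen_compl.mem_nhds hx) subset_closure)

theorem extDeriv_eq_fderiv_of_differentiable (hΩ : IsObstacle Ω) {x : E3} (hx : x ∈ closure Ωᶜ)
    (hf : DifferentiableAt ℝ f x) : extDeriv Ω f x = fderiv ℝ f x :=
  hf.fderivWithin (uniqueDiffOn_closure_compl hΩ x hx)

namespace IsExteriorSmooth

theorem continuousOn_extDeriv (hf : IsExteriorSmooth Ω f) (hΩ : IsObstacle Ω) :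
    ContinuousOn (extDeriv Ω f) (closure Ωᶜ) :=
  hf.contDiffOn_closure.continuousOn_fderivWithin (uniqueDiffOn_closure_compl hΩ) le_rfl

theorem contDiffOn_fderiv (hf : IsExteriorSmooth Ω f) (hΩ : IsClosed Ω) :
    ContDiffOn ℝ 1 (fderiv ℝ f) Ωᶜ :=
  hf.contDiffOn_exterior.fderiv_of_isOpen hΩ.isOpen_compl (by norm_num)

theorem continuousOn_wronskian (hf : IsExteriorSmooth Ω f) (hg : IsExteriorSmooth Ω g)
    (hΩ : IsObstacle Ω) : ContinuousOn (wronskian Ω f g) (closure Ωᶜ) :=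
  (hf.contDiffOn_closure.continuousOn.smul (hg.continuousOn_extDeriv hΩ)).sub
    (hg.contDiffOn_closure.continuousOn.smul (hf.continuousOn_extDeriv hΩ))

theorem wronskian_eventuallyEq (hΩ : IsClosed Ω) {x : E3} (hx : x ∈ Ωᶜ) :
    wronskian Ω f g =ᶠ[𝓝 x] fun y => f y • fderiv ℝ g y - g y • fderiv ℝ f y := by
  filter_upwards [hΩ.isOpen_compl.mem_nhds hx] with y hy
  rw [wronskian, extDeriv_eq_fderiv hΩ hy, extDeriv_eq_fderiv hΩ hy]

theorem contDiffOn_wronskian (hf : IsExteriorSmooth Ω f) (hg : IsExteriorSmooth Ω g)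
    (hΩ : IsClosed Ω) : ContDiffOn ℝ 1 (wronskian Ω f g) Ωᶜ := by
  have h1 : ContDiffOn ℝ 1 (fun y => f y • fderiv ℝ g y - g y • fderiv ℝ f y) Ωᶜ :=
    ((hf.contDiffOn_closure.mono subset_closure).smul (hg.contDiffOn_fderiv hΩ)).sub
      ((hg.contDiffOn_closure.mono subset_closure).smul (hf.contDiffOn_fderiv hΩ))
  exact h1.congr fun x hx => (wronskian_eventuallyEq hΩ hx).self_of_nhds

end IsExteriorSmooth

theorem divg_smul_sub_smul {x : E3} (hf : ContDiffAt ℝ 2 f x) (hg : ContDiffAt ℝ 2 g x) :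
    divg (fun y => f y • fderiv ℝ g y - g y • fderiv ℝ f y) x =
      f x * divg (fderiv ℝ g) x - g x * divg (fderiv ℝ f) x := by
  have hf1 : DifferentiableAt ℝ f x := hf.differentiableAt (by norm_num)
  have hg1 : DifferentiableAt ℝ g x := hg.differentiableAt (by norm_num)
  have hf2 : DifferentiableAt ℝ (fderiv ℝ f) x :=
    (hf.fderiv_right (m := 1) (by norm_num)).differentiableAt (by norm_num)
  have hg2 : DifferentiableAt ℝ (fderiv ℝ g) x :=
    (hg.fderiv_right (m := 1) (by norm_num)).differentiableAt (by norm_num)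
  simp only [divg, Finset.mul_sum, ← Finset.sum_sub_distrib]
  refine Finset.sum_congr rfl fun j _ => ?_
  rw [fderiv_fun_sub (hf1.fun_smul hg2) (hg1.fun_smul hf2), fderiv_fun_smul hf1 hg2,
    fderiv_fun_smul hg1 hf2]
  simp
  ring

theorem IsExteriorSmooth.divg_wronskian (hf : IsExteriorSmooth Ω f) (hg : IsExteriorSmooth Ω g)
    (hΩ : IsClosed Ω) {x : E3} (hx : x ∈ Ωᶜ) :
    divg (wronskian Ω f g) x = f x * divg (fderiv ℝ g) x - g x * divg (fderiv ℝ f) x := by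
  rw [divg_congr (wronskian_eventuallyEq hΩ hx)]
  have hn := hΩ.isOpen_compl.mem_nhds hx
  exact divg_smul_sub_smul (hf.contDiffOn_exterior.contDiffAt hn)
    (hg.contDiffOn_exterior.contDiffAt hn)

/-- Green's second identity in the exterior of `Ω`, with a radial cutoff. -/
theorem IsSurfaceMeasure.green [CompleteSpace A] {ν : Measure E3} (hν : IsSurfaceMeasure A Ω ν)
    (hΩ : IsObstacle Ω) (hf : IsExteriorSmooth Ω f) (hg : IsExteriorSmooth Ω g) {s : E3 → A}
    (hs : ContinuousOn s (closure Ωᶜ))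
    (hfg : ∀ x ∈ Ωᶜ, f x * divg (fderiv ℝ g) x - g x * divg (fderiv ℝ f) x = s x)
    {R : ℝ} (hR : 0 < R) (hΩR : ∀ x ∈ Ω, ‖x‖ ≤ R) :
    ∫ x, wronskian Ω f g x (outwardNormal Ω x) ∂ν =
      (∫ x, stepDeriv (‖x‖ - R) • wronskian Ω f g x (‖x‖⁻¹ • x)) -
        ∫ x in Ωᶜ, radialCutoff R x • s x := by
  have hcl : IsClosed Ω := hΩ.isCompact.isClosed
  have hmΩ : MeasurableSet Ωᶜ := hcl.isOpen_compl.measurableSet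
  have hχ := contDiff_radialCutoff hR
  have hW1 := hf.continuousOn_wronskian hg hΩ
  have hW2 := hf.contDiffOn_wronskian hg hcl
  have hcs := hasCompactSupport_radialCutoff R
  set F : E3 → E3 →L[ℝ] A := fun x => radialCutoff R x • wronskian Ω f g x with hF
  -- The gradient of the radial cutoff is minus the shell weight times x/|x|; this is where a
  -- weighted shell takes the place of the sphere of radius R.
  have hdF : ∀ x ∈ Ωᶜ, divg F x = radialCutoff R x • s x -
      stepDeriv (‖x‖ - R) • wronskian Ω f g x (‖x‖⁻¹ • x) := by
    intro x hx
    rw [hF, divg_smul (hχ.differentiable (by simp)).differentiableAt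
      ((hW2.contDiffAt (hcl.isOpen_compl.mem_nhds hx)).differentiableAt (by simp)),
      hf.divg_wronskian hg hcl hx, hfg x hx, gradient_radialCutoff hR, map_neg, map_smul]
    exact (sub_eq_add_neg _ _).symm
  have hint1 : IntegrableOn (fun x => radialCutoff R x • s x) Ωᶜ :=
    (integrableOn_of_continuousOn_of_support isClosed_closure
      (hχ.continuous.continuousOn.smul hs) hcs.isCompact fun x hx => by
        simp [image_eq_zero_of_notMem_tsupport hx]).mono_set subset_closure
  have hint2 : IntegrableOn (fun x => stepDeriv (‖x‖ - R) • wronskian Ω f g x (‖x‖⁻¹ • x))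
      Ωᶜ := by
    have h1 : IntegrableOn (fun x => wronskian Ω f g x (∇ (radialCutoff R) x)) Ωᶜ := by
      refine (integrableOn_of_continuousOn_of_support isClosed_closure
        (hW1.clm_apply (continuous_gradient hχ).continuousOn) hcs.isCompact fun x hx => ?_).mono_set
        subset_closure
      rw [gradient, (notMem_tsupport_iff_eventuallyEq.1 hx).fderiv_eq]
      simp
    refine h1.neg.congr (Eventually.of_forall fun x => ?_)
    simp only [Pi.neg_apply]
    rw [gradient_radialCutoff hR, map_neg, map_smul, neg_neg]
  have hext : IsExteriorField Ω F :=
    { hasCompactSupport := hcs.mono fun y hy h0 => hy (by simp [hF, h0])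
      continuousOn := hχ.continuous.continuousOn.smul hW1
      contDiffOn := hχ.contDiffOn.smul hW2
      integrableOn := (hint1.sub hint2).congr (by
        filter_upwards [ae_restrict_mem hmΩ] with x hx
        rw [hdF x hx, Pi.sub_apply]) }
  have h1 := hν.setIntegral_divg F hext
  have h2 : ∫ x, F x (outwardNormal Ω x) ∂ν =
      ∫ x, wronskian Ω f g x (outwardNormal Ω x) ∂ν := by
    refine integral_congr_ae ?_
    filter_upwards [ae_mem_frontier hν.le] with x hx
    simp only [hF]
    rw [radialCutoff_of_le (hΩR x (hcl.frontier_subset hx)), one_smul]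
  have h3 : ∫ x in Ωᶜ, stepDeriv (‖x‖ - R) • wronskian Ω f g x (‖x‖⁻¹ • x) =
      ∫ x, stepDeriv (‖x‖ - R) • wronskian Ω f g x (‖x‖⁻¹ • x) := by
    refine setIntegral_eq_integral_of_forall_compl_eq_zero fun x hx => ?_
    rw [stepDeriv_of_nonpos (by linarith [hΩR x (not_not.1 hx)]), zero_smul]
  have h4 : ∫ x in Ωᶜ, divg F x = (∫ x in Ωᶜ, radialCutoff R x • s x) -
      ∫ x in Ωᶜ, stepDeriv (‖x‖ - R) • wronskian Ω f g x (‖x‖⁻¹ • x) :=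
    (setIntegral_congr_fun hmΩ hdF).trans (integral_sub hint1 hint2)
  rw [← h2, ← h3, ← neg_eq_iff_eq_neg.2 h1, h4, neg_sub]

/-- Green's second identity inside `Ω`. -/
theorem IsSurfaceMeasure.green_interior [CompleteSpace A] {ν : Measure E3}
    (hν : IsSurfaceMeasure A Ω ν) (hΩ : IsObstacle Ω) (hf : ContDiff ℝ 2 f) (hg : ContDiff ℝ 2 g)
    (hfg : ∀ x ∈ Ω, f x * divg (fderiv ℝ g) x - g x * divg (fderiv ℝ f) x = 0) :
    ∫ x, wronskian Ω f g x (outwardNormal Ω x) ∂ν = 0 := by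
  have hcl : IsClosed Ω := hΩ.isCompact.isClosed
  have hF : ContDiff ℝ 1 (fun y => f y • fderiv ℝ g y - g y • fderiv ℝ f y) :=
    ((hf.of_le (by norm_num)).smul (hg.fderiv_right (by norm_num))).sub
      ((hg.of_le (by norm_num)).smul (hf.fderiv_right (by norm_num)))
  have h1 := hν.setIntegral_interior hΩ hF
  have h2 : ∫ x in Ω, divg (fun y => f y • fderiv ℝ g y - g y • fderiv ℝ f y) x = 0 := by
    rw [setIntegral_congr_fun hcl.measurableSet (g := fun _ => 0) fun x hx => ?_]
    · simp
    · simp only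
      rw [divg_smul_sub_smul hf.contDiffAt hg.contDiffAt, hfg x hx]
  rw [← h2, h1]
  refine integral_congr_ae ?_
  filter_upwards [ae_mem_frontier hν.le] with x hx
  have hx' := frontier_subset_closure_compl Ω hx
  rw [wronskian, extDeriv_eq_fderiv_of_differentiable hΩ hx'
    (hf.differentiable (by norm_num)).differentiableAt,
    extDeriv_eq_fderiv_of_differentiable hΩ hx' (hg.differentiable (by norm_num)).differentiableAt]

end

/-! ### Polar coordinates and weighted shell averages -/

section

open scoped ENNReal NNReal

/-- The surface measure of the unit sphere. -/
abbrev sphereMeasure : Measure (Metric.sphere (0 : E3) 1) := (volume : Measure E3).toSphere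

theorem sphereMeasure_real_univ : sphereMeasure.real univ = 4 * Real.pi := by
  rw [Measure.toSphere_real_apply_univ, measureReal_def, EuclideanSpace.volume_ball_fin_three]
  rw [ENNReal.toReal_mul, ENNReal.toReal_ofReal (by positivity)]
  simp
  ring

variable {V : Type*} [NormedAddCommGroup V] [NormedSpace ℝ V]

/-- This links the shell integrals of Green's formula to the integrals over the unit sphere in which
the radiation condition and the cross sections are expressed. -/
theorem integral_eq_integral_sphere {h : E3 → V} (hh : Integrable h) :
    ∫ x, h x = ∫ r in Ioi (0 : ℝ), r ^ 2 • ∫ θ, h (r • (θ : E3)) ∂sphereMeasure := by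
  have hd : Module.finrank ℝ E3 - 1 = 2 := by simp
  have hmp := (volume : Measure E3).measurePreserving_homeomorphUnitSphereProd
  rw [hd] at hmp
  have hemb := (homeomorphUnitSphereProd E3).measurableEmbedding
  set g : Metric.sphere (0 : E3) 1 × Ioi (0 : ℝ) → V := fun p => h (p.2.1 • (p.1 : E3)) with hg
  have hgc : ∀ x : ({(0 : E3)}ᶜ : Set E3), g (homeomorphUnitSphereProd E3 x) = h x := by
    intro x
    have hx : ‖(x : E3)‖ ≠ 0 := norm_ne_zero_iff.2 x.2
    simp [hg, smul_smul, mul_inv_cancel₀ hx]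
  have hgi : Integrable g (sphereMeasure.prod (Measure.volumeIoiPow 2)) := by
    rw [← hmp.integrable_comp_emb hemb]
    have h1 : Integrable (fun x : ({(0 : E3)}ᶜ : Set E3) => h x)
        (Measure.comap Subtype.val volume) := by
      have := (integrableOn_iff_comap_subtypeVal (f := h) (μ := (volume : Measure E3))
        (measurableSet_singleton (0 : E3)).compl).1 hh.integrableOn
      exact this
    exact h1.congr (Eventually.of_forall fun x => (hgc x).symm)
  calc ∫ x, h x = ∫ x : ({(0 : E3)}ᶜ : Set E3), h x ∂(Measure.comap Subtype.val volume) := by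
        rw [integral_subtype_comap (measurableSet_singleton _).compl h, restrict_compl_singleton]
    _ = ∫ x : ({(0 : E3)}ᶜ : Set E3), g (homeomorphUnitSphereProd E3 x)
          ∂(Measure.comap Subtype.val volume) := by simp only [hgc]
    _ = ∫ p, g p ∂(sphereMeasure.prod (Measure.volumeIoiPow 2)) := hmp.integral_comp hemb g
    _ = ∫ r : Ioi (0 : ℝ), ∫ θ, h (r.1 • (θ : E3)) ∂sphereMeasure ∂(Measure.volumeIoiPow 2) :=
        integral_prod_symm g hgi
    _ = _ := by
      simp only [Measure.volumeIoiPow, ENNReal.ofReal]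
      rw [integral_withDensity_eq_integral_smul, integral_subtype_comap measurableSet_Ioi
          fun a : ℝ => Real.toNNReal (a ^ 2) • ∫ θ, h (a • (θ : E3)) ∂sphereMeasure,
        setIntegral_congr_fun measurableSet_Ioi fun x hx => ?_]
      · rw [NNReal.smul_def, Real.coe_toNNReal _ (pow_nonneg (le_of_lt hx) _)]
      · exact (measurable_subtype_coe.pow_const _).real_toNNReal

theorem isClosed_setOf_le_norm (R : ℝ) : IsClosed {x : E3 | R ≤ ‖x‖} :=
  isClosed_le continuous_const continuous_norm

theorem continuous_stepDeriv_norm (R : ℝ) : Continuous fun x : E3 => stepDeriv (‖x‖ - R) :=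
  continuous_stepDeriv.comp (continuous_norm.sub continuous_const)

theorem integrable_stepDeriv_smul {R : ℝ} {g : E3 → V} (hg : ContinuousOn g {x | R ≤ ‖x‖}) :
    Integrable fun x => stepDeriv (‖x‖ - R) • g x := by
  have h1 : IntegrableOn (fun x => stepDeriv (‖x‖ - R) • g x) {x | R ≤ ‖x‖} := by
    refine integrableOn_of_continuousOn_of_support (isClosed_setOf_le_norm R)
      ((continuous_stepDeriv_norm R).continuousOn.smul hg)
      (isCompact_closedBall (0 : E3) (R + 1)) fun x hx => ?_
    rw [stepDeriv_of_one_le, zero_smul]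
    simp only [Metric.mem_closedBall, dist_zero_right, not_le] at hx
    linarith
  rwa [integrableOn_iff_integrable_of_support_subset] at h1
  intro x hx
  by_contra h
  simp only [mem_ofPred_eq, not_le] at h
  exact hx (by simp [stepDeriv_of_nonpos (show ‖x‖ - R ≤ 0 by linarith)])

theorem integral_stepDeriv (R : ℝ) : ∫ r in R..(R + 1), stepDeriv (r - R) = 1 := by
  rw [intervalIntegral.integral_eq_sub_of_hasDerivAt
    (f := fun r => Real.smoothTransition (r - R))]
  · simp
  · intro r _
    exact (hasDerivAt_smoothTransition (r - R)).comp_sub_const r R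
  · exact (continuous_stepDeriv.comp (by fun_prop)).intervalIntegrable _ _

/-- A shell average as an average of spherical integrals. -/
theorem integral_stepDeriv_smul {R : ℝ} (hR : 0 < R) {g : E3 → V}
    (hg : ContinuousOn g {x | R ≤ ‖x‖}) :
    ∫ x, stepDeriv (‖x‖ - R) • g x =
      ∫ r in R..(R + 1), stepDeriv (r - R) • (r ^ 2 • ∫ θ, g (r • (θ : E3)) ∂sphereMeasure) := by
  rw [integral_eq_integral_sphere (integrable_stepDeriv_smul hg),
    intervalIntegral.integral_of_le (by linarith)]
  have h1 : ∀ r ∈ Ioi (0 : ℝ),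
      r ^ 2 • ∫ θ, stepDeriv (‖r • (θ : E3)‖ - R) • g (r • (θ : E3)) ∂sphereMeasure =
      stepDeriv (r - R) • (r ^ 2 • ∫ θ, g (r • (θ : E3)) ∂sphereMeasure) := by
    intro r hr
    have : ∀ θ : Metric.sphere (0 : E3) 1, ‖r • (θ : E3)‖ = r := fun θ => by
      rw [norm_smul, norm_eq_of_mem_sphere, mul_one, Real.norm_of_nonneg (le_of_lt hr)]
    simp only [this]
    rw [integral_smul, smul_comm]
  rw [setIntegral_congr_fun measurableSet_Ioi h1]
  refine setIntegral_eq_of_subset_of_forall_sdiff_eq_zero measurableSet_Ioi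
    (fun r hr => hR.trans hr.1) fun r hr => ?_
  rcases le_or_gt r R with h | h
  · rw [stepDeriv_of_nonpos (by linarith), zero_smul]
  · rw [stepDeriv_of_one_le, zero_smul]
    have := hr.2
    simp only [mem_Ioc, not_and, not_le] at this
    linarith [this h]

/-- The shell weight has total mass one in the radius, so a bound on every spherical integral with r
≥ R passes to the shell. -/
theorem norm_integral_stepDeriv_smul_le {R : ℝ} (hR : 0 < R) {g : E3 → V}
    (hg : ContinuousOn g {x | R ≤ ‖x‖}) {C : ℝ}
    (hC : ∀ r, R ≤ r → ‖r ^ 2 • ∫ θ, g (r • (θ : E3)) ∂sphereMeasure‖ ≤ C) :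
    ‖∫ x, stepDeriv (‖x‖ - R) • g x‖ ≤ C := by
  rw [integral_stepDeriv_smul hR hg]
  have h1 : ∫ r in R..(R + 1), stepDeriv (r - R) * C = C := by
    rw [intervalIntegral.integral_mul_const, integral_stepDeriv, one_mul]
  rw [← h1]
  refine intervalIntegral.norm_integral_le_of_norm_le (by linarith) ?_ ?_
  · refine Eventually.of_forall fun r hr => ?_
    rw [norm_smul, Real.norm_of_nonneg (stepDeriv_nonneg _)]
    exact mul_le_mul_of_nonneg_left (hC r hr.1.le) (stepDeriv_nonneg _)
  · exact ((continuous_stepDeriv.comp (by fun_prop)).mul continuous_const).intervalIntegrable _ _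

theorem norm_integral_stepDeriv_smul_le_of_norm_le {R : ℝ} (hR : 0 < R) {g : E3 → V}
    (hg : ContinuousOn g {x | R ≤ ‖x‖}) {C : ℝ} (hC : ∀ x, R ≤ ‖x‖ → ‖g x‖ ≤ C / ‖x‖ ^ 2) :
    ‖∫ x, stepDeriv (‖x‖ - R) • g x‖ ≤ 4 * Real.pi * C := by
  refine norm_integral_stepDeriv_smul_le hR hg fun r hr => ?_
  have hr0 : 0 < r := hR.trans_le hr
  have h1 : ‖∫ θ, g (r • (θ : E3)) ∂sphereMeasure‖ ≤ C / r ^ 2 * sphereMeasure.real univ := by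
    refine norm_integral_le_of_norm_le_const (Eventually.of_forall fun θ => ?_)
    have hn : ‖r • (θ : E3)‖ = r := by
      rw [norm_smul, norm_eq_of_mem_sphere, mul_one, Real.norm_of_nonneg hr0.le]
    have := hC (r • (θ : E3)) (by rw [hn]; exact hr)
    rwa [hn] at this
  rw [norm_smul, Real.norm_of_nonneg (by positivity)]
  calc r ^ 2 * ‖∫ θ, g (r • (θ : E3)) ∂sphereMeasure‖
      ≤ r ^ 2 * (C / r ^ 2 * sphereMeasure.real univ) := by gcongr
    _ = 4 * Real.pi * C := by rw [sphereMeasure_real_univ]; field_simp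

theorem tendsto_integral_stepDeriv_smul_zero {R₀ : ℝ} {g : E3 → V}
    (hg : ContinuousOn g {x | R₀ ≤ ‖x‖})
    (hl : Tendsto (fun r : ℝ => r ^ 2 • ∫ θ, g (r • (θ : E3)) ∂sphereMeasure) atTop (𝓝 0)) :
    Tendsto (fun R : ℝ => ∫ x, stepDeriv (‖x‖ - R) • g x) atTop (𝓝 0) := by
  rw [Metric.tendsto_atTop] at hl ⊢
  intro ε hε
  obtain ⟨N, hN⟩ := hl (ε / 2) (by positivity)
  refine ⟨max N (max R₀ 1), fun R hR => ?_⟩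
  have hR1 : N ≤ R := (le_max_left _ _).trans hR
  have hR2 : R₀ ≤ R := ((le_max_left _ _).trans (le_max_right _ _)).trans hR
  have hR3 : 1 ≤ R := ((le_max_right _ _).trans (le_max_right _ _)).trans hR
  rw [dist_zero_right]
  refine (norm_integral_stepDeriv_smul_le (by linarith)
    (hg.mono fun x (hx : R ≤ ‖x‖) => hR2.trans hx) (C := ε / 2) fun r hr => ?_).trans_lt
    (by linarith)
  have := hN r (hR1.trans hr)
  rw [dist_zero_right] at this
  exact this.le

theorem continuousOn_comp_normalize {f : E3 → V} (hf : Continuous f) :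
    ContinuousOn (fun x : E3 => (‖x‖ ^ 2)⁻¹ • f (‖x‖⁻¹ • x)) {x | 0 < ‖x‖} := by
  have h1 : ∀ x ∈ {x : E3 | 0 < ‖x‖}, ‖x‖ ≠ 0 := fun x hx => ne_of_gt hx
  refine ContinuousOn.smul (ContinuousOn.inv₀ (by fun_prop) fun x hx => pow_ne_zero 2 (h1 x hx)) ?_
  exact hf.comp_continuousOn
    (ContinuousOn.smul (ContinuousOn.inv₀ (by fun_prop) h1) continuousOn_id)

/-- Homogeneity of degree -2 exactly compensates the factor r² of the area element, so every shell
gives the integral over the unit sphere with no error. -/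
theorem integral_stepDeriv_smul_homogeneous [CompleteSpace V] {R : ℝ} (hR : 0 < R) {f : E3 → V}
    (hf : Continuous f) :
    ∫ x, stepDeriv (‖x‖ - R) • ((‖x‖ ^ 2)⁻¹ • f (‖x‖⁻¹ • x)) = ∫ θ, f (θ : E3) ∂sphereMeasure := by
  rw [integral_stepDeriv_smul hR ((continuousOn_comp_normalize hf).mono
    fun x (hx : R ≤ ‖x‖) => hR.trans_le hx)]
  have h1 : ∀ r ∈ uIcc R (R + 1), stepDeriv (r - R) • (r ^ 2 • ∫ θ : Metric.sphere (0 : E3) 1,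
      (‖r • (θ : E3)‖ ^ 2)⁻¹ • f (‖r • (θ : E3)‖⁻¹ • r • (θ : E3)) ∂sphereMeasure) =
      stepDeriv (r - R) • ∫ θ, f (θ : E3) ∂sphereMeasure := by
    intro r hr
    rw [uIcc_of_le (by linarith)] at hr
    have hr0 : 0 < r := hR.trans_le hr.1
    have : ∀ θ : Metric.sphere (0 : E3) 1, ‖r • (θ : E3)‖ = r := fun θ => by
      rw [norm_smul, norm_eq_of_mem_sphere, mul_one, Real.norm_of_nonneg hr0.le]
    simp only [this, smul_smul, inv_mul_cancel₀ hr0.ne', one_smul]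
    rw [integral_smul, smul_smul, mul_assoc, mul_inv_cancel₀ (by positivity), mul_one]
  rw [intervalIntegral.integral_congr h1, intervalIntegral.integral_smul_const,
    integral_stepDeriv, one_smul]

end

/-! ### Radial fields and their Laplacian -/

section

open scoped ENNReal NNReal

variable {V : Type*} [NormedAddCommGroup V] [NormedSpace ℝ V]

/-- The radial field `h(N) / N`, where `N` is the distance from `r`. -/
def radialField (h : ℝ → V) (r y : E3) : V := ‖y - r‖⁻¹ • h ‖y - r‖

theorem hasFDerivAt_comp_norm_sub {φ : ℝ → V} {φ' : V} {r x : E3} (hx : x ≠ r)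
    (hφ : HasDerivAt φ φ' ‖x - r‖) :
    HasFDerivAt (fun y => φ ‖y - r‖) ((innerSL ℝ (‖x - r‖⁻¹ • (x - r))).smulRight φ') x := by
  have hx' : x - r ≠ 0 := sub_ne_zero.2 hx
  have h1 : HasFDerivAt (fun y : E3 => ‖y‖) (innerSL ℝ (‖x - r‖⁻¹ • (x - r))) (x - r) := by
    have h2 : DifferentiableAt ℝ (fun y : E3 => ‖y‖) (x - r) :=
      (contDiffAt_norm ℝ hx' (n := 1)).differentiableAt (by norm_num)
    have h3 : fderiv ℝ (fun y : E3 => ‖y‖) (x - r) = innerSL ℝ (‖x - r‖⁻¹ • (x - r)) := by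
      ext v
      exact fderiv_norm_apply hx' v
    exact h3 ▸ h2.hasFDerivAt
  have hs : HasFDerivAt (fun y : E3 => y - r) (ContinuousLinearMap.id ℝ E3) x :=
    (hasFDerivAt_id x).sub_const r
  have h4 : HasFDerivAt (fun y : E3 => ‖y - r‖) (innerSL ℝ (‖x - r‖⁻¹ • (x - r))) x :=
    (HasFDerivAt.comp x h1 hs).congr_fderiv (ContinuousLinearMap.comp_id _)
  have h5 := hφ.hasFDerivAt.comp x h4
  refine h5.congr_fderiv ?_
  ext v
  simp only [ContinuousLinearMap.comp_apply, ContinuousLinearMap.toSpanSingleton_apply,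
    ContinuousLinearMap.smulRight_apply]

theorem contDiff_comp_norm_sub {n : WithTop ℕ∞} {φ : ℝ → V} {r : E3} {ε : ℝ} (hε : 0 < ε)
    (hφ : ∀ s, 0 < s → ContDiffAt ℝ n φ s) (h0 : ∀ s, 0 ≤ s → s < ε → φ s = 0) :
    ContDiff ℝ n fun y => φ ‖y - r‖ := by
  rw [contDiff_iff_contDiffAt]
  intro x
  by_cases hx : x = r
  · have h1 : (fun y => φ ‖y - r‖) =ᶠ[𝓝 x] fun _ => 0 := by
      have h2 : ∀ᶠ y in 𝓝 x, ‖y - r‖ < ε := by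
        have : Continuous fun y : E3 => ‖y - r‖ := by fun_prop
        exact this.continuousAt.eventually_lt continuousAt_const (by simpa [hx] using hε)
      filter_upwards [h2] with y hy using h0 _ (norm_nonneg _) hy
    exact contDiffAt_const.congr_of_eventuallyEq h1
  · have hx' : x - r ≠ 0 := sub_ne_zero.2 hx
    have h1 : ContDiffAt ℝ n (fun y : E3 => ‖y - r‖) x :=
      (contDiffAt_id.sub contDiffAt_const).norm ℝ hx'
    exact (hφ ‖x - r‖ (norm_pos_iff.2 hx')).comp x h1

theorem contDiff_radialField {n : WithTop ℕ∞} {h : ℝ → V} {r : E3} {ε : ℝ} (hε : 0 < ε)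
    (hh : ContDiff ℝ n h) (h0 : ∀ s, s < ε → h s = 0) : ContDiff ℝ n (radialField h r) := by
  refine contDiff_comp_norm_sub (φ := fun s => s⁻¹ • h s) hε (fun s hs => ?_)
    fun s _ hs => by simp [h0 s hs]
  exact (contDiffAt_inv ℝ hs.ne').smul hh.contDiffAt

theorem hasFDerivAt_radialField {h : ℝ → V} {h' : V} {r x : E3} (hx : x ≠ r)
    (hh : HasDerivAt h h' ‖x - r‖) :
    HasFDerivAt (radialField h r) ((innerSL ℝ (x - r)).smulRight
      ((‖x - r‖ ^ 2)⁻¹ • h' - (‖x - r‖ ^ 3)⁻¹ • h ‖x - r‖)) x := by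
  have hN : ‖x - r‖ ≠ 0 := norm_ne_zero_iff.2 (sub_ne_zero.2 hx)
  have h1 := (hasDerivAt_inv hN).smul hh
  refine (hasFDerivAt_comp_norm_sub hx h1).congr_fderiv ?_
  ext v
  simp only [ContinuousLinearMap.smulRight_apply, innerSL_apply_apply, real_inner_smul_left]
  generalize inner ℝ (x - r) v = c
  rw [smul_add, smul_sub, smul_smul, smul_smul, smul_smul, smul_smul,
    sub_eq_add_neg (_ • h'), ← neg_smul]
  congr 2 <;> field_simp

theorem fderiv_radialField_apply {h : ℝ → V} {h' : V} {r x : E3} (hx : x ≠ r)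
    (hh : HasDerivAt h h' ‖x - r‖) (v : E3) :
    fderiv ℝ (radialField h r) x v = inner ℝ (x - r) v •
      ((‖x - r‖ ^ 2)⁻¹ • h' - (‖x - r‖ ^ 3)⁻¹ • h ‖x - r‖) := by
  rw [(hasFDerivAt_radialField hx hh).fderiv]
  rfl

/-- The Laplacian of a radial field. -/
theorem divg_fderiv_radialField {h h₁ : ℝ → V} {h₂ : V} {r x : E3} (hx : x ≠ r)
    (hd : ∀ s, HasDerivAt h (h₁ s) s) (hd₁ : HasDerivAt h₁ h₂ ‖x - r‖)
    (hF : DifferentiableAt ℝ (fderiv ℝ (radialField h r)) x) :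
    divg (fderiv ℝ (radialField h r)) x = ‖x - r‖⁻¹ • h₂ := by
  have hN : ‖x - r‖ ≠ 0 := norm_ne_zero_iff.2 (sub_ne_zero.2 hx)
  set N := ‖x - r‖ with hNdef
  set m : ℝ → V := fun s => (s ^ 2)⁻¹ • h₁ s - (s ^ 3)⁻¹ • h s with hm
  have hm' : HasDerivAt m ((N ^ 2)⁻¹ • h₂ - (3 * (N ^ 3)⁻¹) • h₁ N + (3 * (N ^ 4)⁻¹) • h N) N := by
    have a1 : HasDerivAt (fun s : ℝ => (s ^ 2)⁻¹) (-2 * (N ^ 3)⁻¹) N :=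
      ((hasDerivAt_pow 2 N).fun_inv (pow_ne_zero 2 hN)).congr_deriv (by push_cast; field_simp)
    have a2 : HasDerivAt (fun s : ℝ => (s ^ 3)⁻¹) (-3 * (N ^ 4)⁻¹) N :=
      ((hasDerivAt_pow 3 N).fun_inv (pow_ne_zero 3 hN)).congr_deriv (by push_cast; field_simp)
    refine ((a1.fun_smul hd₁).fun_sub (a2.fun_smul (hd N))).congr_deriv ?_
    module
  have hmf := hasFDerivAt_comp_norm_sub hx hm'
  -- The first derivative in direction e is ⟨y - r, e⟩ m(|y - r|); one more derivative gives this
  -- formula. Summed over an orthonormal basis, the squared norms give 3 and the squared inner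
  -- products N², and all terms in h and h₁ cancel.
  have key : ∀ e : E3, fderiv ℝ (fderiv ℝ (radialField h r)) x e e =
      (‖e‖ ^ 2) • m N + (inner ℝ (x - r) e ^ 2 * N⁻¹) •
        ((N ^ 2)⁻¹ • h₂ - (3 * (N ^ 3)⁻¹) • h₁ N + (3 * (N ^ 4)⁻¹) • h N) := by
    intro e
    have b1 : HasFDerivAt (fun y => fderiv ℝ (radialField h r) y e)
        ((fderiv ℝ (fderiv ℝ (radialField h r)) x).flip e) x := by
      have := hF.hasFDerivAt.clm_apply (hasFDerivAt_const e x)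
      simpa using this
    have b2 : (fun y => fderiv ℝ (radialField h r) y e) =ᶠ[𝓝 x]
        fun y => inner ℝ (y - r) e • m ‖y - r‖ := by
      filter_upwards [isOpen_ne.mem_nhds hx] with y hy
      exact fderiv_radialField_apply hy (hd _) e
    have b3 : HasFDerivAt (fun y : E3 => inner ℝ (y - r) e) (innerSL ℝ e) x := by
      have : HasFDerivAt (fun y : E3 => innerSL ℝ e (y - r)) (innerSL ℝ e) x :=
        (innerSL ℝ e).hasFDerivAt.comp x ((hasFDerivAt_id x).sub_const r)
      exact this.congr_of_eventuallyEq (Eventually.of_forall fun y => real_inner_comm _ _)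
    have b4 := (b3.fun_smul hmf).congr_of_eventuallyEq b2
    have b5 := congrArg (fun L : E3 →L[ℝ] V => L e) (b1.unique b4)
    simp only [ContinuousLinearMap.flip_apply] at b5
    rw [b5]
    simp only [_root_.add_apply, _root_.smul_apply,
      ContinuousLinearMap.smulRight_apply, innerSL_apply_apply, real_inner_self_eq_norm_sq,
      real_inner_smul_left, smul_smul]
    rw [add_comm]
    congr 2
    ring
  rw [divg, Finset.sum_congr rfl fun j _ => key (stdB j), Finset.sum_add_distrib,
    ← Finset.sum_smul, ← Finset.sum_smul, ← Finset.sum_mul]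
  have c1 : ∑ j, ‖stdB j‖ ^ 2 = 3 := by simp
  have c2 : ∑ j, inner ℝ (x - r) (stdB j) ^ 2 = N ^ 2 := by
    rw [hNdef, ← stdB.sum_sq_norm_inner_left (x - r)]
    simp
  rw [c1, c2, hm]
  simp only [smul_add, smul_sub, smul_smul]
  have d1 : (3 : ℝ) * (N ^ 2)⁻¹ = N ^ 2 * N⁻¹ * (3 * (N ^ 3)⁻¹) := by field_simp
  have d2 : (3 : ℝ) * (N ^ 3)⁻¹ = N ^ 2 * N⁻¹ * (3 * (N ^ 4)⁻¹) := by field_simp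
  have d3 : N ^ 2 * N⁻¹ * (N ^ 2)⁻¹ = N⁻¹ := by field_simp
  rw [d1, d2, d3]
  abel

end

/-! ### The cut-off outgoing profile and its source -/

section

open scoped ENNReal NNReal

theorem hasCompactSupport_stepDeriv : HasCompactSupport stepDeriv := by
  refine HasCompactSupport.intro (isCompact_Icc (a := (0 : ℝ)) (b := 1)) fun s hs => ?_
  rcases le_or_gt s 0 with h | h
  · exact stepDeriv_of_nonpos h
  · refine stepDeriv_of_one_le (le_of_lt ?_)
    by_contra h1
    exact hs ⟨h.le, not_lt.1 h1⟩

theorem continuous_deriv_stepDeriv : Continuous (deriv stepDeriv) :=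
  contDiff_stepDeriv.continuous_deriv (by simp)

theorem hasDerivAt_stepDeriv (s : ℝ) : HasDerivAt stepDeriv (deriv stepDeriv s) s :=
  ((contDiff_stepDeriv.differentiable (by simp)) s).hasDerivAt

theorem deriv_stepDeriv_of_neg {s : ℝ} (hs : s < 0) : deriv stepDeriv s = 0 := by
  have h : stepDeriv =ᶠ[𝓝 s] fun _ => 0 := by
    filter_upwards [gt_mem_nhds hs] with t ht using stepDeriv_of_nonpos ht.le
  rw [h.deriv_eq, deriv_const]

theorem deriv_stepDeriv_of_one_le {s : ℝ} (hs : 1 ≤ s) : deriv stepDeriv s = 0 := by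
  -- At s = 1 the function is known to vanish only to the right, and the one-sided derivative
  -- already determines the derivative.
  have h : ∀ t ∈ Ici s, stepDeriv t = (fun _ => (0 : ℝ)) t := fun t ht =>
    stepDeriv_of_one_le (hs.trans ht)
  have h1 := (hasDerivAt_stepDeriv s).hasDerivWithinAt (s := Ici s)
  have h2 : HasDerivWithinAt stepDeriv 0 (Ici s) s :=
    (hasDerivWithinAt_const s (Ici s) (0 : ℝ)).congr h (h s self_mem_Ici)
  exact (uniqueDiffOn_Ici s s self_mem_Ici).eq_deriv _ h1 h2

theorem exists_stepDeriv_bound :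
    ∃ C : ℝ, 0 ≤ C ∧ ∀ s, ‖stepDeriv s‖ ≤ C ∧ ‖deriv stepDeriv s‖ ≤ C := by
  obtain ⟨C₁, h₁⟩ := hasCompactSupport_stepDeriv.exists_bound_of_continuous continuous_stepDeriv
  obtain ⟨C₂, h₂⟩ :=
    hasCompactSupport_stepDeriv.deriv.exists_bound_of_continuous continuous_deriv_stepDeriv
  exact ⟨max C₁ C₂, (norm_nonneg _).trans ((h₁ 0).trans (le_max_left _ _)),
    fun s => ⟨(h₁ s).trans (le_max_left _ _), (h₂ s).trans (le_max_right _ _)⟩⟩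

/-- The profile `exp (i k s) / 4π` of an outgoing spherical wave. -/
def outgoing (k s : ℝ) : ℂ := (4 * Real.pi : ℝ)⁻¹ • Complex.exp (Complex.I * k * s)

theorem norm_outgoing (k s : ℝ) : ‖outgoing k s‖ = (4 * Real.pi)⁻¹ := by
  have h : Complex.I * k * s = ((k * s : ℝ) : ℂ) * Complex.I := by push_cast; ring
  rw [outgoing, norm_smul, h, Complex.norm_exp_ofReal_mul_I, mul_one, Real.norm_of_nonneg]
  positivity

theorem hasDerivAt_outgoing (k s : ℝ) :
    HasDerivAt (outgoing k) (Complex.I * k * outgoing k s) s := by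
  have h1 : HasDerivAt (fun t : ℝ => Complex.I * k * (t : ℂ)) (Complex.I * k) s := by
    simpa using (Complex.ofRealCLM.hasDerivAt (x := s)).const_mul (Complex.I * k)
  refine (h1.cexp.const_smul (4 * Real.pi : ℝ)⁻¹).congr_deriv ?_
  simp only [outgoing, Complex.real_smul]
  ring

theorem contDiff_outgoing (k : ℝ) : ContDiff ℝ ∞ (outgoing k) := by
  unfold outgoing
  exact (ContDiff.cexp (contDiff_const.mul Complex.ofRealCLM.contDiff)).const_smul _

/-- The outgoing profile, cut off near `0`. -/
def outgoingCut (k ε s : ℝ) : ℂ := Real.smoothTransition (s / ε - 1) • outgoing k s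

/-- The derivative of `outgoingCut`. -/
def outgoingCut' (k ε s : ℝ) : ℂ :=
  (stepDeriv (s / ε - 1) / ε) • outgoing k s +
    Real.smoothTransition (s / ε - 1) • (Complex.I * k * outgoing k s)

/-- The profile of the Helmholtz operator applied to the cut off spherical wave. -/
def sourceProfile (k ε s : ℝ) : ℂ :=
  (deriv stepDeriv (s / ε - 1) / ε ^ 2) • outgoing k s +
    (2 * stepDeriv (s / ε - 1) / ε) • (Complex.I * k * outgoing k s)

theorem hasDerivAt_outgoingCut (k ε s : ℝ) :
    HasDerivAt (outgoingCut k ε) (outgoingCut' k ε s) s := by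
  have h1 : HasDerivAt (fun t : ℝ => t / ε - 1) (1 / ε) s :=
    ((hasDerivAt_id s).div_const ε).sub_const 1
  have h2 := (hasDerivAt_smoothTransition (s / ε - 1)).comp s h1
  refine (h2.smul (hasDerivAt_outgoing k s)).congr_deriv ?_
  rw [outgoingCut', add_comm]
  simp only [Function.comp, mul_one_div]

theorem hasDerivAt_outgoingCut' (k ε s : ℝ) :
    HasDerivAt (outgoingCut' k ε) (sourceProfile k ε s - (k : ℂ) ^ 2 * outgoingCut k ε s) s := by
  have h1 : HasDerivAt (fun t : ℝ => t / ε - 1) (1 / ε) s :=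
    ((hasDerivAt_id s).div_const ε).sub_const 1
  have h2 := (hasDerivAt_smoothTransition (s / ε - 1)).comp s h1
  have h3 := ((hasDerivAt_stepDeriv (s / ε - 1)).comp s h1).div_const ε
  have h4 := hasDerivAt_outgoing k s
  refine ((h3.smul h4).add (h2.smul (h4.const_mul (Complex.I * k)))).congr_deriv ?_
  simp only [sourceProfile, outgoingCut, Function.comp, Complex.real_smul]
  push_cast
  linear_combination (k : ℂ) ^ 2 * (Real.smoothTransition (s / ε - 1) : ℂ) * outgoing k s *
    Complex.I_sq

theorem outgoingCut_of_lt {k ε s : ℝ} (hε : 0 < ε) (hs : s < ε) : outgoingCut k ε s = 0 := by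
  have : s / ε - 1 ≤ 0 := by rw [sub_nonpos, div_le_one hε]; exact hs.le
  rw [outgoingCut, Real.smoothTransition.zero_of_nonpos this]
  simp

theorem outgoingCut_of_le {k ε s : ℝ} (hε : 0 < ε) (hs : 2 * ε ≤ s) :
    outgoingCut k ε s = outgoing k s := by
  have : 1 ≤ s / ε - 1 := by rw [le_sub_iff_add_le, le_div_iff₀ hε]; linarith
  rw [outgoingCut, Real.smoothTransition.one_of_one_le this]
  simp

theorem sourceProfile_of_lt {k ε s : ℝ} (hε : 0 < ε) (hs : s < ε) : sourceProfile k ε s = 0 := by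
  have : s / ε - 1 < 0 := by rw [sub_neg, div_lt_one hε]; exact hs
  rw [sourceProfile, stepDeriv_of_neg this, deriv_stepDeriv_of_neg this]
  simp

theorem sourceProfile_of_le {k ε s : ℝ} (hε : 0 < ε) (hs : 2 * ε ≤ s) :
    sourceProfile k ε s = 0 := by
  have : 1 ≤ s / ε - 1 := by rw [le_sub_iff_add_le, le_div_iff₀ hε]; linarith
  rw [sourceProfile, stepDeriv_of_one_le this, deriv_stepDeriv_of_one_le this]
  simp

theorem contDiff_outgoingCut (k ε : ℝ) : ContDiff ℝ 2 (outgoingCut k ε) := by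
  unfold outgoingCut
  exact (Real.smoothTransition.contDiff.comp (by fun_prop)).smul
    ((contDiff_outgoing k).of_le (by exact_mod_cast le_top))

theorem continuous_sourceProfile (k ε : ℝ) : Continuous (sourceProfile k ε) := by
  unfold sourceProfile
  have h1 : Continuous fun s : ℝ => s / ε - 1 := by fun_prop
  have h2 := continuous_deriv_stepDeriv.comp h1
  have h3 := continuous_stepDeriv.comp h1
  have h4 := (contDiff_outgoing k).continuous
  exact ((h2.div_const _).smul h4).add
    (((continuous_const.mul h3).div_const _).smul (continuous_const.mul h4))

/-- Two derivatives of a cutoff at scale ε cost ε⁻²; the first-order term costs only ε⁻¹, and ε ≤ 1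
absorbs it. -/
theorem exists_norm_sourceProfile_le (k : ℝ) :
    ∃ C : ℝ, 0 ≤ C ∧ ∀ ε, 0 < ε → ε ≤ 1 → ∀ s, ‖sourceProfile k ε s‖ ≤ C / ε ^ 2 := by
  obtain ⟨C, hC0, hC⟩ := exists_stepDeriv_bound
  refine ⟨C * (1 + 2 * |k|), by positivity, fun ε hε hε1 s => ?_⟩
  have hp : (4 * Real.pi)⁻¹ ≤ 1 := inv_le_one_of_one_le₀ (by linarith [Real.pi_gt_three])
  have h1 : ‖(deriv stepDeriv (s / ε - 1) / ε ^ 2) • outgoing k s‖ ≤ C / ε ^ 2 := by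
    rw [norm_smul, norm_outgoing, norm_div, Real.norm_of_nonneg (sq_nonneg ε)]
    calc _ ≤ C / ε ^ 2 * 1 := by gcongr; exact (hC _).2
      _ = _ := mul_one _
  have h2 : ‖(2 * stepDeriv (s / ε - 1) / ε) • (Complex.I * k * outgoing k s)‖ ≤
      C * (2 * |k|) / ε ^ 2 := by
    rw [norm_smul, norm_mul, norm_outgoing, norm_div, Real.norm_of_nonneg hε.le, norm_mul, norm_mul,
      Complex.norm_I, one_mul, Complex.norm_real, Real.norm_ofNat, Real.norm_eq_abs k]
    calc _ ≤ 2 * C / ε * (|k| * 1) := by gcongr; exact (hC _).1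
      _ ≤ 2 * C / ε ^ 2 * (|k| * 1) := by gcongr; nlinarith
      _ = _ := by ring
  refine (norm_add_le _ _).trans ((add_le_add h1 h2).trans (le_of_eq ?_))
  ring

/-- The source integral in polar coordinates. -/
theorem integral_sourceProfile {k ε : ℝ} (hε : 0 < ε) :
    ∫ s in (0 : ℝ)..(2 * ε), s • sourceProfile k ε s =
      (2 * ε) • (Complex.I * k * outgoing k (2 * ε)) - outgoing k (2 * ε) +
        ∫ s in (0 : ℝ)..(2 * ε), s • ((k : ℂ) ^ 2 * outgoingCut k ε s) := by
  have hc1 : Continuous fun s : ℝ => s • sourceProfile k ε s :=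
    continuous_id.smul (continuous_sourceProfile k ε)
  have hc2 : Continuous fun s : ℝ => s • ((k : ℂ) ^ 2 * outgoingCut k ε s) :=
    continuous_id.smul (continuous_const.mul (contDiff_outgoingCut k ε).continuous)
  -- With h the cut-off profile, s (source - k² h) = s h'' is the derivative of s h' - h. It
  -- vanishes at 0, and at 2ε the cutoff equals one.
  rw [← sub_eq_iff_eq_add, ← intervalIntegral.integral_sub (hc1.intervalIntegrable _ _)
    (hc2.intervalIntegrable _ _),
    intervalIntegral.integral_eq_sub_of_hasDerivAt
      (f := fun s => s • outgoingCut' k ε s - outgoingCut k ε s)]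
  · have h1 : outgoingCut' k ε (2 * ε) = Complex.I * k * outgoing k (2 * ε) := by
      have h : (1 : ℝ) ≤ 2 * ε / ε - 1 := by rw [le_sub_iff_add_le, le_div_iff₀ hε]; linarith
      rw [outgoingCut', stepDeriv_of_one_le h, Real.smoothTransition.one_of_one_le h]
      simp
    simp only [outgoingCut_of_lt hε hε, h1, outgoingCut_of_le hε le_rfl, zero_smul, sub_zero]
  · intro s _
    refine (((hasDerivAt_id s).smul (hasDerivAt_outgoingCut' k ε s)).sub
      (hasDerivAt_outgoingCut k ε s)).congr_deriv ?_
    simp only [Complex.real_smul, id]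
    push_cast
    ring
  · exact (hc1.sub hc2).intervalIntegrable _ _

/-- The boundary term tends to minus the outgoing profile at 0, that is -1/(4π), and the remaining
integral is O(ε²). Hence the total mass of the smeared source tends to -1. -/
theorem tendsto_integral_sourceProfile (k : ℝ) :
    Tendsto (fun ε : ℝ => (4 * Real.pi) • ∫ s in (0 : ℝ)..(2 * ε), s • sourceProfile k ε s)
      (𝓝[>] 0) (𝓝 (-1)) := by
  have h1 : Tendsto (fun ε : ℝ => (2 * ε) • (Complex.I * k * outgoing k (2 * ε)) -
      outgoing k (2 * ε)) (𝓝[>] 0) (𝓝 (-outgoing k 0)) := by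
    have hc := (contDiff_outgoing k).continuous
    have : Continuous fun ε : ℝ => (2 * ε) • (Complex.I * k * outgoing k (2 * ε)) -
        outgoing k (2 * ε) := by fun_prop
    simpa using (this.tendsto 0).mono_left nhdsWithin_le_nhds
  have h2 : Tendsto (fun ε : ℝ => ∫ s in (0 : ℝ)..(2 * ε), s • ((k : ℂ) ^ 2 * outgoingCut k ε s))
      (𝓝[>] 0) (𝓝 0) := by
    have h3 : Tendsto (fun ε : ℝ => 2 * ε * k ^ 2 * |2 * ε - 0|) (𝓝[>] 0) (𝓝 0) := by
      have : Continuous fun ε : ℝ => 2 * ε * k ^ 2 * |2 * ε - 0| := by fun_prop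
      simpa using (this.tendsto 0).mono_left nhdsWithin_le_nhds
    refine squeeze_zero_norm' ?_ h3
    filter_upwards [self_mem_nhdsWithin] with ε hε
    have hε' : (0 : ℝ) < ε := hε
    refine intervalIntegral.norm_integral_le_of_norm_le_const fun s hs => ?_
    rw [uIoc_of_le (by linarith)] at hs
    have hp : (4 * Real.pi)⁻¹ ≤ 1 := inv_le_one_of_one_le₀ (by linarith [Real.pi_gt_three])
    rw [norm_smul, norm_mul, outgoingCut, norm_smul, norm_outgoing, Real.norm_of_nonneg hs.1.le,
      norm_pow, Complex.norm_real, Real.norm_eq_abs, sq_abs,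
      Real.norm_of_nonneg (Real.smoothTransition.nonneg _)]
    calc _ ≤ 2 * ε * (k ^ 2 * (1 * 1)) := by
          have := Real.smoothTransition.nonneg (s / ε - 1)
          gcongr
          · exact hs.2
          · exact Real.smoothTransition.le_one _
      _ = _ := by ring
  have h4 := (h1.add h2).const_smul (4 * Real.pi)
  have h5 : (4 * Real.pi) • (-outgoing k 0 + 0) = (-1 : ℂ) := by
    have := Real.pi_ne_zero
    simp only [outgoing, Complex.real_smul]
    push_cast
    simp
    field_simp
  rw [h5] at h4
  refine h4.congr' ?_
  filter_upwards [self_mem_nhdsWithin] with ε hε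
  rw [integral_sourceProfile hε]

end

/-! ### The fundamental solution with its pole smoothed -/

section

open scoped ENNReal NNReal

/-- The outgoing fundamental solution of the Helmholtz operator with pole `r`. -/
def greenFn (k : ℝ) (r : E3) : E3 → ℂ := radialField (outgoing k) r

/-- The fundamental solution with its singularity cut off in the ball of radius `2 ε`. -/
def greenCut (k ε : ℝ) (r : E3) : E3 → ℂ := radialField (outgoingCut k ε) r

/-- The Helmholtz operator applied to `greenCut`, up to sign an approximate delta at `r`. -/
def greenSource (k ε : ℝ) (r : E3) : E3 → ℂ := radialField (sourceProfile k ε) r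

theorem contDiff_greenCut {k ε : ℝ} (hε : 0 < ε) (r : E3) : ContDiff ℝ 2 (greenCut k ε r) :=
  contDiff_radialField hε (contDiff_outgoingCut k ε) fun _ hs => outgoingCut_of_lt hε hs

theorem continuous_greenSource {k ε : ℝ} (hε : 0 < ε) (r : E3) :
    Continuous (greenSource k ε r) := by
  rw [← contDiff_zero (𝕜 := ℝ)]
  exact contDiff_radialField hε (contDiff_zero.2 (continuous_sourceProfile k ε))
    fun _ hs => sourceProfile_of_lt hε hs

theorem greenSource_of_le {k ε : ℝ} (hε : 0 < ε) {r y : E3} (hy : 2 * ε ≤ ‖y - r‖) :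
    greenSource k ε r y = 0 := by
  rw [greenSource, radialField, sourceProfile_of_le hε hy, smul_zero]

theorem divg_fderiv_greenCut {k ε : ℝ} (hε : 0 < ε) (r y : E3) :
    divg (fderiv ℝ (greenCut k ε r)) y + (k : ℂ) ^ 2 * greenCut k ε r y = greenSource k ε r y := by
  by_cases hy : y = r
  · have h1 : greenCut k ε r =ᶠ[𝓝 y] fun _ => 0 := by
      have h2 : ∀ᶠ z in 𝓝 y, ‖z - r‖ < ε := by
        have : Continuous fun z : E3 => ‖z - r‖ := by fun_prop
        exact this.continuousAt.eventually_lt continuousAt_const (by simpa [hy] using hε)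
      filter_upwards [h2] with z hz
      rw [greenCut, radialField, outgoingCut_of_lt hε hz, smul_zero]
    have h3 : fderiv ℝ (greenCut k ε r) =ᶠ[𝓝 y] fun _ => 0 := by
      refine h1.fderiv.trans (Eventually.of_forall fun z => ?_)
      exact fderiv_const_apply (0 : ℂ)
    rw [divg_congr h3, divg_zero, h1.self_of_nhds, greenSource, radialField, hy]
    simp
  · have hF : DifferentiableAt ℝ (fderiv ℝ (greenCut k ε r)) y :=
      (((contDiff_greenCut hε r).fderiv_right (m := 1) (by norm_num)).differentiable
        (by norm_num)) y
    rw [greenCut, divg_fderiv_radialField hy (hasDerivAt_outgoingCut k ε)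
      (hasDerivAt_outgoingCut' k ε _) hF, greenSource, radialField, radialField]
    simp only [Complex.real_smul]
    ring

theorem greenCut_eventuallyEq {k ε : ℝ} (hε : 0 < ε) {r y : E3} (hy : 2 * ε < ‖y - r‖) :
    greenCut k ε r =ᶠ[𝓝 y] greenFn k r := by
  have : Continuous fun z : E3 => ‖z - r‖ := by fun_prop
  filter_upwards [continuousAt_const.eventually_lt this.continuousAt hy] with z hz
  rw [greenCut, greenFn, radialField, radialField, outgoingCut_of_le hε hz.le]

theorem norm_greenSource_le {k : ℝ} :
    ∃ C : ℝ, 0 ≤ C ∧ ∀ ε, 0 < ε → ε ≤ 1 → ∀ r y, ‖greenSource k ε r y‖ ≤ C / ε ^ 3 := by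
  obtain ⟨C, hC0, hC⟩ := exists_norm_sourceProfile_le k
  refine ⟨C, hC0, fun ε hε hε1 r y => ?_⟩
  rcases lt_or_ge ‖y - r‖ ε with h | h
  · rw [greenSource, radialField, sourceProfile_of_lt hε h, smul_zero, norm_zero]
    positivity
  · rw [greenSource, radialField, norm_smul, norm_inv, norm_norm]
    calc ‖y - r‖⁻¹ * ‖sourceProfile k ε ‖y - r‖‖ ≤ ε⁻¹ * (C / ε ^ 2) :=
          mul_le_mul (inv_anti₀ hε h) (hC ε hε hε1 _) (norm_nonneg _) (by positivity)
      _ = C / ε ^ 3 := by field_simp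

theorem integral_greenSource {k ε : ℝ} (hε : 0 < ε) (r : E3) :
    ∫ y, greenSource k ε r y =
      (4 * Real.pi) • ∫ s in (0 : ℝ)..(2 * ε), s • sourceProfile k ε s := by
  have h1 : ∫ y, greenSource k ε r y = ∫ y : E3, (fun s : ℝ => s⁻¹ • sourceProfile k ε s) ‖y‖ :=
    integral_sub_right_eq_self (fun y : E3 => ‖y‖⁻¹ • sourceProfile k ε ‖y‖) r
  have h2 : Module.finrank ℝ E3 = 3 := by simp
  rw [h1, integral_fun_norm_addHaar (volume : Measure E3)
    (fun s : ℝ => s⁻¹ • sourceProfile k ε s), h2]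
  have h3 : ∫ y in Ioi (0 : ℝ), y ^ (3 - 1) • y⁻¹ • sourceProfile k ε y =
      ∫ s in (0 : ℝ)..(2 * ε), s • sourceProfile k ε s := by
    rw [intervalIntegral.integral_of_le (by linarith)]
    have h4 : ∀ s ∈ Ioi (0 : ℝ), s ^ (3 - 1) • s⁻¹ • sourceProfile k ε s =
        s • sourceProfile k ε s := by
      intro s hs
      have hs' : s ≠ 0 := ne_of_gt hs
      rw [smul_smul]
      congr 1
      field_simp
    rw [setIntegral_congr_fun measurableSet_Ioi h4]
    refine setIntegral_eq_of_subset_of_forall_sdiff_eq_zero measurableSet_Ioi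
      (fun s hs => hs.1) fun s hs => ?_
    have hs2 := hs.2
    simp only [mem_Ioc, not_and, not_le] at hs2
    rw [sourceProfile_of_le hε (hs2 hs.1).le, smul_zero]
  rw [h3]
  have h5 := sphereMeasure_real_univ
  rw [Measure.toSphere_real_apply_univ, h2] at h5
  rw [← h5, ← smul_assoc, nsmul_eq_mul]

/-- The source lives in a ball of volume O(ε³), is at most C/ε³ there, and has mass tending to -1,
so it acts as minus a delta at r. The bound on its size is needed because the source has no definite
sign. Only values of v near r matter. -/
theorem tendsto_integral_greenSource_mul (k : ℝ) {r : E3} {v : E3 → ℂ} {δ : ℝ} (hδ : 0 < δ)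
    (hv : ContinuousOn v (Metric.closedBall r δ)) :
    Tendsto (fun ε : ℝ => ∫ y, greenSource k ε r y * v y) (𝓝[>] 0) (𝓝 (-v r)) := by
  obtain ⟨C, hC0, hC⟩ := norm_greenSource_le (k := k)
  have h1 : Tendsto (fun ε : ℝ => ∫ y, greenSource k ε r y * v r) (𝓝[>] 0) (𝓝 (-v r)) := by
    have h2 := (tendsto_integral_sourceProfile k).mul_const (v r)
    rw [neg_one_mul] at h2
    refine h2.congr' ?_
    filter_upwards [self_mem_nhdsWithin] with ε hε
    rw [integral_mul_const, integral_greenSource hε]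
  have hsmall : ∀ᶠ ε : ℝ in 𝓝[>] 0, 0 < ε ∧ ε ≤ 1 ∧ 2 * ε ≤ δ := by
    have h2 : ∀ᶠ ε : ℝ in 𝓝[>] 0, ε ∈ Ioo 0 (min 1 (δ / 2)) :=
      Ioo_mem_nhdsGT (by positivity)
    filter_upwards [h2] with ε hε
    exact ⟨hε.1, hε.2.le.trans (min_le_left _ _), by
      have := hε.2.le.trans (min_le_right _ _)
      linarith⟩
  have hint : ∀ ε : ℝ, 0 < ε → 2 * ε ≤ δ → ∀ w : E3 → ℂ, ContinuousOn w (Metric.closedBall r δ) →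
      Integrable fun y => greenSource k ε r y * w y := by
    intro ε hε hεδ w hw
    have h3 : IntegrableOn (fun y => greenSource k ε r y * w y) (Metric.closedBall r δ) :=
      ((continuous_greenSource hε r).continuousOn.mul hw).integrableOn_compact
        (isCompact_closedBall r δ)
    rwa [integrableOn_iff_integrable_of_support_subset] at h3
    intro y hy
    by_contra h
    rw [Metric.mem_closedBall, dist_eq_norm, not_le] at h
    exact hy (by simp [greenSource_of_le hε (hεδ.trans h.le)])
  have h4 : Tendsto (fun ε : ℝ => ∫ y, greenSource k ε r y * (v y - v r)) (𝓝[>] 0) (𝓝 0) := by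
    rw [Metric.tendsto_nhds]
    intro η hη
    set K : ℝ := C * (8 * (4 / 3 * Real.pi)) with hK
    have hK0 : 0 ≤ K := by positivity
    have hvr : ContinuousAt v r := hv.continuousAt (Metric.closedBall_mem_nhds r hδ)
    obtain ⟨ρ, hρ, hρv⟩ := Metric.continuousAt_iff.1 hvr (η / (K + 1)) (by positivity)
    have hsm2 : ∀ᶠ ε : ℝ in 𝓝[>] 0, 2 * ε < ρ := by
      filter_upwards [Ioo_mem_nhdsGT (show (0 : ℝ) < ρ / 2 by positivity)] with ε hε
      linarith [hε.2]
    filter_upwards [hsmall, hsm2] with ε hε hερ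
    obtain ⟨hε0, hε1, -⟩ := hε
    rw [dist_zero_right]
    have h5 : ∫ y, greenSource k ε r y * (v y - v r) =
        ∫ y in Metric.ball r (2 * ε), greenSource k ε r y * (v y - v r) := by
      symm
      refine setIntegral_eq_integral_of_forall_compl_eq_zero fun y hy => ?_
      rw [Metric.mem_ball, dist_eq_norm, not_lt] at hy
      rw [greenSource_of_le hε0 hy, zero_mul]
    have hvol : volume.real (Metric.ball r (2 * ε)) = 8 * (4 / 3 * Real.pi) * ε ^ 3 := by
      rw [measureReal_def, EuclideanSpace.volume_ball_fin_three, ENNReal.toReal_mul,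
        ENNReal.toReal_ofReal (by positivity), ← ENNReal.ofReal_pow (by positivity),
        ENNReal.toReal_ofReal (by positivity)]
      ring
    rw [h5]
    have h6 : ‖∫ y in Metric.ball r (2 * ε), greenSource k ε r y * (v y - v r)‖ ≤
        C / ε ^ 3 * (η / (K + 1)) * volume.real (Metric.ball r (2 * ε)) := by
      refine norm_setIntegral_le_of_norm_le_const measure_ball_lt_top fun y hy => ?_
      rw [norm_mul]
      refine mul_le_mul (hC ε hε0 hε1 r y) ?_ (norm_nonneg _) (by positivity)
      rw [← dist_eq_norm]
      exact (hρv ((Metric.mem_ball.1 hy).trans hερ)).le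
    refine h6.trans_lt ?_
    rw [hvol]
    have h7 : C / ε ^ 3 * (η / (K + 1)) * (8 * (4 / 3 * Real.pi) * ε ^ 3) = η * (K / (K + 1)) := by
      rw [hK]; field_simp
    rw [h7]
    have h8 : K / (K + 1) < 1 := by rw [div_lt_one (by positivity)]; linarith
    nlinarith
  have h9 := h4.add h1
  rw [zero_add] at h9
  refine h9.congr' ?_
  filter_upwards [hsmall] with ε hε
  rw [← integral_add (hint ε hε.1 hε.2.2 (fun y => v y - v r) (hv.sub continuousOn_const))
    (hint ε hε.1 hε.2.2 (fun _ => v r) continuousOn_const)]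
  refine integral_congr_ae (Eventually.of_forall fun y => ?_)
  ring

end

/-! ### Energy conservation and the representation formula with a shell term -/

section

open scoped ENNReal NNReal

section Conj

variable {V W : Type*} [NormedAddCommGroup V] [NormedSpace ℝ V] [NormedAddCommGroup W]
  [NormedSpace ℝ W]

theorem divg_comp (L : V →L[ℝ] W) {F : E3 → E3 →L[ℝ] V} {x : E3} (hF : DifferentiableAt ℝ F x) :
    divg (fun y => L.comp (F y)) x = L (divg F x) := by
  have h1 : HasFDerivAt (fun y => L.comp (F y))
      (((ContinuousLinearMap.compL ℝ E3 V W) L).comp (fderiv ℝ F x)) x :=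
    HasFDerivAt.comp x ((ContinuousLinearMap.compL ℝ E3 V W) L).hasFDerivAt hF.hasFDerivAt
  simp only [divg, h1.fderiv, map_sum]
  rfl

theorem divg_fderiv_comp (L : V →L[ℝ] W) {f : E3 → V} {x : E3} (hf : ContDiffAt ℝ 2 f x) :
    divg (fderiv ℝ fun y => L (f y)) x = L (divg (fderiv ℝ f) x) := by
  have h1 : (fderiv ℝ fun y => L (f y)) =ᶠ[𝓝 x] fun y => L.comp (fderiv ℝ f y) := by
    filter_upwards [hf.eventually (by simp)] with y hy
    exact (L.hasFDerivAt.comp y (hy.differentiableAt (by norm_num)).hasFDerivAt).fderiv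
  rw [divg_congr h1]
  exact divg_comp L ((hf.fderiv_right (m := 1) (by norm_num)).differentiableAt (by norm_num))

end Conj

variable {Ω : Set E3}

theorem wronskian_congr_right {A : Type*} [NormedField A] [NormedAlgebra ℝ A] {f g g' : E3 → A}
    {x : E3} (h : g =ᶠ[𝓝 x] g') : wronskian Ω f g x = wronskian Ω f g' x := by
  rw [wronskian, wronskian, extDeriv, h.fderivWithin_eq_of_nhds, h.self_of_nhds]

theorem IsExteriorSmooth.conj {u : E3 → ℂ} (hu : IsExteriorSmooth Ω u) :
    IsExteriorSmooth Ω fun x => (starRingEnd ℂ) (u x) :=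
  ⟨Complex.conjCLE.contDiff.comp_contDiffOn hu.contDiffOn_exterior,
    Complex.conjCLE.contDiff.comp_contDiffOn hu.contDiffOn_closure⟩

theorem IsExteriorSmooth.extDeriv_conj {u : E3 → ℂ} (hu : IsExteriorSmooth Ω u)
    (hΩ : IsObstacle Ω) {x : E3} (hx : x ∈ closure Ωᶜ) (v : E3) :
    extDeriv Ω (fun y => (starRingEnd ℂ) (u y)) x v = (starRingEnd ℂ) (extDeriv Ω u x v) := by
  have h1 : HasFDerivWithinAt u (extDeriv Ω u x) (closure Ωᶜ) x :=
    ((hu.contDiffOn_closure.differentiableOn (by norm_num)) x hx).hasFDerivWithinAt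
  have h2 : HasFDerivWithinAt (fun y => Complex.conjCLE (u y))
      ((Complex.conjCLE : ℂ →L[ℝ] ℂ).comp (extDeriv Ω u x)) (closure Ωᶜ) x :=
    (Complex.conjCLE : ℂ →L[ℝ] ℂ).hasFDerivAt.comp_hasFDerivWithinAt x h1
  have h3 := h2.fderivWithin (uniqueDiffOn_closure_compl hΩ x hx)
  exact congrArg (fun L : E3 →L[ℝ] ℂ => L v) h3

/-- A solution of the Helmholtz equation in the exterior of `Ω`, `C¹` up to the boundary. -/
structure IsHelmholtzField (k : ℝ) (Ω : Set E3) (u : E3 → ℂ) : Prop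
    extends IsExteriorSmooth Ω u where
  helmholtz : ∀ x ∈ Ωᶜ, divg (fderiv ℝ u) x = -((k : ℂ) ^ 2 * u x)

namespace IsHelmholtzField

variable {k : ℝ} {u : E3 → ℂ}

/-- The energy flux density `Im (ū ∂u)` of a field. -/
def _root_.ImpedanceScattering.fluxDensity (Ω : Set E3) (u : E3 → ℂ) (x v : E3) : ℝ :=
  ((starRingEnd ℂ) (u x) * extDeriv Ω u x v).im

/-- A number minus its conjugate is 2i times its imaginary part. Since k is real, the conjugate of u
solves the same equation, so Green's identity for this pair expresses conservation of the energy
flux. -/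
theorem wronskian_conj (hu : IsHelmholtzField k Ω u) (hΩ : IsObstacle Ω) {x : E3}
    (hx : x ∈ closure Ωᶜ) (v : E3) :
    wronskian Ω (fun y => (starRingEnd ℂ) (u y)) u x v =
      (2 * Complex.I) * (fluxDensity Ω u x v : ℂ) := by
  rw [wronskian_apply, hu.extDeriv_conj hΩ hx, fluxDensity]
  apply Complex.ext
  · simp
  · simp
    ring

/-- Conservation of energy. -/
theorem integral_fluxDensity (hu : IsHelmholtzField k Ω u) (hΩ : IsObstacle Ω) {ν : Measure E3}
    (hν : IsSurfaceMeasure ℂ Ω ν) {R : ℝ} (hR : 0 < R) (hΩR : ∀ x ∈ Ω, ‖x‖ ≤ R) :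
    ∫ x, fluxDensity Ω u x (outwardNormal Ω x) ∂ν =
      ∫ x, stepDeriv (‖x‖ - R) • fluxDensity Ω u x (‖x‖⁻¹ • x) := by
  have hcl : IsClosed Ω := hΩ.isCompact.isClosed
  have h1 := hν.green hΩ hu.conj hu.toIsExteriorSmooth (s := fun _ => 0) continuousOn_const
    (fun x hx => by
      have h2 := divg_fderiv_comp (Complex.conjCLE : ℂ →L[ℝ] ℂ)
        (hu.contDiffOn_exterior.contDiffAt (hcl.isOpen_compl.mem_nhds hx))
      have h3 : divg (fderiv ℝ fun y => (starRingEnd ℂ) (u y)) x =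
          (starRingEnd ℂ) (divg (fderiv ℝ u) x) := h2
      rw [h3, hu.helmholtz x hx]
      simp
      ring) hR hΩR
  have h4 : ∫ x, wronskian Ω (fun y => (starRingEnd ℂ) (u y)) u x (outwardNormal Ω x) ∂ν =
      (2 * Complex.I) * ((∫ x, fluxDensity Ω u x (outwardNormal Ω x) ∂ν : ℝ) : ℂ) := by
    rw [← integral_complex_ofReal, ← integral_const_mul]
    refine integral_congr_ae ?_
    filter_upwards [ae_mem_frontier hν.le] with x hx
    exact hu.wronskian_conj hΩ (frontier_subset_closure_compl Ω hx) _
  have h5 : ∫ x, stepDeriv (‖x‖ - R) •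
        wronskian Ω (fun y => (starRingEnd ℂ) (u y)) u x (‖x‖⁻¹ • x) =
      (2 * Complex.I) *
        ((∫ x, stepDeriv (‖x‖ - R) • fluxDensity Ω u x (‖x‖⁻¹ • x) : ℝ) : ℂ) := by
    rw [← integral_complex_ofReal, ← integral_const_mul]
    refine integral_congr_ae (Eventually.of_forall fun x => ?_)
    simp only
    by_cases hx : x ∈ Ω
    · rw [stepDeriv_of_nonpos (by linarith [hΩR x hx])]
      simp
    · rw [hu.wronskian_conj hΩ (subset_closure hx)]
      simp only [Complex.real_smul, smul_eq_mul]
      push_cast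
      ring
  rw [h4, h5] at h1
  simp only [smul_zero, integral_zero, sub_zero] at h1
  have h6 := mul_left_cancel₀ (by simp : (2 * Complex.I) ≠ 0) h1
  exact_mod_cast h6

/-- The representation formula, with a term on a large shell. -/
theorem representation_shell (hu : IsHelmholtzField k Ω u) (hΩ : IsObstacle Ω) {ν : Measure E3}
    (hν : IsSurfaceMeasure ℂ Ω ν) {R : ℝ} (hR : 0 < R) (hΩR : ∀ x ∈ Ω, ‖x‖ ≤ R) {r : E3}
    (hr : r ∈ Ωᶜ) (hrR : ‖r‖ < R) :
    u r = (∫ x, wronskian Ω u (greenFn k r) x (outwardNormal Ω x) ∂ν) -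
      ∫ x, stepDeriv (‖x‖ - R) • wronskian Ω u (greenFn k r) x (‖x‖⁻¹ • x) := by
  have hcl : IsClosed Ω := hΩ.isCompact.isClosed
  have hnhds : Ωᶜ ∩ Metric.ball 0 R ∈ 𝓝 r :=
    inter_mem (hcl.isOpen_compl.mem_nhds hr) (Metric.isOpen_ball.mem_nhds (by simpa using hrR))
  obtain ⟨δ, hδ, hball⟩ := Metric.nhds_basis_closedBall.mem_iff.1 hnhds
  have hlim := tendsto_integral_greenSource_mul k (v := u) hδ
    (hu.contDiffOn_exterior.continuousOn.mono fun x hx => (hball hx).1)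
  -- The closed δ-ball around r avoids both Ω and the shell. For 2ε < δ the smoothed and the true
  -- fundamental solutions agree off this ball, so the right-hand side of Green's identity does not
  -- depend on ε, and the limit on the left is an equality.
  have hconst : ∀ᶠ ε : ℝ in 𝓝[>] 0, ∫ y, greenSource k ε r y * u y =
      (∫ x, stepDeriv (‖x‖ - R) • wronskian Ω u (greenFn k r) x (‖x‖⁻¹ • x)) -
        ∫ x, wronskian Ω u (greenFn k r) x (outwardNormal Ω x) ∂ν := by
    filter_upwards [Ioo_mem_nhdsGT (show (0 : ℝ) < δ / 2 by positivity)] with ε hε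
    have hε0 : 0 < ε := hε.1
    have hεδ : 2 * ε < δ := by linarith [hε.2]
    have hfar : ∀ x, x ∉ Metric.closedBall r δ → 2 * ε < ‖x - r‖ := fun x hx => by
      rw [Metric.mem_closedBall, dist_eq_norm, not_le] at hx
      exact hεδ.trans hx
    have hW : ∀ x, x ∉ Metric.closedBall r δ →
        wronskian Ω u (greenCut k ε r) x = wronskian Ω u (greenFn k r) x := fun x hx =>
      wronskian_congr_right (greenCut_eventuallyEq hε0 (hfar x hx))
    have h1 := hν.green hΩ hu.toIsExteriorSmooth
      (IsExteriorSmooth.of_contDiff (contDiff_greenCut (k := k) hε0 r))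
      (s := fun x => u x * greenSource k ε r x)
      (hu.contDiffOn_closure.continuousOn.mul (continuous_greenSource hε0 r).continuousOn)
      (fun x hx => by
        rw [hu.helmholtz x hx, ← divg_fderiv_greenCut hε0]
        ring) hR hΩR
    have h2 : ∫ x, wronskian Ω u (greenCut k ε r) x (outwardNormal Ω x) ∂ν =
        ∫ x, wronskian Ω u (greenFn k r) x (outwardNormal Ω x) ∂ν := by
      refine integral_congr_ae ?_
      filter_upwards [ae_mem_frontier hν.le] with x hx
      rw [hW x fun hx' => (hball hx').1 (hcl.frontier_subset hx)]
    have h3 : ∀ x, stepDeriv (‖x‖ - R) • wronskian Ω u (greenCut k ε r) x (‖x‖⁻¹ • x) =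
        stepDeriv (‖x‖ - R) • wronskian Ω u (greenFn k r) x (‖x‖⁻¹ • x) := by
      intro x
      by_cases hx : x ∈ Metric.closedBall r δ
      · have := mem_ball_zero_iff.1 (hball hx).2
        rw [stepDeriv_of_nonpos (by linarith)]
        simp
      · rw [hW x hx]
    have h4 : ∫ x in Ωᶜ, radialCutoff R x • (u x * greenSource k ε r x) =
        ∫ y, greenSource k ε r y * u y := by
      rw [setIntegral_eq_integral_of_forall_compl_eq_zero]
      · refine integral_congr_ae (Eventually.of_forall fun x => ?_)
        by_cases hx : x ∈ Metric.closedBall r δ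
        · simp only [radialCutoff_of_le (mem_ball_zero_iff.1 (hball hx).2).le, one_smul]
          ring
        · simp [greenSource_of_le hε0 (hfar x hx).le]
      · intro x hx
        have : x ∉ Metric.closedBall r δ := fun hx' => hx (hball hx').1
        simp [greenSource_of_le hε0 (hfar x this).le]
    simp only [h3] at h1
    rw [h2, h4] at h1
    rw [h1]
    ring
  have h5 := tendsto_nhds_unique (hlim.congr' hconst) tendsto_const_nhds
  rw [← neg_sub, ← h5, neg_neg]

end IsHelmholtzField

end

/-! ### The radiation condition on shells and the energy bound -/

section

open scoped ENNReal NNReal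

section Shell

variable {V : Type*} [NormedAddCommGroup V] [NormedSpace ℝ V]

theorem integral_stepDeriv_smul_mono {R : ℝ} {f g : E3 → ℝ} (hf : ContinuousOn f {x | R ≤ ‖x‖})
    (hg : ContinuousOn g {x | R ≤ ‖x‖}) (hfg : ∀ x, R ≤ ‖x‖ → f x ≤ g x) :
    ∫ x, stepDeriv (‖x‖ - R) • f x ≤ ∫ x, stepDeriv (‖x‖ - R) • g x := by
  refine integral_mono (integrable_stepDeriv_smul hf) (integrable_stepDeriv_smul hg) fun x => ?_
  rcases le_or_gt R ‖x‖ with h | h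
  · exact mul_le_mul_of_nonneg_left (hfg x h) (stepDeriv_nonneg _)
  · simp [stepDeriv_of_nonpos (show ‖x‖ - R ≤ 0 by linarith)]

theorem norm_integral_stepDeriv_smul_le_integral {R : ℝ} {f : E3 → V} {g : E3 → ℝ}
    (hg : ContinuousOn g {x | R ≤ ‖x‖}) (hfg : ∀ x, R ≤ ‖x‖ → ‖f x‖ ≤ g x) :
    ‖∫ x, stepDeriv (‖x‖ - R) • f x‖ ≤ ∫ x, stepDeriv (‖x‖ - R) • g x := by
  refine norm_integral_le_of_norm_le (integrable_stepDeriv_smul hg)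
    (Eventually.of_forall fun x => ?_)
  rw [norm_smul, Real.norm_of_nonneg (stepDeriv_nonneg _)]
  rcases le_or_gt R ‖x‖ with h | h
  · exact mul_le_mul_of_nonneg_left (hfg x h) (stepDeriv_nonneg _)
  · simp [stepDeriv_of_nonpos (show ‖x‖ - R ≤ 0 by linarith)]

theorem integral_stepDeriv_smul_linear {R : ℝ} {f g : E3 → ℝ} (hf : ContinuousOn f {x | R ≤ ‖x‖})
    (hg : ContinuousOn g {x | R ≤ ‖x‖}) (c d : ℝ) :
    ∫ x, stepDeriv (‖x‖ - R) • (c * f x + d * g x) =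
      c * (∫ x, stepDeriv (‖x‖ - R) • f x) + d * ∫ x, stepDeriv (‖x‖ - R) • g x := by
  rw [← integral_const_mul, ← integral_const_mul, ← integral_add
    ((integrable_stepDeriv_smul hf).const_mul _) ((integrable_stepDeriv_smul hg).const_mul _)]
  refine integral_congr_ae (Eventually.of_forall fun x => ?_)
  simp only [smul_eq_mul]
  ring

/-- On large shells, the product of a field with bounded energy and a field with vanishing energy
is negligible. -/
theorem tendsto_integral_stepDeriv_smul_of_norm_le_mul {R₀ K : ℝ} {g : E3 → V} {a b : E3 → ℝ}
    (ha : ContinuousOn a {x | R₀ ≤ ‖x‖}) (hb : ContinuousOn b {x | R₀ ≤ ‖x‖})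
    (hg : ∀ x, R₀ ≤ ‖x‖ → ‖g x‖ ≤ a x * b x)
    (hK : ∀ᶠ R : ℝ in atTop, ∫ x, stepDeriv (‖x‖ - R) • a x ^ 2 ≤ K)
    (h0 : Tendsto (fun R : ℝ => ∫ x, stepDeriv (‖x‖ - R) • b x ^ 2) atTop (𝓝 0)) :
    Tendsto (fun R : ℝ => ∫ x, stepDeriv (‖x‖ - R) • g x) atTop (𝓝 0) := by
  rw [Metric.tendsto_nhds]
  intro η hη
  set δ := η / (|K| + 1) with hδ
  have hδ0 : 0 < δ := by positivity
  filter_upwards [hK, h0.eventually_lt_const (show 0 < η * δ by positivity), eventually_ge_atTop R₀]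
    with R h1 h2 h3
  have hmono : ∀ x : E3, R ≤ ‖x‖ → R₀ ≤ ‖x‖ := fun x hx => h3.trans hx
  have ha' : ContinuousOn (fun x => a x ^ 2) {x | R ≤ ‖x‖} := (ha.mono hmono).pow 2
  have hb' : ContinuousOn (fun x => b x ^ 2) {x | R ≤ ‖x‖} := (hb.mono hmono).pow 2
  rw [dist_zero_right]
  -- Weighted arithmetic-geometric mean inequality: δ = η/(|K|+1) keeps the bounded factor below
  -- η/2, and the vanishing factor is eventually below η/2 for this fixed δ.
  have hle : ∀ x, R ≤ ‖x‖ → ‖g x‖ ≤ δ / 2 * a x ^ 2 + (2 * δ)⁻¹ * b x ^ 2 := by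
    intro x hx
    refine (hg x (hmono x hx)).trans ?_
    have h4 : δ / 2 * a x ^ 2 + (2 * δ)⁻¹ * b x ^ 2 - a x * b x =
        (2 * δ)⁻¹ * (δ * a x - b x) ^ 2 := by field_simp; ring
    have : 0 ≤ (2 * δ)⁻¹ * (δ * a x - b x) ^ 2 := by positivity
    linarith
  have hc : ContinuousOn (fun x => δ / 2 * a x ^ 2 + (2 * δ)⁻¹ * b x ^ 2) {x | R ≤ ‖x‖} :=
    (continuousOn_const.mul ha').add (continuousOn_const.mul hb')
  refine (norm_integral_stepDeriv_smul_le_integral hc hle).trans_lt ?_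
  rw [integral_stepDeriv_smul_linear ha' hb']
  have h7 : δ / 2 * (∫ x, stepDeriv (‖x‖ - R) • a x ^ 2) ≤ δ / 2 * |K| := by
    have := h1.trans (le_abs_self K)
    gcongr
  have h8 : (2 * δ)⁻¹ * (∫ x, stepDeriv (‖x‖ - R) • b x ^ 2) < (2 * δ)⁻¹ * (η * δ) := by
    gcongr
  have h9 : (2 * δ)⁻¹ * (η * δ) = η / 2 := by field_simp
  have h10 : δ / 2 * |K| ≤ η / 2 := by
    rw [hδ]
    have : |K| / (|K| + 1) ≤ 1 := by
      rw [div_le_one (by positivity)]; linarith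
    calc η / (|K| + 1) / 2 * |K| = η / 2 * (|K| / (|K| + 1)) := by ring
      _ ≤ η / 2 * 1 := by gcongr
      _ = η / 2 := mul_one _
  linarith

theorem integral_stepDeriv_smul_le_of_le {R C : ℝ} (hR : 0 < R) {g : E3 → ℝ}
    (hg : ContinuousOn g {x | R ≤ ‖x‖}) (hC : ∀ x, R ≤ ‖x‖ → |g x| ≤ C / ‖x‖ ^ 2) :
    ∫ x, stepDeriv (‖x‖ - R) • g x ≤ 4 * Real.pi * C :=
  (le_abs_self _).trans (norm_integral_stepDeriv_smul_le_of_norm_le hR hg hC)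

theorem continuousOn_const_div_norm_pow (C : ℝ) (n : ℕ) {R : ℝ} (hR : 0 < R) :
    ContinuousOn (fun x : E3 => C / ‖x‖ ^ n) {x | R ≤ ‖x‖} :=
  continuousOn_const.div (by fun_prop) fun x hx => pow_ne_zero n (hR.trans_le hx).ne'

theorem tendsto_integral_stepDeriv_const_div_norm_pow (C : ℝ) {n : ℕ} (hn : 3 ≤ n) :
    Tendsto (fun R : ℝ => ∫ x : E3, stepDeriv (‖x‖ - R) • (C / ‖x‖ ^ n)) atTop (𝓝 0) := by
  have h1 : Tendsto (fun R : ℝ => 4 * Real.pi * (|C| / R)) atTop (𝓝 0) := by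
    simpa using (tendsto_const_nhds.div_atTop tendsto_id).const_mul (4 * Real.pi)
  refine squeeze_zero_norm' ?_ h1
  filter_upwards [eventually_ge_atTop 1] with R hR
  refine norm_integral_stepDeriv_smul_le_of_norm_le (by linarith)
    (continuousOn_const_div_norm_pow C n (by linarith)) fun x hx => ?_
  have hx1 : 1 ≤ ‖x‖ := hR.trans hx
  rw [norm_div, norm_pow, norm_norm, Real.norm_eq_abs, div_div]
  have : R * ‖x‖ ^ 2 ≤ ‖x‖ ^ n :=
    calc R * ‖x‖ ^ 2 ≤ ‖x‖ * ‖x‖ ^ 2 := by gcongr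
      _ = ‖x‖ ^ 3 := by ring
      _ ≤ ‖x‖ ^ n := pow_le_pow_right₀ hx1 hn
  gcongr

end Shell

/-- A solution of the exterior Helmholtz equation that satisfies the radiation condition. -/
structure IsRadiatingField (k : ℝ) (Ω : Set E3) (u : E3 → ℂ) : Prop
    extends IsHelmholtzField k Ω u where
  radiating : IsRadiating k u

variable {Ω : Set E3} {k : ℝ} {u : E3 → ℂ}

/-- The radiation defect `∂u/∂|r| - i k u`. -/
def radiationDefect (k : ℝ) (Ω : Set E3) (u : E3 → ℂ) (x : E3) : ℂ :=
  extDeriv Ω u x (‖x‖⁻¹ • x) - Complex.I * k * u x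

theorem subset_compl_of_radius {R₁ R : ℝ} (hΩR : ∀ x ∈ Ω, ‖x‖ ≤ R₁) (hR : R₁ < R) :
    {x : E3 | R ≤ ‖x‖} ⊆ Ωᶜ := fun x hx hx' => by
  have := hΩR x hx'
  have : R ≤ ‖x‖ := hx
  linarith

theorem continuousOn_normalize {R : ℝ} (hR : 0 < R) :
    ContinuousOn (fun x : E3 => ‖x‖⁻¹ • x) {x | R ≤ ‖x‖} :=
  (continuous_norm.continuousOn.inv₀ fun _ hx => (hR.trans_le hx).ne').smul continuousOn_id

theorem norm_normalize {x : E3} (hx : 0 < ‖x‖) : ‖‖x‖⁻¹ • x‖ = 1 := by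
  rw [norm_smul, norm_inv, norm_norm, inv_mul_cancel₀ hx.ne']

theorem IsExteriorSmooth.continuousOn_radiationDefect (hu : IsExteriorSmooth Ω u)
    (hΩ : IsObstacle Ω) {R₁ R : ℝ} (hΩR : ∀ x ∈ Ω, ‖x‖ ≤ R₁) (hR₁ : 0 < R₁) (hR : R₁ < R) :
    ContinuousOn (radiationDefect k Ω u) {x | R ≤ ‖x‖} := by
  have hs : {x : E3 | R ≤ ‖x‖} ⊆ closure Ωᶜ := (subset_compl_of_radius hΩR hR).trans subset_closure
  exact (((hu.continuousOn_extDeriv hΩ).mono hs).clm_apply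
    (continuousOn_normalize (hR₁.trans hR))).sub
    (continuousOn_const.mul (hu.contDiffOn_closure.continuousOn.mono hs))

namespace IsRadiatingField

theorem tendsto_radiationDefect (hu : IsRadiatingField k Ω u) (hΩ : IsObstacle Ω) :
    Tendsto (fun R : ℝ => ∫ x, stepDeriv (‖x‖ - R) • ‖radiationDefect k Ω u x‖ ^ 2)
      atTop (𝓝 0) := by
  obtain ⟨R₁, hR₁, hΩR⟩ := hΩ.exists_radius
  have hcl : IsClosed Ω := hΩ.isCompact.isClosed
  refine tendsto_integral_stepDeriv_smul_zero (R₀ := R₁ + 1)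
    ((hu.continuousOn_radiationDefect hΩ hΩR hR₁ (by linarith)).norm.pow 2) ?_
  refine Tendsto.congr' ?_ hu.radiating
  filter_upwards [eventually_gt_atTop R₁] with r hr
  have hr0 : 0 < r := hR₁.trans hr
  rw [smul_eq_mul]
  congr 2
  ext θ
  have hn : ‖r • (θ : E3)‖ = r := by
    rw [norm_smul, norm_eq_of_mem_sphere, mul_one, Real.norm_of_nonneg hr0.le]
  have hmem : r • (θ : E3) ∈ Ωᶜ := fun h => by
    have := hΩR _ h
    rw [hn] at this
    linarith
  rw [radiationDefect, extDeriv_eq_fderiv hcl hmem, hn, smul_smul, inv_mul_cancel₀ hr0.ne',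
    one_smul]

theorem flux_identity (x : E3) :
    fluxDensity Ω u x (‖x‖⁻¹ • x) =
      k * ‖u x‖ ^ 2 + ((starRingEnd ℂ) (u x) * radiationDefect k Ω u x).im := by
  rw [fluxDensity, radiationDefect, ← Complex.normSq_eq_norm_sq, Complex.normSq_apply]
  simp
  ring

/-- Expand |d - iku|² = |d|² + k²|u|² - 2k Im(ū d), with d the radial derivative, and discard |d|².
-/
theorem sq_norm_le_defect_add_flux (x : E3) :
    k ^ 2 * ‖u x‖ ^ 2 ≤
      ‖radiationDefect k Ω u x‖ ^ 2 + 2 * k * fluxDensity Ω u x (‖x‖⁻¹ • x) := by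
  rw [fluxDensity, radiationDefect]
  generalize extDeriv Ω u x (‖x‖⁻¹ • x) = d
  simp only [← Complex.normSq_eq_norm_sq, Complex.normSq_apply]
  simp
  nlinarith [sq_nonneg d.re, sq_nonneg d.im]

theorem continuousOn_fluxDensity (hu : IsExteriorSmooth Ω u) (hΩ : IsObstacle Ω) {R₁ R : ℝ}
    (hΩR : ∀ x ∈ Ω, ‖x‖ ≤ R₁) (hR₁ : 0 < R₁) (hR : R₁ < R) :
    ContinuousOn (fun x => fluxDensity Ω u x (‖x‖⁻¹ • x)) {x | R ≤ ‖x‖} := by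
  have hs : {x : E3 | R ≤ ‖x‖} ⊆ closure Ωᶜ := (subset_compl_of_radius hΩR hR).trans subset_closure
  exact Complex.continuous_im.comp_continuousOn
    ((Complex.continuous_conj.comp_continuousOn
      (hu.contDiffOn_closure.continuousOn.mono hs)).mul
      (((hu.continuousOn_extDeriv hΩ).mono hs).clm_apply
        (continuousOn_normalize (hR₁.trans hR))))

/-- The flux through every large shell equals the flux through ∂Ω, which is a fixed number, and the
radiation defect tends to zero; the pointwise inequality `sq_norm_le_defect_add_flux` then bounds
|u|². No decay of u is assumed beforehand. -/
theorem exists_shell_energy_le (hu : IsRadiatingField k Ω u) (hk : 0 < k) (hΩ : IsObstacle Ω) :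
    ∃ K : ℝ, ∀ᶠ R : ℝ in atTop, ∫ x, stepDeriv (‖x‖ - R) • ‖u x‖ ^ 2 ≤ K := by
  obtain ⟨R₁, hR₁, hΩR⟩ := hΩ.exists_radius
  obtain ⟨ν, hν⟩ := exists_isSurfaceMeasure (V := ℂ) hΩ
  refine ⟨(1 + 2 * k * ∫ x, fluxDensity Ω u x (outwardNormal Ω x) ∂ν) / k ^ 2, ?_⟩
  filter_upwards [eventually_gt_atTop R₁,
    (hu.tendsto_radiationDefect hΩ).eventually_lt_const one_pos] with R hR hE
  have hs : {x : E3 | R ≤ ‖x‖} ⊆ closure Ωᶜ := (subset_compl_of_radius hΩR hR).trans subset_closure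
  have c1 : ContinuousOn (fun x => ‖u x‖ ^ 2) {x | R ≤ ‖x‖} :=
    (hu.contDiffOn_closure.continuousOn.mono hs).norm.pow 2
  have c2 : ContinuousOn (fun x => ‖radiationDefect k Ω u x‖ ^ 2) {x | R ≤ ‖x‖} :=
    (hu.continuousOn_radiationDefect (k := k) hΩ hΩR hR₁ hR).norm.pow 2
  have c3 := continuousOn_fluxDensity hu.toIsExteriorSmooth hΩ hΩR hR₁ hR
  have h0 : ContinuousOn (fun _ : E3 => (0 : ℝ)) {x | R ≤ ‖x‖} := continuousOn_const
  have c4 : ContinuousOn (fun x => k ^ 2 * ‖u x‖ ^ 2 + 0 * 0) {x | R ≤ ‖x‖} :=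
    (continuousOn_const.mul c1).add continuousOn_const
  have c5 : ContinuousOn (fun x => 1 * ‖radiationDefect k Ω u x‖ ^ 2 +
      2 * k * fluxDensity Ω u x (‖x‖⁻¹ • x)) {x | R ≤ ‖x‖} :=
    (continuousOn_const.mul c2).add (continuousOn_const.mul c3)
  have h1 := integral_stepDeriv_smul_mono c4 c5 fun x _ => by
    have := sq_norm_le_defect_add_flux (Ω := Ω) (k := k) (u := u) x
    linarith
  rw [integral_stepDeriv_smul_linear c1 h0, integral_stepDeriv_smul_linear c2 c3] at h1
  rw [le_div_iff₀ (by positivity), hu.integral_fluxDensity hΩ hν (hR₁.trans hR)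
    fun x hx => (hΩR x hx).trans hR.le]
  linarith

end IsRadiatingField

end

/-! ### The shell term vanishes: Green's representation -/

section

open scoped ENNReal NNReal

theorem contDiffAt_greenFn {k : ℝ} {r x : E3} (hx : x ≠ r) : ContDiffAt ℝ 2 (greenFn k r) x := by
  have hN : 0 < ‖x - r‖ := norm_pos_iff.2 (sub_ne_zero.2 hx)
  have hN3 : 0 < ‖x - r‖ / 3 := by positivity
  exact (contDiff_greenCut (k := k) hN3 r).contDiffAt.congr_of_eventuallyEq
    (greenCut_eventuallyEq (by positivity) (by linarith)).symm

theorem fderiv_greenFn_apply {k : ℝ} {r x : E3} (hx : x ≠ r) (v : E3) :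
    fderiv ℝ (greenFn k r) x v = inner ℝ (‖x - r‖⁻¹ • (x - r)) v •
      (Complex.I * k * greenFn k r x - ‖x - r‖⁻¹ • greenFn k r x) := by
  have hN : ‖x - r‖ ≠ 0 := norm_ne_zero_iff.2 (sub_ne_zero.2 hx)
  rw [greenFn, fderiv_radialField_apply hx (hasDerivAt_outgoing k _), radialField,
    real_inner_smul_left]
  simp only [Complex.real_smul]
  push_cast
  have hN' : (‖x - r‖ : ℂ) ≠ 0 := by exact_mod_cast hN
  field_simp

theorem norm_greenFn_le (k : ℝ) (r x : E3) : ‖greenFn k r x‖ ≤ ‖x - r‖⁻¹ := by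
  rw [greenFn, radialField, norm_smul, norm_outgoing, norm_inv, norm_norm]
  exact mul_le_of_le_one_right (by positivity)
    (inv_le_one_of_one_le₀ (by linarith [Real.pi_gt_three]))

variable {Ω : Set E3} {k : ℝ} {u : E3 → ℂ}

theorem wronskian_greenFn_apply (hΩ : IsObstacle Ω) {r x : E3} (hx : x ∈ closure Ωᶜ) (hxr : x ≠ r)
    (v : E3) : wronskian Ω u (greenFn k r) x v =
      u x * fderiv ℝ (greenFn k r) x v - greenFn k r x * extDeriv Ω u x v := by
  rw [wronskian_apply, extDeriv_eq_fderiv_of_differentiable (f := greenFn k r) hΩ hx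
    ((contDiffAt_greenFn hxr).differentiableAt (by norm_num))]

/-- The condition on x gives |x - r| ≥ |x|/2. Along x/|x| the derivative of the fundamental solution
G is cos α · (ik - 1/|x-r|) G, with α the angle to x - r. Both cos α - 1 and 1/|x-r| are O(1/|x|),
which beats the size O(1/|x|) of G by one order. -/
theorem norm_radial_defect_greenFn_le {r x : E3} (hx : 2 * ‖r‖ + 1 ≤ ‖x‖) :
    ‖fderiv ℝ (greenFn k r) x (‖x‖⁻¹ • x) - Complex.I * k * greenFn k r x‖ ≤
      4 * (2 * |k| * ‖r‖ + 1) / ‖x‖ ^ 2 := by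
  have hx0 : 0 < ‖x‖ := by linarith [norm_nonneg r]
  have hN : ‖x‖ / 2 ≤ ‖x - r‖ := by
    have := norm_sub_norm_le x r
    linarith
  have hN0 : 0 < ‖x - r‖ := by linarith
  have hxr : x ≠ r := fun h => by simp [h] at hN0
  rw [fderiv_greenFn_apply hxr]
  set e := ‖x - r‖⁻¹ • (x - r) with he
  have he1 : ‖e‖ = 1 := norm_normalize hN0
  have hc1 : |inner ℝ e (‖x‖⁻¹ • x)| ≤ 1 := by
    have := abs_real_inner_le_norm e (‖x‖⁻¹ • x)
    rwa [he1, norm_normalize hx0, one_mul] at this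
  have hc2 : |inner ℝ e (‖x‖⁻¹ • x) - 1| ≤ 2 * ‖r‖ / ‖x - r‖ := by
    have h1 : inner ℝ e (‖x‖⁻¹ • x) - 1 =
        ‖x - r‖⁻¹ * ((‖x‖ - ‖x - r‖) - inner ℝ r (‖x‖⁻¹ • x)) := by
      rw [he, real_inner_smul_left, inner_sub_left, real_inner_smul_right,
        real_inner_self_eq_norm_sq]
      field_simp
      ring
    have h2 : |inner ℝ r (‖x‖⁻¹ • x)| ≤ ‖r‖ := by
      have := abs_real_inner_le_norm r (‖x‖⁻¹ • x)
      rwa [norm_normalize hx0, mul_one] at this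
    have h3 : |‖x‖ - ‖x - r‖| ≤ ‖r‖ := by
      have := abs_norm_sub_norm_le x (x - r)
      rwa [sub_sub_cancel] at this
    rw [h1, abs_mul, abs_of_pos (inv_pos.2 hN0), div_eq_inv_mul]
    gcongr
    exact (abs_sub _ _).trans (by linarith)
  have h4 : inner ℝ e (‖x‖⁻¹ • x) •
        (Complex.I * k * greenFn k r x - ‖x - r‖⁻¹ • greenFn k r x) -
        Complex.I * k * greenFn k r x =
      (inner ℝ e (‖x‖⁻¹ • x) - 1 : ℝ) • (Complex.I * k * greenFn k r x) -
        (inner ℝ e (‖x‖⁻¹ • x) * ‖x - r‖⁻¹) • greenFn k r x := by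
    simp only [Complex.real_smul]
    push_cast
    ring
  have hG := norm_greenFn_le k r x
  rw [h4]
  refine (norm_sub_le _ _).trans ?_
  rw [norm_smul, norm_smul, norm_mul, norm_mul, Complex.norm_I, one_mul, Complex.norm_real,
    Real.norm_eq_abs, Real.norm_eq_abs, Real.norm_eq_abs, abs_mul, abs_of_pos (inv_pos.2 hN0)]
  calc _ ≤ 2 * ‖r‖ / ‖x - r‖ * (|k| * ‖x - r‖⁻¹) + 1 * ‖x - r‖⁻¹ * ‖x - r‖⁻¹ := by gcongr
    _ = (2 * |k| * ‖r‖ + 1) / ‖x - r‖ ^ 2 := by field_simp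
    _ ≤ (2 * |k| * ‖r‖ + 1) / (‖x‖ / 2) ^ 2 := by gcongr
    _ = _ := by field_simp; ring

/-- Subtracting iku·G from both terms turns the Wronskian into u times the defect of G minus G times
the defect of u. -/
theorem norm_wronskian_greenFn_le (hΩ : IsObstacle Ω) {r x : E3} (hx : x ∈ Ωᶜ)
    (hxr : 2 * ‖r‖ + 1 ≤ ‖x‖) :
    ‖wronskian Ω u (greenFn k r) x (‖x‖⁻¹ • x)‖ ≤
      1 * (‖u x‖ * (4 * (2 * |k| * ‖r‖ + 1) / ‖x‖ ^ 2)) +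
        1 * (2 / ‖x‖ ^ 1 * ‖radiationDefect k Ω u x‖) := by
  have hx0 : 0 < ‖x‖ := by linarith [norm_nonneg r]
  have hN : ‖x‖ / 2 ≤ ‖x - r‖ := by
    have := norm_sub_norm_le x r
    linarith
  have hne : x ≠ r := fun h => by
    rw [h, sub_self, norm_zero] at hN
    rw [h] at hx0
    linarith
  rw [wronskian_greenFn_apply hΩ (subset_closure hx) hne]
  have h1 : u x * fderiv ℝ (greenFn k r) x (‖x‖⁻¹ • x) -
        greenFn k r x * extDeriv Ω u x (‖x‖⁻¹ • x) =
      u x * (fderiv ℝ (greenFn k r) x (‖x‖⁻¹ • x) - Complex.I * k * greenFn k r x) -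
        greenFn k r x * radiationDefect k Ω u x := by
    rw [radiationDefect]
    ring
  rw [h1, one_mul, one_mul]
  refine (norm_sub_le _ _).trans ?_
  rw [norm_mul, norm_mul, pow_one]
  have h2 : ‖greenFn k r x‖ ≤ 2 / ‖x‖ := by
    refine (norm_greenFn_le k r x).trans ?_
    calc ‖x - r‖⁻¹ ≤ (‖x‖ / 2)⁻¹ := inv_anti₀ (by positivity) hN
      _ = 2 / ‖x‖ := by field_simp
  exact add_le_add (mul_le_mul_of_nonneg_left (norm_radial_defect_greenFn_le hxr) (norm_nonneg _))
    (mul_le_mul_of_nonneg_right h2 (norm_nonneg _))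

namespace IsRadiatingField

/-- Each of the two products pairs a factor with bounded shell energy and one with vanishing shell
energy: u against |x|⁻², and |x|⁻¹ against the radiation defect of u. -/
theorem tendsto_wronskian_greenFn (hu : IsRadiatingField k Ω u) (hk : 0 < k) (hΩ : IsObstacle Ω)
    (r : E3) : Tendsto (fun R : ℝ => ∫ x, stepDeriv (‖x‖ - R) •
      wronskian Ω u (greenFn k r) x (‖x‖⁻¹ • x)) atTop (𝓝 0) := by
  obtain ⟨R₁, hR₁, hΩR⟩ := hΩ.exists_radius
  obtain ⟨K, hK⟩ := hu.exists_shell_energy_le hk hΩ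
  have hE := hu.tendsto_radiationDefect hΩ
  set R₀ : ℝ := R₁ + 1 with hR₀
  have hs : {x : E3 | R₀ ≤ ‖x‖} ⊆ closure Ωᶜ :=
    (subset_compl_of_radius hΩR (by linarith)).trans subset_closure
  have c1 : ContinuousOn (fun x => ‖u x‖) {x | R₀ ≤ ‖x‖} :=
    (hu.contDiffOn_closure.continuousOn.mono hs).norm
  have c2 : ContinuousOn (fun x => ‖radiationDefect k Ω u x‖) {x | R₀ ≤ ‖x‖} :=
    (hu.continuousOn_radiationDefect (k := k) hΩ hΩR hR₁ (by linarith)).norm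
  set C : ℝ := 4 * (2 * |k| * ‖r‖ + 1) with hC
  have c3 := continuousOn_const_div_norm_pow C 2 (show 0 < R₀ by linarith)
  have c4 := continuousOn_const_div_norm_pow 2 1 (show 0 < R₀ by linarith)
  have t1 : Tendsto (fun R : ℝ => ∫ x, stepDeriv (‖x‖ - R) • (‖u x‖ * (C / ‖x‖ ^ 2)))
      atTop (𝓝 0) := by
    refine tendsto_integral_stepDeriv_smul_of_norm_le_mul c1 c3 (fun x _ => ?_) hK ?_
    · rw [Real.norm_of_nonneg (by positivity)]
    · simpa only [div_pow, ← pow_mul] using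
        tendsto_integral_stepDeriv_const_div_norm_pow (C ^ 2) (n := 4) (by norm_num)
  have t2 : Tendsto (fun R : ℝ => ∫ x, stepDeriv (‖x‖ - R) •
      (2 / ‖x‖ ^ 1 * ‖radiationDefect k Ω u x‖)) atTop (𝓝 0) := by
    refine tendsto_integral_stepDeriv_smul_of_norm_le_mul (K := 4 * Real.pi * 4) c4 c2
      (fun x _ => ?_) ?_ hE
    · rw [Real.norm_of_nonneg (by positivity)]
    · filter_upwards [eventually_ge_atTop R₀] with R hR
      refine integral_stepDeriv_smul_le_of_le (by linarith)
        ((c4.pow 2).mono fun x hx => hR.trans hx) fun x _ => ?_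
      rw [pow_one, div_pow, abs_of_nonneg (by positivity)]
      norm_num
  have t3 := (t1.const_mul 1).add (t2.const_mul 1)
  rw [mul_zero, add_zero] at t3
  refine squeeze_zero_norm' ?_ t3
  filter_upwards [eventually_ge_atTop (max R₀ (2 * ‖r‖ + 1))] with R hR
  have hR0 : R₀ ≤ R := (le_max_left _ _).trans hR
  have hsub : {x : E3 | R ≤ ‖x‖} ⊆ {x | R₀ ≤ ‖x‖} := fun x hx => hR0.trans hx
  have c5 : ContinuousOn (fun x => ‖u x‖ * (C / ‖x‖ ^ 2)) {x | R ≤ ‖x‖} :=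
    (c1.mul c3).mono hsub
  have c6 : ContinuousOn (fun x => 2 / ‖x‖ ^ 1 * ‖radiationDefect k Ω u x‖) {x | R ≤ ‖x‖} :=
    (c4.mul c2).mono hsub
  rw [← integral_stepDeriv_smul_linear c5 c6]
  refine norm_integral_stepDeriv_smul_le_integral
    ((continuousOn_const.mul c5).add (continuousOn_const.mul c6)) fun x hx => ?_
  exact norm_wronskian_greenFn_le hΩ (subset_compl_of_radius hΩR (by linarith) (hsub hx))
    (((le_max_right _ _).trans hR).trans hx)

/-- Green's representation of a radiating field. -/
theorem representation (hu : IsRadiatingField k Ω u) (hk : 0 < k) (hΩ : IsObstacle Ω)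
    {ν : Measure E3} (hν : IsSurfaceMeasure ℂ Ω ν) {r : E3} (hr : r ∈ Ωᶜ) :
    u r = ∫ x, wronskian Ω u (greenFn k r) x (outwardNormal Ω x) ∂ν := by
  obtain ⟨R₁, hR₁, hΩR⟩ := hΩ.exists_radius
  have h1 := (tendsto_const_nhds (x := ∫ x, wronskian Ω u (greenFn k r) x (outwardNormal Ω x) ∂ν)
    (f := (atTop : Filter ℝ))).sub (hu.tendsto_wronskian_greenFn hk hΩ r)
  rw [sub_zero] at h1
  refine tendsto_nhds_unique (tendsto_const_nhds.congr' ?_) h1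
  filter_upwards [eventually_gt_atTop (max R₁ ‖r‖)] with R hR
  have hR1 : R₁ < R := (le_max_left _ _).trans_lt hR
  exact hu.representation_shell hΩ hν (hR₁.trans hR1) (fun x hx => (hΩR x hx).trans hR1.le) hr
    ((le_max_right _ _).trans_lt hR)

end IsRadiatingField

end

/-! ### The fundamental solution with distant pole -/

section

open scoped ENNReal NNReal

section Geometry

variable {a : ℝ} {r y : E3}

theorem half_norm_le_norm_sub (hy : ‖y‖ ≤ a) (hr : 2 * a ≤ ‖r‖) : ‖r‖ / 2 ≤ ‖y - r‖ := by
  have := norm_sub_norm_le r y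
  rw [norm_sub_rev] at this
  linarith

theorem abs_norm_sub_sub_norm_le (hy : ‖y‖ ≤ a) : |‖y - r‖ - ‖r‖| ≤ a := by
  have := abs_norm_sub_norm_le (y - r) (-r)
  rw [norm_neg, sub_neg_eq_add, sub_add_cancel] at this
  exact this.trans hy

/-- The distance from a far point, to first order. -/
theorem abs_norm_sub_sub_expansion_le (hy : ‖y‖ ≤ a) (hr0 : 0 < ‖r‖) :
    |‖y - r‖ - (‖r‖ - inner ℝ (‖r‖⁻¹ • r) y)| ≤ 2 * a ^ 2 / ‖r‖ := by
  have ha : 0 ≤ a := (norm_nonneg y).trans hy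
  have hsum : 0 < ‖y - r‖ + ‖r‖ := by positivity
  have hsq : ‖y - r‖ ^ 2 = ‖y‖ ^ 2 - 2 * inner ℝ r y + ‖r‖ ^ 2 := by
    rw [norm_sub_sq_real, real_inner_comm]
  have h1 : ‖y - r‖ - (‖r‖ - inner ℝ (‖r‖⁻¹ • r) y) =
      (‖y‖ ^ 2 * ‖r‖ + inner ℝ r y * (‖y - r‖ - ‖r‖)) / ((‖y - r‖ + ‖r‖) * ‖r‖) := by
    rw [real_inner_smul_left, eq_div_iff (by positivity)]
    field_simp
    linear_combination ‖r‖ * hsq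
  have h2 : |inner ℝ r y| ≤ ‖r‖ * a :=
    (abs_real_inner_le_norm r y).trans (mul_le_mul_of_nonneg_left hy hr0.le)
  have h3 := abs_norm_sub_sub_norm_le (r := r) hy
  rw [h1, abs_div, abs_of_pos (show 0 < (‖y - r‖ + ‖r‖) * ‖r‖ by positivity)]
  calc |‖y‖ ^ 2 * ‖r‖ + inner ℝ r y * (‖y - r‖ - ‖r‖)| / ((‖y - r‖ + ‖r‖) * ‖r‖)
      ≤ (a ^ 2 * ‖r‖ + ‖r‖ * a * a) / (‖r‖ * ‖r‖) := by
        gcongr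
        · refine (abs_add_le _ _).trans (add_le_add ?_ ?_)
          · rw [abs_of_nonneg (by positivity)]
            gcongr
          · rw [abs_mul]
            gcongr
        · linarith [norm_nonneg (y - r)]
    _ = 2 * a ^ 2 / ‖r‖ := by field_simp; ring

theorem norm_normalize_sub_add_le (hy : ‖y‖ ≤ a) (hr0 : 0 < ‖r‖) (hr : 2 * a ≤ ‖r‖) :
    ‖‖y - r‖⁻¹ • (y - r) + ‖r‖⁻¹ • r‖ ≤ 4 * a / ‖r‖ := by
  have ha : 0 ≤ a := (norm_nonneg y).trans hy
  have hN := half_norm_le_norm_sub hy hr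
  have hN0 : 0 < ‖y - r‖ := by linarith
  have h1 : ‖y - r‖⁻¹ • (y - r) + ‖r‖⁻¹ • r =
      ‖y - r‖⁻¹ • y + ((‖y - r‖ - ‖r‖) / (‖y - r‖ * ‖r‖)) • r := by
    have : (‖y - r‖ - ‖r‖) / (‖y - r‖ * ‖r‖) = ‖r‖⁻¹ - ‖y - r‖⁻¹ := by field_simp
    rw [this]
    module
  rw [h1]
  refine (norm_add_le _ _).trans ?_
  rw [norm_smul, norm_smul, norm_inv, norm_norm, Real.norm_eq_abs, abs_div,
    abs_of_pos (show 0 < ‖y - r‖ * ‖r‖ by positivity)]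
  calc ‖y - r‖⁻¹ * ‖y‖ + |‖y - r‖ - ‖r‖| / (‖y - r‖ * ‖r‖) * ‖r‖
      ≤ ‖y - r‖⁻¹ * a + a / (‖y - r‖ * ‖r‖) * ‖r‖ := by
        have := abs_norm_sub_sub_norm_le (r := r) hy
        gcongr
    _ = 2 * a / ‖y - r‖ := by field_simp; ring
    _ ≤ 2 * a / (‖r‖ / 2) := by gcongr
    _ = 4 * a / ‖r‖ := by field_simp; ring

end Geometry

theorem norm_outgoing_sub_le (k s t : ℝ) : ‖outgoing k s - outgoing k t‖ ≤ |k| * |s - t| := by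
  have h := Convex.norm_image_sub_le_of_norm_hasDerivWithin_le (f := outgoing k)
    (f' := fun s => Complex.I * k * outgoing k s) (s := univ) (C := |k|) (x := t) (y := s)
    (fun x _ => (hasDerivAt_outgoing k x).hasDerivWithinAt) (fun x _ => ?_) convex_univ
    (mem_univ _) (mem_univ _)
  · rwa [Real.norm_eq_abs] at h
  · rw [norm_mul, norm_mul, Complex.norm_I, one_mul, Complex.norm_real, Real.norm_eq_abs,
      norm_outgoing]
    exact mul_le_of_le_one_right (abs_nonneg k)
      (inv_le_one_of_one_le₀ (by linarith [Real.pi_gt_three]))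

/-- The plane wave `exp (-i k θ·y) / 4π`. -/
def farWave (k : ℝ) (θ y : E3) : ℂ := outgoing k (-inner ℝ θ y)

theorem norm_farWave (k : ℝ) (θ y : E3) : ‖farWave k θ y‖ = (4 * Real.pi)⁻¹ := norm_outgoing _ _

theorem contDiff_farWave (k : ℝ) (θ : E3) : ContDiff ℝ 2 (farWave k θ) := by
  have h : ContDiff ℝ 2 fun y : E3 => -inner ℝ θ y := (contDiff_const.inner ℝ contDiff_id).neg
  have h2 : ContDiff ℝ 2 (outgoing k) := by exact_mod_cast contDiff_infty.1 (contDiff_outgoing k) 2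
  exact h2.comp h

theorem fderiv_farWave_apply (k : ℝ) (θ y v : E3) :
    fderiv ℝ (farWave k θ) y v = -inner ℝ θ v • (Complex.I * k * farWave k θ y) := by
  have h1 : HasFDerivAt (fun y : E3 => -inner ℝ θ y) (-innerSL ℝ θ) y :=
    (innerSL ℝ θ).hasFDerivAt.neg
  have h2 : HasFDerivAt (farWave k θ) _ y :=
    HasFDerivAt.comp y (hasDerivAt_outgoing k (-inner ℝ θ y)).hasFDerivAt h1
  rw [h2.fderiv]
  rfl

/-- The phase `exp (i k s)`, as a multiple of the outgoing profile. -/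
theorem outgoing_add (k s t : ℝ) :
    outgoing k (s + t) = Complex.exp (Complex.I * k * s) * outgoing k t := by
  simp only [outgoing, Complex.real_smul]
  rw [Complex.ofReal_add, mul_add, Complex.exp_add]
  ring

/-- The outgoing spherical wave `exp (i k |r|) / |r|`. -/
def sphericalWave (k : ℝ) (r : E3) : ℂ := Complex.exp (Complex.I * k * ‖r‖) / ‖r‖

theorem norm_exp_I_mul (k s : ℝ) : ‖Complex.exp (Complex.I * k * s)‖ = 1 := by
  have h : Complex.I * k * s = ((k * s : ℝ) : ℂ) * Complex.I := by push_cast; ring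
  rw [h, Complex.norm_exp_ofReal_mul_I]

theorem norm_sphericalWave (k : ℝ) (r : E3) : ‖sphericalWave k r‖ = ‖r‖⁻¹ := by
  rw [sphericalWave, norm_div, norm_exp_I_mul, Complex.norm_real, norm_norm, one_div]

/-- Two replacements, each costing O(|r|⁻²): the amplitude 1/|y-r| by 1/|r|, and the phase |y-r| by
its first-order expansion, whose error O(1/|r|) is multiplied by 1/|r|. -/
theorem norm_greenFn_sub_le (k : ℝ) {a : ℝ} {r y : E3} (hy : ‖y‖ ≤ a) (hr0 : 0 < ‖r‖)
    (hr : 2 * a ≤ ‖r‖) :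
    ‖greenFn k r y - sphericalWave k r * farWave k (‖r‖⁻¹ • r) y‖ ≤
      (2 * a + 2 * |k| * a ^ 2) / ‖r‖ ^ 2 := by
  have ha : 0 ≤ a := (norm_nonneg y).trans hy
  have hN := half_norm_le_norm_sub hy hr
  have hN0 : 0 < ‖y - r‖ := by linarith
  set s := ‖r‖ - inner ℝ (‖r‖⁻¹ • r) y with hs
  have h1 : sphericalWave k r * farWave k (‖r‖⁻¹ • r) y = ‖r‖⁻¹ • outgoing k s := by
    rw [hs, sub_eq_add_neg, outgoing_add, farWave, sphericalWave, Complex.real_smul]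
    push_cast
    ring
  have h2 : greenFn k r y - ‖r‖⁻¹ • outgoing k s =
      (‖y - r‖⁻¹ - ‖r‖⁻¹) • outgoing k ‖y - r‖ +
        ‖r‖⁻¹ • (outgoing k ‖y - r‖ - outgoing k s) := by
    rw [greenFn, radialField]
    simp only [Complex.real_smul]
    push_cast
    ring
  have h3 : |‖y - r‖⁻¹ - ‖r‖⁻¹| ≤ 2 * a / ‖r‖ ^ 2 := by
    have e : ‖y - r‖⁻¹ - ‖r‖⁻¹ = -(‖y - r‖ - ‖r‖) / (‖y - r‖ * ‖r‖) := by field_simp; ring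
    rw [e, abs_div, abs_neg, abs_of_pos (show 0 < ‖y - r‖ * ‖r‖ by positivity)]
    have := abs_norm_sub_sub_norm_le (r := r) hy
    calc |‖y - r‖ - ‖r‖| / (‖y - r‖ * ‖r‖) ≤ a / (‖r‖ / 2 * ‖r‖) := by gcongr
      _ = 2 * a / ‖r‖ ^ 2 := by field_simp
  have hp : (4 * Real.pi)⁻¹ ≤ 1 := inv_le_one_of_one_le₀ (by linarith [Real.pi_gt_three])
  rw [h1, h2]
  refine (norm_add_le _ _).trans ?_
  rw [norm_smul, norm_smul, norm_outgoing, norm_inv, norm_norm, Real.norm_eq_abs]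
  calc |‖y - r‖⁻¹ - ‖r‖⁻¹| * (4 * Real.pi)⁻¹ +
        ‖r‖⁻¹ * ‖outgoing k ‖y - r‖ - outgoing k s‖
      ≤ 2 * a / ‖r‖ ^ 2 * 1 + ‖r‖⁻¹ * (|k| * (2 * a ^ 2 / ‖r‖)) := by
        gcongr
        exact (norm_outgoing_sub_le k _ _).trans
          (mul_le_mul_of_nonneg_left (abs_norm_sub_sub_expansion_le hy hr0) (abs_nonneg k))
    _ = _ := by field_simp

/-- The constant in the far field expansion of the fundamental solution. -/
def farConst (k a : ℝ) : ℝ := |k| * (8 * a) + (1 + |k|) * (2 * a + 2 * |k| * a ^ 2) + 4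

/-- The unit vector from r to y is -r/|r| up to O(1/|r|), and the term with 1/|y-r| in the gradient
is already O(|r|⁻²); the rest is the estimate for the function itself. -/
theorem norm_fderiv_greenFn_sub_le (k : ℝ) {a : ℝ} {r y : E3} (hy : ‖y‖ ≤ a) (hr0 : 0 < ‖r‖)
    (hr : 2 * a ≤ ‖r‖) {v : E3} (hv : ‖v‖ = 1) :
    ‖fderiv ℝ (greenFn k r) y v - sphericalWave k r * fderiv ℝ (farWave k (‖r‖⁻¹ • r)) y v‖ ≤
      farConst k a / ‖r‖ ^ 2 := by
  have ha : 0 ≤ a := (norm_nonneg y).trans hy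
  have hN := half_norm_le_norm_sub hy hr
  have hN0 : 0 < ‖y - r‖ := by linarith
  have hne : y ≠ r := fun h => by rw [h, sub_self, norm_zero] at hN0; exact lt_irrefl _ hN0
  have hG : ‖greenFn k r y‖ ≤ 2 / ‖r‖ := (norm_greenFn_le k r y).trans (by
    calc ‖y - r‖⁻¹ ≤ (‖r‖ / 2)⁻¹ := inv_anti₀ (by positivity) hN
      _ = 2 / ‖r‖ := by field_simp)
  have hNi : ‖y - r‖⁻¹ ≤ 2 / ‖r‖ := by
    calc ‖y - r‖⁻¹ ≤ (‖r‖ / 2)⁻¹ := inv_anti₀ (by positivity) hN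
      _ = 2 / ‖r‖ := by field_simp
  rw [fderiv_greenFn_apply hne, fderiv_farWave_apply]
  set e := ‖y - r‖⁻¹ • (y - r) with he
  set θ := ‖r‖⁻¹ • r with hθ
  have h1 : inner ℝ e v • (Complex.I * k * greenFn k r y - ‖y - r‖⁻¹ • greenFn k r y) -
      sphericalWave k r * (-inner ℝ θ v • (Complex.I * k * farWave k θ y)) =
      inner ℝ (e + θ) v • (Complex.I * k * greenFn k r y) -
        inner ℝ θ v • (Complex.I * k * (greenFn k r y - sphericalWave k r * farWave k θ y)) -
        (inner ℝ e v * ‖y - r‖⁻¹) • greenFn k r y := by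
    rw [inner_add_left]
    simp only [Complex.real_smul]
    push_cast
    ring
  have b1 : |inner ℝ (e + θ) v| ≤ 4 * a / ‖r‖ := by
    have := abs_real_inner_le_norm (e + θ) v
    rw [hv, mul_one] at this
    exact this.trans (norm_normalize_sub_add_le hy hr0 hr)
  have b2 : |inner ℝ θ v| ≤ 1 := by
    have := abs_real_inner_le_norm θ v
    rwa [hv, hθ, norm_normalize hr0, mul_one] at this
  have b3 : |inner ℝ e v| ≤ 1 := by
    have := abs_real_inner_le_norm e v
    rwa [hv, he, norm_normalize hN0, mul_one] at this
  have b4 := norm_greenFn_sub_le k hy hr0 hr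
  rw [← hθ] at b4
  rw [h1]
  refine (norm_sub_le _ _).trans ((add_le_add (norm_sub_le _ _) le_rfl).trans ?_)
  have hI : ‖Complex.I * (k : ℂ)‖ = |k| := by
    rw [norm_mul, Complex.norm_I, one_mul, Complex.norm_real, Real.norm_eq_abs]
  rw [norm_smul, norm_smul, norm_smul, norm_mul (Complex.I * (k : ℂ)),
    norm_mul (Complex.I * (k : ℂ)), hI, Real.norm_eq_abs, Real.norm_eq_abs, Real.norm_eq_abs,
    abs_mul, abs_of_pos (inv_pos.2 hN0)]
  calc _ ≤ 4 * a / ‖r‖ * (|k| * (2 / ‖r‖)) +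
        1 * (|k| * ((2 * a + 2 * |k| * a ^ 2) / ‖r‖ ^ 2)) + 1 * (2 / ‖r‖) * (2 / ‖r‖) := by
        gcongr
    _ = (|k| * (8 * a) + |k| * (2 * a + 2 * |k| * a ^ 2) + 4) / ‖r‖ ^ 2 := by field_simp; ring
    _ ≤ farConst k a / ‖r‖ ^ 2 := by
        have : 0 ≤ 2 * a + 2 * |k| * a ^ 2 := by positivity
        rw [farConst]
        gcongr
        linarith

theorem norm_greenFn_sub_le' (k : ℝ) {a : ℝ} {r y : E3} (hy : ‖y‖ ≤ a) (hr0 : 0 < ‖r‖)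
    (hr : 2 * a ≤ ‖r‖) :
    ‖greenFn k r y - sphericalWave k r * farWave k (‖r‖⁻¹ • r) y‖ ≤ farConst k a / ‖r‖ ^ 2 := by
  have ha : 0 ≤ a := (norm_nonneg y).trans hy
  refine (norm_greenFn_sub_le k hy hr0 hr).trans ?_
  refine div_le_div_of_nonneg_right ?_ (by positivity)
  rw [farConst]
  have h1 : 0 ≤ |k| * (8 * a) := by positivity
  have h2 : 0 ≤ |k| * (2 * a + 2 * |k| * a ^ 2) := by positivity
  linarith

end

/-! ### The amplitude as a boundary integral and the far field asymptotics -/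

section

open scoped ENNReal NNReal

variable {Ω : Set E3} {k : ℝ} {u : E3 → ℂ} {ν : Measure E3}

namespace IsExteriorSmooth

theorem continuousOn_wronskian_normal {f g : E3 → ℂ} (hf : IsExteriorSmooth Ω f)
    (hg : IsExteriorSmooth Ω g) (hΩ : IsObstacle Ω) :
    ContinuousOn (fun x => wronskian Ω f g x (outwardNormal Ω x)) (frontier Ω) :=
  ((hf.continuousOn_wronskian hg hΩ).mono (frontier_subset_closure_compl Ω)).clm_apply
    (continuousOn_outwardNormal hΩ)

theorem continuousOn_normalDeriv {f : E3 → ℂ} (hf : IsExteriorSmooth Ω f) (hΩ : IsObstacle Ω) :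
    ContinuousOn (normalDeriv Ω f) (frontier Ω) :=
  ((hf.continuousOn_extDeriv hΩ).mono (frontier_subset_closure_compl Ω)).clm_apply
    (continuousOn_outwardNormal hΩ)

theorem continuousOn_frontier {f : E3 → ℂ} (hf : IsExteriorSmooth Ω f) :
    ContinuousOn f (frontier Ω) :=
  hf.contDiffOn_closure.continuousOn.mono (frontier_subset_closure_compl Ω)

theorem integrable_wronskian_normal {f g : E3 → ℂ} (hf : IsExteriorSmooth Ω f)
    (hg : IsExteriorSmooth Ω g) (hΩ : IsObstacle Ω) (hν : IsSurfaceMeasure ℂ Ω ν) :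
    Integrable (fun x => wronskian Ω f g x (outwardNormal Ω x)) ν := by
  have := hν.isFiniteMeasure hΩ
  exact integrable_of_continuousOn_frontier hΩ hν.le (hf.continuousOn_wronskian_normal hg hΩ)

/-- For r outside Ω the pole is at positive distance from the boundary, where the fundamental
solution may be replaced by its C² smoothed version. -/
theorem integrable_wronskian_greenFn (hu : IsExteriorSmooth Ω u) (hΩ : IsObstacle Ω)
    (hν : IsSurfaceMeasure ℂ Ω ν) {r : E3} (hr : r ∈ Ωᶜ) :
    Integrable (fun x => wronskian Ω u (greenFn k r) x (outwardNormal Ω x)) ν := by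
  have hcl : IsClosed Ω := hΩ.isCompact.isClosed
  obtain ⟨δ, hδ, hball⟩ := Metric.nhds_basis_closedBall.mem_iff.1 (hcl.isOpen_compl.mem_nhds hr)
  have hδ3 : 0 < δ / 3 := by positivity
  refine (hu.integrable_wronskian_normal
    (IsExteriorSmooth.of_contDiff (contDiff_greenCut (k := k) hδ3 r)) hΩ hν).congr ?_
  filter_upwards [ae_mem_frontier hν.le] with x hx
  have hx' : x ∉ Metric.closedBall r δ := fun h => hball h (hcl.frontier_subset hx)
  rw [Metric.mem_closedBall, dist_eq_norm, not_le] at hx'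
  rw [wronskian_congr_right (greenCut_eventuallyEq hδ3 (by linarith))]

end IsExteriorSmooth

/-- The far field of `u`, as an integral over the boundary of the obstacle. -/
def farField (ν : Measure E3) (Ω : Set E3) (k : ℝ) (u : E3 → ℂ) (θ : E3) : ℂ :=
  ∫ x, wronskian Ω u (farWave k θ) x (outwardNormal Ω x) ∂ν

theorem wronskian_farWave_apply (hΩ : IsObstacle Ω) {x : E3} (hx : x ∈ closure Ωᶜ) (θ v : E3) :
    wronskian Ω u (farWave k θ) x v =
      u x * fderiv ℝ (farWave k θ) x v - farWave k θ x * extDeriv Ω u x v := by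
  rw [wronskian_apply, extDeriv_eq_fderiv_of_differentiable (f := farWave k θ) hΩ hx
    (((contDiff_farWave k θ).differentiable (by norm_num)) x)]

/-- The boundary integral is defined for every θ in ℝ³, not only for unit vectors, and is continuous
there. This supplies integrability over the sphere, bounds for the amplitude, and later positivity
of the total cross section from its value at one point. -/
theorem IsExteriorSmooth.continuous_farField (hu : IsExteriorSmooth Ω u) (hΩ : IsObstacle Ω)
    (hν : IsSurfaceMeasure ℂ Ω ν) : Continuous (farField ν Ω k u) := by
  have := hν.isFiniteMeasure hΩ
  rw [continuous_iff_continuousAt]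
  intro θ₀
  have hc : ContinuousOn (fun x => ‖u x‖ * ((‖θ₀‖ + 1) * |k|) + ‖normalDeriv Ω u x‖)
      (frontier Ω) :=
    (hu.continuousOn_frontier.norm.mul continuousOn_const).add
      (hu.continuousOn_normalDeriv hΩ).norm
  refine continuousAt_of_dominated
    (bound := fun x => ‖u x‖ * ((‖θ₀‖ + 1) * |k|) + ‖normalDeriv Ω u x‖) ?_ ?_
    (integrable_of_continuousOn_frontier hΩ hν.le hc) ?_
  · exact Eventually.of_forall fun θ => (hu.integrable_wronskian_normal
      (IsExteriorSmooth.of_contDiff (contDiff_farWave k θ)) hΩ hν).aestronglyMeasurable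
  · have hθ : ∀ᶠ θ : E3 in 𝓝 θ₀, ‖θ‖ < ‖θ₀‖ + 1 :=
      continuous_norm.continuousAt.eventually_lt continuousAt_const (by linarith)
    filter_upwards [hθ] with θ hθ
    filter_upwards [ae_mem_frontier hν.le] with x hx
    have hp : (4 * Real.pi)⁻¹ ≤ 1 := inv_le_one_of_one_le₀ (by linarith [Real.pi_gt_three])
    rw [wronskian_farWave_apply hΩ (frontier_subset_closure_compl Ω hx)]
    refine (norm_sub_le _ _).trans (add_le_add ?_ ?_)
    · rw [norm_mul, fderiv_farWave_apply, norm_smul, norm_mul, norm_mul, norm_farWave,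
        Complex.norm_I, one_mul, Complex.norm_real, Real.norm_eq_abs, Real.norm_eq_abs, abs_neg]
      have h1 : |inner ℝ θ (outwardNormal Ω x)| ≤ ‖θ₀‖ + 1 := by
        have := abs_real_inner_le_norm θ (outwardNormal Ω x)
        rw [norm_outwardNormal hΩ hx, mul_one] at this
        exact this.trans hθ.le
      calc ‖u x‖ * (|inner ℝ θ (outwardNormal Ω x)| * (|k| * (4 * Real.pi)⁻¹))
          ≤ ‖u x‖ * ((‖θ₀‖ + 1) * (|k| * 1)) := by gcongr
        _ = _ := by rw [mul_one]
    · rw [norm_mul, norm_farWave]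
      exact mul_le_of_le_one_left (norm_nonneg _) hp
  · filter_upwards [ae_mem_frontier hν.le] with x hx
    have h1 : (fun θ => wronskian Ω u (farWave k θ) x (outwardNormal Ω x)) = fun θ =>
        u x * (-inner ℝ θ (outwardNormal Ω x) • (Complex.I * k * outgoing k (-inner ℝ θ x))) -
          outgoing k (-inner ℝ θ x) * extDeriv Ω u x (outwardNormal Ω x) := by
      ext θ
      rw [wronskian_farWave_apply hΩ (frontier_subset_closure_compl Ω hx), fderiv_farWave_apply]
      rfl
    rw [h1]
    have h2 := (contDiff_outgoing k).continuous
    refine Continuous.continuousAt ?_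
    fun_prop

namespace IsRadiatingField

/-- The far field asymptotics of a radiating field, with a rate. -/
theorem exists_norm_sub_farField_le (hu : IsRadiatingField k Ω u) (hk : 0 < k) (hΩ : IsObstacle Ω)
    (hν : IsSurfaceMeasure ℂ Ω ν) :
    ∃ C R₀ : ℝ, 0 ≤ C ∧ 1 ≤ R₀ ∧ (∀ x ∈ Ω, ‖x‖ < R₀) ∧ ∀ r, R₀ ≤ ‖r‖ →
      ‖u r - sphericalWave k r * farField ν Ω k u (‖r‖⁻¹ • r)‖ ≤ C / ‖r‖ ^ 2 := by
  have := hν.isFiniteMeasure hΩ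
  have hcl : IsClosed Ω := hΩ.isCompact.isClosed
  obtain ⟨a, ha, hΩa⟩ := hΩ.exists_radius
  have hB : Integrable (fun x => ‖u x‖ + ‖normalDeriv Ω u x‖) ν :=
    integrable_of_continuousOn_frontier hΩ hν.le
      (hu.continuousOn_frontier.norm.add (hu.continuousOn_normalDeriv hΩ).norm)
  have hF : 0 ≤ farConst k a := by
    rw [farConst]
    positivity
  refine ⟨farConst k a * ∫ x, (‖u x‖ + ‖normalDeriv Ω u x‖) ∂ν, 2 * a + 1,
    mul_nonneg hF (integral_nonneg fun x => by positivity), by linarith,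
    fun x hx => by linarith [hΩa x hx], fun r hr => ?_⟩
  have hr0 : 0 < ‖r‖ := by linarith
  have hr2 : 2 * a ≤ ‖r‖ := by linarith
  have hrΩ : r ∈ Ωᶜ := fun h => by linarith [hΩa r h]
  rw [hu.representation hk hΩ hν hrΩ, farField, ← integral_const_mul,
    ← integral_sub (hu.integrable_wronskian_greenFn hΩ hν hrΩ) ((hu.integrable_wronskian_normal
      (IsExteriorSmooth.of_contDiff (contDiff_farWave k _)) hΩ hν).const_mul _),
    mul_div_right_comm, ← integral_const_mul]
  refine norm_integral_le_of_norm_le (hB.const_mul _) ?_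
  filter_upwards [ae_mem_frontier hν.le] with x hx
  have hxΩ : x ∈ Ω := hcl.frontier_subset hx
  have hx' := frontier_subset_closure_compl Ω hx
  have hxr : x ≠ r := fun h => hrΩ (h ▸ hxΩ)
  rw [wronskian_greenFn_apply hΩ hx' hxr, wronskian_farWave_apply hΩ hx']
  have h1 : u x * fderiv ℝ (greenFn k r) x (outwardNormal Ω x) -
        greenFn k r x * extDeriv Ω u x (outwardNormal Ω x) - sphericalWave k r *
        (u x * fderiv ℝ (farWave k (‖r‖⁻¹ • r)) x (outwardNormal Ω x) -
          farWave k (‖r‖⁻¹ • r) x * extDeriv Ω u x (outwardNormal Ω x)) =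
      u x * (fderiv ℝ (greenFn k r) x (outwardNormal Ω x) -
          sphericalWave k r * fderiv ℝ (farWave k (‖r‖⁻¹ • r)) x (outwardNormal Ω x)) -
        (greenFn k r x - sphericalWave k r * farWave k (‖r‖⁻¹ • r) x) *
          extDeriv Ω u x (outwardNormal Ω x) := by ring
  have h2 := norm_fderiv_greenFn_sub_le k (hΩa x hxΩ) hr0 hr2 (norm_outwardNormal hΩ hx)
  have h3 := norm_greenFn_sub_le' k (hΩa x hxΩ) hr0 hr2
  rw [h1]
  refine (norm_sub_le _ _).trans ?_
  rw [norm_mul, norm_mul]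
  calc _ ≤ ‖u x‖ * (farConst k a / ‖r‖ ^ 2) + farConst k a / ‖r‖ ^ 2 * ‖normalDeriv Ω u x‖ := by
        gcongr
        exact le_rfl
    _ = _ := by ring

theorem tendsto_farField (hu : IsRadiatingField k Ω u) (hk : 0 < k) (hΩ : IsObstacle Ω)
    (hν : IsSurfaceMeasure ℂ Ω ν) {θ : E3} (hθ : ‖θ‖ = 1) :
    Tendsto (fun R : ℝ => (R : ℂ) * Complex.exp (-(Complex.I * k * R)) * u (R • θ)) atTop
      (𝓝 (farField ν Ω k u θ)) := by
  obtain ⟨C, R₀, hC, hR₀, -, h⟩ := hu.exists_norm_sub_farField_le hk hΩ hν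
  rw [tendsto_iff_norm_sub_tendsto_zero]
  have h1 : Tendsto (fun R : ℝ => C / R) atTop (𝓝 0) := tendsto_const_nhds.div_atTop tendsto_id
  refine squeeze_zero' (Eventually.of_forall fun R => norm_nonneg _) ?_ h1
  filter_upwards [eventually_ge_atTop R₀] with R hR
  have hR0 : 0 < R := by linarith
  have hn : ‖R • θ‖ = R := by rw [norm_smul, hθ, mul_one, Real.norm_of_nonneg hR0.le]
  have h2 := h (R • θ) (by rw [hn]; exact hR)
  rw [hn, smul_smul, inv_mul_cancel₀ hR0.ne', one_smul, sphericalWave, hn] at h2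
  have h3 : (R : ℂ) * Complex.exp (-(Complex.I * k * R)) * u (R • θ) - farField ν Ω k u θ =
      (R : ℂ) * Complex.exp (-(Complex.I * k * R)) *
        (u (R • θ) - Complex.exp (Complex.I * k * R) / R * farField ν Ω k u θ) := by
    have h4 : Complex.exp (-(Complex.I * k * R)) * Complex.exp (Complex.I * k * R) = 1 := by
      rw [← Complex.exp_add, neg_add_cancel, Complex.exp_zero]
    have h5 : (R : ℂ) ≠ 0 := by exact_mod_cast hR0.ne'
    have h6 : (R : ℂ) * Complex.exp (-(Complex.I * k * R)) *
        (Complex.exp (Complex.I * k * R) / R * farField ν Ω k u θ) =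
        (R : ℂ) * (R : ℂ)⁻¹ *
          (Complex.exp (-(Complex.I * k * R)) * Complex.exp (Complex.I * k * R)) *
          farField ν Ω k u θ := by ring
    rw [mul_sub, h6, h4, mul_inv_cancel₀ h5, one_mul, one_mul]
  have h6 : ‖Complex.exp (-(Complex.I * k * R))‖ = 1 := by
    rw [Complex.exp_neg, norm_inv, norm_exp_I_mul, inv_one]
  rw [h3, norm_mul, norm_mul, h6, mul_one, Complex.norm_real, Real.norm_of_nonneg hR0.le]
  calc _ ≤ R * (C / R ^ 2) := by gcongr
    _ = C / R := by field_simp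

theorem scatteringAmplitude_eq (hu : IsRadiatingField k Ω u) (hk : 0 < k) (hΩ : IsObstacle Ω)
    (hν : IsSurfaceMeasure ℂ Ω ν) {θ : E3} (hθ : ‖θ‖ = 1) :
    scatteringAmplitude k u θ = farField ν Ω k u θ :=
  (hu.tendsto_farField hk hΩ hν hθ).limUnder_eq

theorem hasFarField (hu : IsRadiatingField k Ω u) (hk : 0 < k) (hΩ : IsObstacle Ω) :
    HasFarField k u (scatteringAmplitude k u) := by
  obtain ⟨ν, hν⟩ := exists_isSurfaceMeasure (V := ℂ) hΩ
  obtain ⟨C, R₀, hC, hR₀, -, h⟩ := hu.exists_norm_sub_farField_le hk hΩ hν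
  rw [HasFarField, Asymptotics.isLittleO_iff]
  intro c hc
  filter_upwards [tendsto_norm_cobounded_atTop.eventually_ge_atTop (max R₀ (C / c))] with r hr
  have hr1 : R₀ ≤ ‖r‖ := (le_max_left _ _).trans hr
  have hr0 : 0 < ‖r‖ := by linarith
  have hr2 : C ≤ ‖r‖ * c := (div_le_iff₀ hc).1 ((le_max_right _ _).trans hr)
  rw [hu.scatteringAmplitude_eq hk hΩ hν (norm_normalize hr0)]
  refine (h r hr1).trans ?_
  rw [norm_div, norm_one, norm_norm, mul_one_div, div_le_div_iff₀ (by positivity) hr0]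
  nlinarith

end IsRadiatingField

end

/-! ### Cross sections as limits of shell energies -/

section

open scoped ENNReal NNReal

variable {Ω : Set E3} {k : ℝ} {u : E3 → ℂ} {ν : Measure E3}

theorem integrable_sphere_of_continuous {f : E3 → ℝ} (hf : Continuous f) :
    Integrable (fun θ : Metric.sphere (0 : E3) 1 => f θ) sphereMeasure :=
  (hf.comp continuous_subtype_val).integrable_of_hasCompactSupport
    (HasCompactSupport.of_compactSpace _)

namespace IsRadiatingField

theorem totalCrossSection_eq (hu : IsRadiatingField k Ω u) (hk : 0 < k) (hΩ : IsObstacle Ω)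
    (hν : IsSurfaceMeasure ℂ Ω ν) :
    totalCrossSection k u = ∫ θ, ‖farField ν Ω k u (θ : E3)‖ ^ 2 ∂sphereMeasure := by
  rw [totalCrossSection]
  congr 1
  ext θ
  rw [hu.scatteringAmplitude_eq hk hΩ hν (norm_eq_of_mem_sphere θ)]

theorem integrable_sq_scatteringAmplitude (hu : IsRadiatingField k Ω u) (hk : 0 < k)
    (hΩ : IsObstacle Ω) :
    Integrable (fun θ : Metric.sphere (0 : E3) 1 => ‖scatteringAmplitude k u θ‖ ^ 2)
      sphereMeasure := by
  obtain ⟨ν, hν⟩ := exists_isSurfaceMeasure (V := ℂ) hΩ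
  have hc := hu.continuous_farField (k := k) hΩ hν
  refine (integrable_sphere_of_continuous (f := fun x => ‖farField ν Ω k u x‖ ^ 2)
    (by fun_prop)).congr (Eventually.of_forall fun θ => ?_)
  simp only [hu.scatteringAmplitude_eq hk hΩ hν (norm_eq_of_mem_sphere θ)]

theorem transportCrossSection_eq (hu : IsRadiatingField k Ω u) (hk : 0 < k) (hΩ : IsObstacle Ω)
    (hν : IsSurfaceMeasure ℂ Ω ν) (θ₀ : E3) :
    transportCrossSection k θ₀ u =
      ∫ θ, (1 - inner ℝ (θ : E3) θ₀) * ‖farField ν Ω k u (θ : E3)‖ ^ 2 ∂sphereMeasure := by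
  rw [transportCrossSection]
  congr 1
  ext θ
  rw [hu.scatteringAmplitude_eq hk hΩ hν (norm_eq_of_mem_sphere θ)]

/-- The far field expansion makes |u|² and |f(x/|x|)|²/|x|² differ by O(|x|⁻³), which is negligible
on shells, and the second function gives the total cross section on every shell by homogeneity. -/
theorem tendsto_shell_energy (hu : IsRadiatingField k Ω u) (hk : 0 < k) (hΩ : IsObstacle Ω) :
    Tendsto (fun R : ℝ => ∫ x, stepDeriv (‖x‖ - R) • ‖u x‖ ^ 2) atTop
      (𝓝 (totalCrossSection k u)) := by
  obtain ⟨ν, hν⟩ := exists_isSurfaceMeasure (V := ℂ) hΩ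
  obtain ⟨C, R₀, hC, hR₀, hΩR, h⟩ := hu.exists_norm_sub_farField_le hk hΩ hν
  have hfc := hu.continuous_farField (k := k) hΩ hν
  obtain ⟨F, hF⟩ := (isCompact_sphere (0 : E3) 1).exists_bound_of_continuousOn hfc.continuousOn
  set f := farField ν Ω k u with hf
  have hs : {x : E3 | R₀ ≤ ‖x‖} ⊆ closure Ωᶜ := fun x hx => subset_closure fun hx' =>
    absurd (hΩR x hx') (not_lt.2 hx)
  have c1 : ContinuousOn (fun x => ‖u x‖ ^ 2) {x | R₀ ≤ ‖x‖} :=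
    (hu.contDiffOn_closure.continuousOn.mono hs).norm.pow 2
  have c2 : ContinuousOn (fun x : E3 => (‖x‖ ^ 2)⁻¹ • ‖f (‖x‖⁻¹ • x)‖ ^ 2) {x | R₀ ≤ ‖x‖} :=
    (continuousOn_comp_normalize (f := fun x => ‖f x‖ ^ 2) (by fun_prop)).mono
      fun x (hx : R₀ ≤ ‖x‖) => show 0 < ‖x‖ by linarith
  have hle : ∀ x : E3, R₀ ≤ ‖x‖ →
      ‖1 * ‖u x‖ ^ 2 + (-1) * ((‖x‖ ^ 2)⁻¹ • ‖f (‖x‖⁻¹ • x)‖ ^ 2)‖ ≤ C * (2 * F + C) / ‖x‖ ^ 3 := by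
    intro x hx
    have hx1 : 1 ≤ ‖x‖ := hR₀.trans hx
    have hx0 : 0 < ‖x‖ := by linarith
    have h1 := h x hx
    set c := sphericalWave k x * f (‖x‖⁻¹ • x) with hc
    have h2 : (‖x‖ ^ 2)⁻¹ • ‖f (‖x‖⁻¹ • x)‖ ^ 2 = ‖c‖ ^ 2 := by
      rw [hc, norm_mul, norm_sphericalWave, mul_pow, inv_pow, smul_eq_mul]
    have h3 : ‖c‖ ≤ F / ‖x‖ := by
      rw [hc, norm_mul, norm_sphericalWave, ← div_eq_inv_mul]
      gcongr
      exact hF _ (by rw [mem_sphere_zero_iff_norm, norm_normalize hx0])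
    have h4 : ‖u x‖ ≤ ‖c‖ + C / ‖x‖ ^ 2 := by
      have := norm_le_norm_add_norm_sub' (u x) c
      linarith
    have h5 : C / ‖x‖ ^ 2 ≤ C / ‖x‖ := by
      refine div_le_div_of_nonneg_left hC hx0 ?_
      nlinarith
    have h6 : |‖u x‖ - ‖c‖| ≤ C / ‖x‖ ^ 2 := (abs_norm_sub_norm_le _ _).trans h1
    rw [h2]
    have h7 : 1 * ‖u x‖ ^ 2 + -1 * ‖c‖ ^ 2 = (‖u x‖ - ‖c‖) * (‖u x‖ + ‖c‖) := by ring
    rw [h7, norm_mul, Real.norm_eq_abs, Real.norm_of_nonneg (show 0 ≤ ‖u x‖ + ‖c‖ by positivity)]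
    calc |‖u x‖ - ‖c‖| * (‖u x‖ + ‖c‖) ≤ C / ‖x‖ ^ 2 * (F / ‖x‖ + C / ‖x‖ + F / ‖x‖) := by
          gcongr
          linarith
      _ = C * (2 * F + C) / ‖x‖ ^ 3 := by field_simp; ring
  have h1 : Tendsto (fun R : ℝ => ∫ x : E3, stepDeriv (‖x‖ - R) •
      (1 * ‖u x‖ ^ 2 + (-1) * ((‖x‖ ^ 2)⁻¹ • ‖f (‖x‖⁻¹ • x)‖ ^ 2))) atTop (𝓝 0) := by
    refine squeeze_zero_norm' ?_
      (tendsto_integral_stepDeriv_const_div_norm_pow (C * (2 * F + C)) le_rfl)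
    filter_upwards [eventually_ge_atTop R₀] with R hR
    exact norm_integral_stepDeriv_smul_le_integral
      (continuousOn_const_div_norm_pow _ 3 (by linarith)) fun x hx => hle x (hR.trans hx)
  have h2 := h1.add_const (totalCrossSection k u)
  rw [zero_add] at h2
  refine h2.congr' ?_
  filter_upwards [eventually_ge_atTop R₀] with R hR
  have hsub : {x : E3 | R ≤ ‖x‖} ⊆ {x | R₀ ≤ ‖x‖} := fun x hx => hR.trans hx
  rw [integral_stepDeriv_smul_linear (c1.mono hsub) (c2.mono hsub),
    integral_stepDeriv_smul_homogeneous (by linarith) (f := fun x => ‖f x‖ ^ 2) (by fun_prop),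
    hu.totalCrossSection_eq hk hΩ hν]
  ring

/-- The energy flux through the boundary is the total cross section times the wave number. -/
theorem integral_fluxDensity_eq (hu : IsRadiatingField k Ω u) (hk : 0 < k) (hΩ : IsObstacle Ω)
    (hν : IsSurfaceMeasure ℂ Ω ν) :
    ∫ x, fluxDensity Ω u x (outwardNormal Ω x) ∂ν = k * totalCrossSection k u := by
  obtain ⟨R₁, hR₁, hΩR⟩ := hΩ.exists_radius
  obtain ⟨K, hK⟩ := hu.exists_shell_energy_le hk hΩ
  have hs : {x : E3 | R₁ + 1 ≤ ‖x‖} ⊆ closure Ωᶜ :=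
    (subset_compl_of_radius hΩR (by linarith)).trans subset_closure
  have cu : ContinuousOn u {x | R₁ + 1 ≤ ‖x‖} := hu.contDiffOn_closure.continuousOn.mono hs
  have cD := hu.continuousOn_radiationDefect (k := k) hΩ hΩR hR₁ (R := R₁ + 1) (by linarith)
  have c1 : ContinuousOn (fun x => ‖u x‖ ^ 2) {x | R₁ + 1 ≤ ‖x‖} := cu.norm.pow 2
  have c2 : ContinuousOn (fun x => ((starRingEnd ℂ) (u x) * radiationDefect k Ω u x).im)
      {x | R₁ + 1 ≤ ‖x‖} :=
    Complex.continuous_im.comp_continuousOn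
      ((Complex.continuous_conj.comp_continuousOn cu).mul cD)
  -- The correction in `flux_identity` is a product of u, with bounded shell energy, and the
  -- radiation defect, with vanishing shell energy.
  have t1 : Tendsto (fun R : ℝ => ∫ x, stepDeriv (‖x‖ - R) •
      ((starRingEnd ℂ) (u x) * radiationDefect k Ω u x).im) atTop (𝓝 0) := by
    refine tendsto_integral_stepDeriv_smul_of_norm_le_mul cu.norm cD.norm (fun x _ => ?_) hK
      (hu.tendsto_radiationDefect hΩ)
    refine (Complex.abs_im_le_norm _).trans ?_
    rw [norm_mul, RCLike.norm_conj]
  have t2 := ((hu.tendsto_shell_energy hk hΩ).const_mul k).add (t1.const_mul 1)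
  rw [mul_zero, add_zero] at t2
  refine tendsto_nhds_unique (tendsto_const_nhds.congr' ?_) t2
  filter_upwards [eventually_ge_atTop (R₁ + 1)] with R hR
  have hsub : {x : E3 | R ≤ ‖x‖} ⊆ {x | R₁ + 1 ≤ ‖x‖} := fun x hx => hR.trans hx
  rw [← integral_stepDeriv_smul_linear (c1.mono hsub) (c2.mono hsub),
    hu.integral_fluxDensity hΩ hν (by linarith) fun x hx => (hΩR x hx).trans (by linarith)]
  simp only [flux_identity (k := k), one_mul]

end IsRadiatingField

end

/-! ### Plane waves, the total field and the optical theorem -/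

section

open scoped ENNReal NNReal

section Linear

variable {V : Type*} [NormedAddCommGroup V] [NormedSpace ℝ V]

theorem hasFDerivAt_comp_inner {p : ℝ → V} {p' : V} {θ y : E3}
    (hp : HasDerivAt p p' (inner ℝ θ y)) :
    HasFDerivAt (fun y => p (inner ℝ θ y)) ((innerSL ℝ θ).smulRight p') y := by
  have h1 : HasFDerivAt (fun y : E3 => inner ℝ θ y) (innerSL ℝ θ) y := (innerSL ℝ θ).hasFDerivAt
  have h2 := HasFDerivAt.comp y hp.hasFDerivAt h1
  exact h2

theorem divg_fderiv_comp_inner {p p' : ℝ → V} {p'' : V} {θ y : E3}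
    (hp : ∀ s, HasDerivAt p (p' s) s) (hp' : HasDerivAt p' p'' (inner ℝ θ y)) :
    divg (fderiv ℝ fun y => p (inner ℝ θ y)) y = ‖θ‖ ^ 2 • p'' := by
  have h1 : (fderiv ℝ fun y => p (inner ℝ θ y)) =
      fun y => (innerSL ℝ θ).smulRight (p' (inner ℝ θ y)) :=
    funext fun y => (hasFDerivAt_comp_inner (hp _)).fderiv
  have h2 : HasFDerivAt (fun y => (innerSL ℝ θ).smulRight (p' (inner ℝ θ y)))
      (((ContinuousLinearMap.smulRightL ℝ E3 V) (innerSL ℝ θ)).comp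
        ((innerSL ℝ θ).smulRight p'')) y :=
    HasFDerivAt.comp y ((ContinuousLinearMap.smulRightL ℝ E3 V) (innerSL ℝ θ)).hasFDerivAt
      (hasFDerivAt_comp_inner hp')
  rw [divg, h1, h2.fderiv]
  have h3 : ∀ j, (((ContinuousLinearMap.smulRightL ℝ E3 V) (innerSL ℝ θ)).comp
      ((innerSL ℝ θ).smulRight p'')) (stdB j) (stdB j) = inner ℝ θ (stdB j) ^ 2 • p'' := by
    intro j
    rw [pow_two, mul_smul]
    rfl
  rw [Finset.sum_congr rfl fun j _ => h3 j, ← Finset.sum_smul]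
  congr 1
  rw [← stdB.sum_sq_norm_inner_left θ]
  simp

end Linear

variable {Ω : Set E3} {k : ℝ} {u : E3 → ℂ} {ν : Measure E3}

theorem hasDerivAt_exp_I_mul (k s : ℝ) :
    HasDerivAt (fun t : ℝ => Complex.exp (Complex.I * k * t))
      (Complex.I * k * Complex.exp (Complex.I * k * s)) s := by
  have h1 : HasDerivAt (fun t : ℝ => Complex.I * k * (t : ℂ)) (Complex.I * k) s := by
    simpa using (Complex.ofRealCLM.hasDerivAt (x := s)).const_mul (Complex.I * k)
  exact h1.cexp.congr_deriv (mul_comm _ _)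

theorem planeWave_eq (k : ℝ) (θ : E3) :
    planeWave k θ = fun y => (fun t : ℝ => Complex.exp (Complex.I * k * t)) (inner ℝ θ y) := by
  ext y
  rw [planeWave, real_inner_comm]

theorem contDiff_planeWave (k : ℝ) (θ : E3) : ContDiff ℝ 2 (planeWave k θ) := by
  have h : ContDiff ℝ 2 fun y : E3 => inner ℝ θ y := contDiff_const.inner ℝ contDiff_id
  rw [planeWave_eq]
  exact (contDiff_const.mul (Complex.ofRealCLM.contDiff.comp h)).cexp

theorem norm_planeWave (k : ℝ) (θ y : E3) : ‖planeWave k θ y‖ = 1 := norm_exp_I_mul _ _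

theorem fderiv_planeWave_apply (k : ℝ) (θ y v : E3) :
    fderiv ℝ (planeWave k θ) y v = inner ℝ θ v • (Complex.I * k * planeWave k θ y) := by
  rw [planeWave_eq, (hasFDerivAt_comp_inner (hasDerivAt_exp_I_mul k _)).fderiv]
  rfl

theorem divg_fderiv_planeWave (k : ℝ) {θ : E3} (hθ : ‖θ‖ = 1) (y : E3) :
    divg (fderiv ℝ (planeWave k θ)) y = -((k : ℂ) ^ 2 * planeWave k θ y) := by
  rw [planeWave_eq, divg_fderiv_comp_inner (hasDerivAt_exp_I_mul k)
    ((hasDerivAt_exp_I_mul k _).const_mul _), hθ, one_pow, one_smul]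
  linear_combination (k : ℂ) ^ 2 * Complex.exp (Complex.I * k * (inner ℝ θ y : ℝ)) * Complex.I_sq

theorem farWave_eq (k : ℝ) (θ : E3) : farWave k θ = fun y => outgoing k (inner ℝ (-θ) y) := by
  ext y
  rw [farWave, inner_neg_left]

theorem divg_fderiv_farWave (k : ℝ) {θ : E3} (hθ : ‖θ‖ = 1) (y : E3) :
    divg (fderiv ℝ (farWave k θ)) y = -((k : ℂ) ^ 2 * farWave k θ y) := by
  rw [farWave_eq, divg_fderiv_comp_inner (hasDerivAt_outgoing k)
    ((hasDerivAt_outgoing k _).const_mul _), norm_neg, hθ, one_pow, one_smul]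
  linear_combination (k : ℂ) ^ 2 * outgoing k (inner ℝ (-θ) y) * Complex.I_sq

/-- Both waves solve the Helmholtz equation throughout Ω, so Green's identity inside Ω gives zero.
This permits passing from u to the total field. -/
theorem integral_wronskian_planeWave_farWave (hΩ : IsObstacle Ω) (hν : IsSurfaceMeasure ℂ Ω ν)
    (k : ℝ) {θ₀ θ : E3} (hθ₀ : ‖θ₀‖ = 1) (hθ : ‖θ‖ = 1) :
    ∫ x, wronskian Ω (planeWave k θ₀) (farWave k θ) x (outwardNormal Ω x) ∂ν = 0 := by
  refine hν.green_interior hΩ (contDiff_planeWave k θ₀) (contDiff_farWave k θ) fun x _ => ?_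
  rw [divg_fderiv_planeWave k hθ₀, divg_fderiv_farWave k hθ]
  ring

theorem wronskian_add_planeWave {g : E3 → ℂ} {θ₀ x : E3} (v : E3) :
    wronskian Ω u g x v + wronskian Ω (planeWave k θ₀) g x v =
      (u x + planeWave k θ₀ x) * extDeriv Ω g x v -
        g x * (extDeriv Ω u x v + extDeriv Ω (planeWave k θ₀) x v) := by
  rw [wronskian_apply, wronskian_apply]
  ring

theorem norm_le_boundarySup (hΩ : IsObstacle Ω) {γ : E3 → ℂ} (hγ : ContinuousOn γ (frontier Ω))
    {x : E3} (hx : x ∈ frontier Ω) : ‖γ x‖ ≤ boundarySup Ω γ := by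
  have hc : IsCompact (frontier Ω) :=
    hΩ.isCompact.of_isClosed_subset isClosed_frontier hΩ.isCompact.isClosed.frontier_subset
  exact le_csSup (hc.bddAbove_image hγ.norm) (mem_image_of_mem _ hx)

namespace IsScatteredField

variable {γ : E3 → ℂ} {θ₀ : E3} {γ₀ : ℝ}

theorem isRadiatingField (hu : IsScatteredField k Ω γ θ₀ u) : IsRadiatingField k Ω u where
  contDiffOn_exterior := hu.contDiffOn_exterior
  contDiffOn_closure := hu.contDiffOn_closure
  helmholtz x hx := by
    have h := hu.helmholtz x hx
    rw [laplacian_eq_divg] at h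
    linear_combination h
  radiating := hu.radiating

/-- The impedance condition for the total field. -/
theorem extDeriv_total (hu : IsScatteredField k Ω γ θ₀ u) {x : E3} (hx : x ∈ frontier Ω) :
    extDeriv Ω u x (outwardNormal Ω x) + extDeriv Ω (planeWave k θ₀) x (outwardNormal Ω x) =
      -(k * γ x * (u x + planeWave k θ₀ x)) := by
  have h := hu.boundary x hx
  simp only [impedanceOp, normalDeriv] at h
  linear_combination h

theorem continuousOn_total (hu : IsScatteredField k Ω γ θ₀ u) :
    ContinuousOn (fun x => u x + planeWave k θ₀ x) (frontier Ω) :=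
  hu.isRadiatingField.continuousOn_frontier.add (contDiff_planeWave k θ₀).continuous.continuousOn

/-- The impedance condition gives the total field v = u + w the flux -k Im γ |v|². Expanding Im(v̄
∂v), the cross terms are Wronskians of u with w̄, and w̄ is 4π times the far wave in direction θ₀;
the square of w is half a Wronskian of w with w̄. The latter integrates to zero in `optical`. -/
theorem flux_pointwise (hu : IsScatteredField k Ω γ θ₀ u) (hΩ : IsObstacle Ω) {x : E3}
    (hx : x ∈ frontier Ω) :
    fluxDensity Ω u x (outwardNormal Ω x) =
      4 * Real.pi * (wronskian Ω u (farWave k θ₀) x (outwardNormal Ω x)).im +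
      2 * Real.pi * (wronskian Ω (planeWave k θ₀) (farWave k θ₀) x (outwardNormal Ω x)).im -
      k * ((γ x).im * ‖u x + planeWave k θ₀ x‖ ^ 2) := by
  have hx' := frontier_subset_closure_compl Ω hx
  have hw : extDeriv Ω (planeWave k θ₀) x (outwardNormal Ω x) =
      inner ℝ θ₀ (outwardNormal Ω x) • (Complex.I * k * planeWave k θ₀ x) := by
    rw [extDeriv_eq_fderiv_of_differentiable (f := planeWave k θ₀) hΩ hx'
      (((contDiff_planeWave k θ₀).differentiable (by norm_num)) x), fderiv_planeWave_apply]
  have hg : farWave k θ₀ x = (4 * Real.pi : ℝ)⁻¹ • (starRingEnd ℂ) (planeWave k θ₀ x) := by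
    rw [farWave, outgoing, planeWave, ← Complex.exp_conj, real_inner_comm]
    simp
  have hu' := hu.extDeriv_total hx
  rw [wronskian_farWave_apply hΩ hx', wronskian_farWave_apply hΩ hx', fderiv_farWave_apply, hw, hg,
    fluxDensity]
  rw [hw] at hu'
  generalize extDeriv Ω u x (outwardNormal Ω x) = d at *
  generalize planeWave k θ₀ x = w at *
  generalize inner ℝ θ₀ (outwardNormal Ω x) = c at *
  have hd : d = -(k * γ x * (u x + w)) - c • (Complex.I * k * w) := by linear_combination hu'
  subst hd
  generalize u x = z at *
  generalize γ x = g at *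
  have hπ := Real.pi_ne_zero
  rw [← Complex.normSq_eq_norm_sq, Complex.normSq_apply]
  simp
  field_simp
  ring

/-- The optical theorem. -/
theorem optical (hu : IsScatteredField k Ω γ θ₀ u) (hk : 0 < k) (hΩ : IsObstacle Ω)
    (hν : IsSurfaceMeasure ℂ Ω ν) (hγ : ContinuousOn γ (frontier Ω)) (hθ₀ : ‖θ₀‖ = 1) :
    k * totalCrossSection k u + k * ∫ x, (γ x).im * ‖u x + planeWave k θ₀ x‖ ^ 2 ∂ν =
      4 * Real.pi * (farField ν Ω k u θ₀).im := by
  have := hν.isFiniteMeasure hΩ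
  have hr := hu.isRadiatingField
  have i1 := hr.integrable_wronskian_normal
    (IsExteriorSmooth.of_contDiff (contDiff_farWave k θ₀)) hΩ hν
  have i2 := (IsExteriorSmooth.of_contDiff (contDiff_planeWave k θ₀)).integrable_wronskian_normal
    (IsExteriorSmooth.of_contDiff (contDiff_farWave k θ₀)) hΩ hν
  have i3 : Integrable (fun x => (γ x).im * ‖u x + planeWave k θ₀ x‖ ^ 2) ν :=
    integrable_of_continuousOn_frontier hΩ hν.le
      ((Complex.continuous_im.comp_continuousOn hγ).mul (hu.continuousOn_total.norm.pow 2))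
  have e1 : ∫ x, (wronskian Ω u (farWave k θ₀) x (outwardNormal Ω x)).im ∂ν =
      (farField ν Ω k u θ₀).im := integral_im i1
  have e2 : ∫ x, (wronskian Ω (planeWave k θ₀) (farWave k θ₀) x (outwardNormal Ω x)).im ∂ν = 0 := by
    have h : ∫ x, (wronskian Ω (planeWave k θ₀) (farWave k θ₀) x (outwardNormal Ω x)).im ∂ν =
        (∫ x, wronskian Ω (planeWave k θ₀) (farWave k θ₀) x (outwardNormal Ω x) ∂ν).im :=
      integral_im i2
    rw [h, integral_wronskian_planeWave_farWave hΩ hν k hθ₀ hθ₀, Complex.zero_im]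
  have i1' : Integrable (fun x =>
      4 * Real.pi * (wronskian Ω u (farWave k θ₀) x (outwardNormal Ω x)).im) ν :=
    i1.im.const_mul (4 * Real.pi)
  have i2' : Integrable (fun x => 2 * Real.pi *
      (wronskian Ω (planeWave k θ₀) (farWave k θ₀) x (outwardNormal Ω x)).im) ν :=
    i2.im.const_mul (2 * Real.pi)
  have i12 : Integrable (fun x =>
      4 * Real.pi * (wronskian Ω u (farWave k θ₀) x (outwardNormal Ω x)).im + 2 * Real.pi *
        (wronskian Ω (planeWave k θ₀) (farWave k θ₀) x (outwardNormal Ω x)).im) ν := i1'.add i2'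
  have h := integral_congr_ae (μ := ν) ((ae_mem_frontier hν.le).mono fun x hx =>
    hu.flux_pointwise hΩ hx)
  rw [hr.integral_fluxDensity_eq hk hΩ hν, integral_sub i12 (i3.const_mul k),
    integral_add i1' i2', integral_const_mul, integral_const_mul, integral_const_mul] at h
  rw [h, e1, e2]
  ring

end IsScatteredField

end

/-! ### Caps, the amplitude bound and the lower bound for the transport cross section -/

section

open scoped ENNReal NNReal Pointwise

/-- Polarization: the distance from Q (t, y) to Q (1, 0) is known from the norm identity. -/
theorem inner_adapted_coordinates {Q : (ℝ × E2) ≃L[ℝ] E3} {θ₀ : E3} (h1 : Q (1, 0) = θ₀)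
    (hQ : ∀ t y, ‖Q (t, y)‖ ^ 2 = t ^ 2 + ‖y‖ ^ 2) (t : ℝ) (y : E2) :
    inner ℝ (Q (t, y)) θ₀ = t := by
  have e1 : Q (t, y) - θ₀ = Q (t - 1, y) := by
    rw [← h1, ← map_sub, Prod.mk_sub_mk, sub_zero]
  have e2 := norm_sub_sq_real (Q (t, y)) θ₀
  have e3 : ‖θ₀‖ ^ 2 = 1 := by rw [← h1, hQ]; simp
  rw [e1, hQ, hQ, e3] at e2
  linarith

/-- The area of a spherical cap is at most of the order of its height. -/
theorem sphereMeasure_cap_le {θ₀ : E3} (hθ₀ : ‖θ₀‖ = 1) {h : ℝ} (hh : 0 < h) :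
    sphereMeasure.real {θ | 1 - inner ℝ (θ : E3) θ₀ < h} ≤ 6 * Real.pi * h := by
  -- For h > 1 the area 4π of the whole sphere suffices. For h ≤ 1 the cosine c is positive on the
  -- cap, as the inclusion in the cylinder requires.
  rcases lt_or_ge 1 h with h1 | h1
  · have h2 : sphereMeasure.real {θ | 1 - inner ℝ (θ : E3) θ₀ < h} ≤ sphereMeasure.real univ :=
      measureReal_mono (subset_univ _)
    rw [sphereMeasure_real_univ] at h2
    nlinarith [Real.pi_pos]
  obtain ⟨Q, hQ1, hQn, hQm⟩ := exists_adapted_coordinates hθ₀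
  set s : Set (Metric.sphere (0 : E3) 1) := {θ | 1 - inner ℝ (θ : E3) θ₀ < h} with hs
  have hms : MeasurableSet s := by
    have : Continuous fun θ : Metric.sphere (0 : E3) 1 => 1 - inner ℝ (θ : E3) θ₀ := by fun_prop
    exact (isOpen_lt this continuous_const).measurableSet
  set B : Set (ℝ × E2) := Ioo 0 1 ×ˢ Metric.ball 0 √(2 * h) with hB
  have hBo : IsOpen B := isOpen_Ioo.prod Metric.isOpen_ball
  -- The cone over the cap lies in a cylinder of height 1 and squared radius 2h, since 1 - c² =
  -- (1-c)(1+c) < 2h. Spherical measure is three times the volume of the cone, whence 6πh; the sharp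
  -- value is 2πh.
  have hsub : Ioo (0 : ℝ) 1 • ((↑) '' s : Set E3) ⊆ Q.symm ⁻¹' B := by
    rintro x ⟨t, ht, -, ⟨θ, hθ, rfl⟩, rfl⟩
    have hθ' : 1 - inner ℝ (θ : E3) θ₀ < h := hθ
    obtain ⟨⟨a, y⟩, hay⟩ := Q.surjective (t • (θ : E3))
    have hθn : ‖(θ : E3)‖ = 1 := norm_eq_of_mem_sphere θ
    have ha := inner_adapted_coordinates hQ1 hQn a y
    rw [hay, real_inner_smul_left] at ha
    have hn := hQn a y
    rw [hay, norm_smul, hθn, mul_one, Real.norm_of_nonneg ht.1.le] at hn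
    have hc1 : inner ℝ (θ : E3) θ₀ ≤ 1 := by
      have := real_inner_le_norm (θ : E3) θ₀
      rwa [hθn, hθ₀, one_mul] at this
    set c := inner ℝ (θ : E3) θ₀ with hc
    have hc0 : 0 < c := by linarith
    simp only [mem_preimage]
    rw [← hay, Q.symm_apply_apply]
    refine ⟨⟨?_, ?_⟩, ?_⟩
    · rw [← ha]
      exact mul_pos ht.1 hc0
    · simp only
      rw [← ha]
      nlinarith [ht.1, ht.2]
    · rw [mem_ball_zero_iff]
      refine Real.lt_sqrt_of_sq_lt ?_
      have h3 : ‖y‖ ^ 2 = t ^ 2 * ((1 - c) * (1 + c)) := by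
        rw [← ha] at hn
        linarith
      have h4 : (1 - c) * (1 + c) < 2 * h := by nlinarith
      have h5 : 0 ≤ (1 - c) * (1 + c) := by nlinarith
      have h6 : t ^ 2 ≤ 1 := by nlinarith [ht.1, ht.2]
      rw [h3]
      nlinarith
  have hvol : volume (Q.symm ⁻¹' B) = ENNReal.ofReal (2 * Real.pi * h) := by
    rw [← hQm.measure_preimage (hBo.preimage Q.symm.continuous).measurableSet.nullMeasurableSet]
    have e1 : Q ⁻¹' (Q.symm ⁻¹' B) = B := by
      ext p
      simp
    rw [e1, hB, Measure.volume_eq_prod, Measure.prod_prod, Real.volume_Ioo,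
      EuclideanSpace.volume_ball_fin_two, sub_zero, ENNReal.ofReal_one, one_mul,
      ← ENNReal.ofReal_pow (Real.sqrt_nonneg _), Real.sq_sqrt (by positivity)]
    rw [← ENNReal.ofReal_mul (by positivity)]
    congr 1
    ring
  rw [measureReal_def, Measure.toSphere_apply' _ hms]
  have h7 : (3 : ℝ≥0∞) * volume (Ioo (0 : ℝ) 1 • ((↑) '' s : Set E3)) ≤
      3 * ENNReal.ofReal (2 * Real.pi * h) := by
    gcongr
    exact (measure_mono hsub).trans hvol.le
  have h8 : (Module.finrank ℝ E3 : ℝ≥0∞) = 3 := by simp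
  rw [h8]
  have hpos : 0 ≤ 2 * Real.pi * h := by have := Real.pi_pos; positivity
  refine (ENNReal.toReal_mono (ENNReal.mul_ne_top (by simp) ENNReal.ofReal_ne_top) h7).trans ?_
  rw [ENNReal.toReal_mul, ENNReal.toReal_ofReal hpos]
  simp only [ENNReal.toReal_ofNat]
  linarith

/-- A bounded density on the sphere cannot be concentrated near one direction. -/
theorem transport_lower_bound {θ₀ : E3} (hθ₀ : ‖θ₀‖ = 1) {f : E3 → ℂ} (hf : Continuous f) {M : ℝ}
    (hM : 0 < M) (hfM : ∀ θ, ‖θ‖ = 1 → ‖f θ‖ ≤ M) :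
    (∫ θ, ‖f (θ : E3)‖ ^ 2 ∂sphereMeasure) ^ 2 / (24 * Real.pi * M ^ 2) ≤
      ∫ θ, (1 - inner ℝ (θ : E3) θ₀) * ‖f (θ : E3)‖ ^ 2 ∂sphereMeasure := by
  set σ := ∫ θ, ‖f (θ : E3)‖ ^ 2 ∂sphereMeasure with hσ
  have hπ := Real.pi_pos
  have hle1 : ∀ θ : Metric.sphere (0 : E3) 1, 0 ≤ 1 - inner ℝ (θ : E3) θ₀ := by
    intro θ
    have := real_inner_le_norm (θ : E3) θ₀
    rw [norm_eq_of_mem_sphere θ, hθ₀, one_mul] at this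
    linarith
  have hσ0 : 0 ≤ σ := integral_nonneg fun θ => by positivity
  rcases hσ0.eq_or_lt with h0 | h0
  · rw [← h0]
    simp only [ne_eq, OfNat.ofNat_ne_zero, not_false_eq_true, zero_pow, zero_div]
    exact integral_nonneg fun θ => mul_nonneg (hle1 θ) (sq_nonneg _)
  -- The maximizer of tσ - 6πM²t²: off the cap the weight 1 - θ·θ₀ is at least t, and on the cap at
  -- most 6πt · M² of the mass is lost.
  set t := σ / (12 * Real.pi * M ^ 2) with ht
  have ht0 : 0 < t := by positivity
  set s : Set (Metric.sphere (0 : E3) 1) := {θ | 1 - inner ℝ (θ : E3) θ₀ < t} with hs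
  have hms : MeasurableSet s := by
    have : Continuous fun θ : Metric.sphere (0 : E3) 1 => 1 - inner ℝ (θ : E3) θ₀ := by fun_prop
    exact (isOpen_lt this continuous_const).measurableSet
  have i1 : Integrable (fun θ : Metric.sphere (0 : E3) 1 => t * ‖f (θ : E3)‖ ^ 2) sphereMeasure :=
    integrable_sphere_of_continuous (f := fun x => t * ‖f x‖ ^ 2) (by fun_prop)
  have i2 : Integrable (s.indicator fun _ => t * M ^ 2) sphereMeasure :=
    (integrable_const _).indicator hms
  have i3 : Integrable (fun θ : Metric.sphere (0 : E3) 1 =>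
      (1 - inner ℝ (θ : E3) θ₀) * ‖f (θ : E3)‖ ^ 2) sphereMeasure :=
    integrable_sphere_of_continuous (f := fun x => (1 - inner ℝ x θ₀) * ‖f x‖ ^ 2) (by fun_prop)
  have h1 : ∫ θ, (t * ‖f (θ : E3)‖ ^ 2 - s.indicator (fun _ => t * M ^ 2) θ) ∂sphereMeasure ≤
      ∫ θ, (1 - inner ℝ (θ : E3) θ₀) * ‖f (θ : E3)‖ ^ 2 ∂sphereMeasure := by
    refine integral_mono (i1.sub i2) i3 fun θ => ?_
    have hfθ := hfM θ (norm_eq_of_mem_sphere θ)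
    by_cases hθ : θ ∈ s
    · simp only [indicator_of_mem hθ]
      have h2 : ‖f (θ : E3)‖ ^ 2 ≤ M ^ 2 := by gcongr
      nlinarith [mul_nonneg (hle1 θ) (sq_nonneg ‖f (θ : E3)‖)]
    · simp only [indicator_of_notMem hθ, sub_zero]
      have h2 : t ≤ 1 - inner ℝ (θ : E3) θ₀ := not_lt.1 hθ
      gcongr
  rw [integral_sub i1 i2, integral_const_mul, integral_indicator_const _ hms, smul_eq_mul] at h1
  have h2 := sphereMeasure_cap_le hθ₀ ht0
  have h3 : sphereMeasure.real s * (t * M ^ 2) ≤ 6 * Real.pi * t * (t * M ^ 2) := by gcongr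
  have h4 : t * σ - 6 * Real.pi * t * (t * M ^ 2) = σ ^ 2 / (24 * Real.pi * M ^ 2) := by
    rw [ht]
    field_simp
    ring
  linarith

variable {Ω : Set E3} {k : ℝ} {u : E3 → ℂ} {ν : Measure E3}

namespace IsScatteredField

variable {γ : E3 → ℂ} {θ₀ : E3} {γ₀ : ℝ}

/-- Adding the vanishing integral of the incident wave turns the Cauchy data of u into those of the
total field, and the impedance condition eliminates the normal derivative. -/
theorem farField_eq_total (hu : IsScatteredField k Ω γ θ₀ u) (hΩ : IsObstacle Ω)
    (hν : IsSurfaceMeasure ℂ Ω ν) (hθ₀ : ‖θ₀‖ = 1) {θ : E3} (hθ : ‖θ‖ = 1) :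
    farField ν Ω k u θ = ∫ x, (u x + planeWave k θ₀ x) *
      (fderiv ℝ (farWave k θ) x (outwardNormal Ω x) + k * γ x * farWave k θ x) ∂ν := by
  have i1 := hu.isRadiatingField.integrable_wronskian_normal
    (IsExteriorSmooth.of_contDiff (contDiff_farWave k θ)) hΩ hν
  have i2 := (IsExteriorSmooth.of_contDiff (contDiff_planeWave k θ₀)).integrable_wronskian_normal
    (IsExteriorSmooth.of_contDiff (contDiff_farWave k θ)) hΩ hν
  rw [farField, ← add_zero (∫ x, wronskian Ω u (farWave k θ) x (outwardNormal Ω x) ∂ν),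
    ← integral_wronskian_planeWave_farWave hΩ hν k hθ₀ hθ, ← integral_add i1 i2]
  refine integral_congr_ae ?_
  filter_upwards [ae_mem_frontier hν.le] with x hx
  rw [wronskian_add_planeWave, hu.extDeriv_total hx,
    extDeriv_eq_fderiv_of_differentiable (f := farWave k θ) hΩ
      (frontier_subset_closure_compl Ω hx)
      (((contDiff_farWave k θ).differentiable (by norm_num)) x)]
  ring

/-- The far wave has modulus 1/(4π), its normal derivative is at most k/(4π), and the impedance term
is at most kΓ/(4π). -/
theorem norm_farField_le_integral (hu : IsScatteredField k Ω γ θ₀ u) (hk : 0 < k)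
    (hΩ : IsObstacle Ω) (hν : IsSurfaceMeasure ℂ Ω ν) (hγ : ContinuousOn γ (frontier Ω))
    (hθ₀ : ‖θ₀‖ = 1) {θ : E3} (hθ : ‖θ‖ = 1) :
    ‖farField ν Ω k u θ‖ ≤
      k * (1 + boundarySup Ω γ) / (4 * Real.pi) * ∫ x, ‖u x + planeWave k θ₀ x‖ ∂ν := by
  have := hν.isFiniteMeasure hΩ
  have hi : Integrable (fun x => ‖u x + planeWave k θ₀ x‖) ν :=
    integrable_of_continuousOn_frontier hΩ hν.le hu.continuousOn_total.norm
  rw [hu.farField_eq_total hΩ hν hθ₀ hθ, ← integral_const_mul]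
  refine norm_integral_le_of_norm_le (hi.const_mul _) ?_
  filter_upwards [ae_mem_frontier hν.le] with x hx
  have h1 : |inner ℝ θ (outwardNormal Ω x)| ≤ 1 := by
    have := abs_real_inner_le_norm θ (outwardNormal Ω x)
    rwa [hθ, norm_outwardNormal hΩ hx, one_mul] at this
  have h2 := norm_le_boundarySup hΩ hγ hx
  have hπ := Real.pi_pos
  have h3 : ‖fderiv ℝ (farWave k θ) x (outwardNormal Ω x) + k * γ x * farWave k θ x‖ ≤
      k * (1 + boundarySup Ω γ) / (4 * Real.pi) := by
    refine (norm_add_le _ _).trans ?_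
    rw [fderiv_farWave_apply, norm_smul, norm_mul, norm_mul, norm_mul, norm_mul, norm_farWave,
      Complex.norm_I, one_mul, Complex.norm_real, Real.norm_of_nonneg hk.le, Real.norm_eq_abs,
      abs_neg]
    calc _ ≤ 1 * (k * (4 * Real.pi)⁻¹) + k * boundarySup Ω γ * (4 * Real.pi)⁻¹ := by gcongr
      _ = _ := by ring
  rw [norm_mul, mul_comm]
  gcongr

theorem totalCrossSection_nonneg : 0 ≤ totalCrossSection k u :=
  integral_nonneg fun _ => by positivity

theorem boundarySup_nonneg (Ω : Set E3) (γ : E3 → ℂ) : 0 ≤ boundarySup Ω γ := by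
  refine Real.sSup_nonneg ?_
  rintro _ ⟨x, -, rfl⟩
  exact norm_nonneg _

/-- The absorbed energy is controlled by the forward amplitude. -/
theorem energy_le (hu : IsScatteredField k Ω γ θ₀ u) (hk : 0 < k) (hΩ : IsObstacle Ω)
    (hν : IsSurfaceMeasure ℂ Ω ν) (hγ : ContinuousOn γ (frontier Ω))
    (hγ₀ : ∀ x ∈ frontier Ω, γ₀ ≤ (γ x).im) (hθ₀ : ‖θ₀‖ = 1) :
    k * (γ₀ * ∫ x, ‖u x + planeWave k θ₀ x‖ ^ 2 ∂ν) ≤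
      4 * Real.pi * ‖farField ν Ω k u θ₀‖ := by
  have := hν.isFiniteMeasure hΩ
  have i1 : Integrable (fun x => ‖u x + planeWave k θ₀ x‖ ^ 2) ν :=
    integrable_of_continuousOn_frontier hΩ hν.le (hu.continuousOn_total.norm.pow 2)
  have i3 : Integrable (fun x => (γ x).im * ‖u x + planeWave k θ₀ x‖ ^ 2) ν :=
    integrable_of_continuousOn_frontier hΩ hν.le
      ((Complex.continuous_im.comp_continuousOn hγ).mul (hu.continuousOn_total.norm.pow 2))
  have h1 : γ₀ * ∫ x, ‖u x + planeWave k θ₀ x‖ ^ 2 ∂ν ≤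
      ∫ x, (γ x).im * ‖u x + planeWave k θ₀ x‖ ^ 2 ∂ν := by
    rw [← integral_const_mul]
    refine integral_mono_ae (i1.const_mul _) i3 ?_
    filter_upwards [ae_mem_frontier hν.le] with x hx
    exact mul_le_mul_of_nonneg_right (hγ₀ x hx) (sq_nonneg _)
  have h2 := hu.optical hk hΩ hν hγ hθ₀
  have h3 := totalCrossSection_nonneg (k := k) (u := u)
  have h4 : (farField ν Ω k u θ₀).im ≤ ‖farField ν Ω k u θ₀‖ := Complex.im_le_norm _
  have hπ := Real.pi_pos
  calc k * (γ₀ * ∫ x, ‖u x + planeWave k θ₀ x‖ ^ 2 ∂ν)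
      ≤ k * ∫ x, (γ x).im * ‖u x + planeWave k θ₀ x‖ ^ 2 ∂ν := by gcongr
    _ ≤ 4 * Real.pi * (farField ν Ω k u θ₀).im := by nlinarith
    _ ≤ _ := by gcongr

/-- The energy bound is self-improving. With Y and X the integrals of |v| and |v|² and c = (1+Γ)/γ₀,
the optical theorem and the amplitude bound at θ₀ give X ≤ cY, while integrating (|v| - c)² ≥ 0
gives 2cY ≤ X + c² ν(∂Ω); together Y ≤ c ν(∂Ω). -/
theorem integral_norm_total_le (hu : IsScatteredField k Ω γ θ₀ u) (hk : 0 < k) (hγ0 : 0 < γ₀)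
    (hΩ : IsObstacle Ω) (hν : IsSurfaceMeasure ℂ Ω ν) (hγ : ContinuousOn γ (frontier Ω))
    (hγ₀ : ∀ x ∈ frontier Ω, γ₀ ≤ (γ x).im) (hθ₀ : ‖θ₀‖ = 1) :
    ∫ x, ‖u x + planeWave k θ₀ x‖ ∂ν ≤ (1 + boundarySup Ω γ) / γ₀ * ν.real univ := by
  have := hν.isFiniteMeasure hΩ
  have hΓ := boundarySup_nonneg Ω γ
  have hπ := Real.pi_pos
  have i1 : Integrable (fun x => ‖u x + planeWave k θ₀ x‖ ^ 2) ν :=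
    integrable_of_continuousOn_frontier hΩ hν.le (hu.continuousOn_total.norm.pow 2)
  have i2 : Integrable (fun x => ‖u x + planeWave k θ₀ x‖) ν :=
    integrable_of_continuousOn_frontier hΩ hν.le hu.continuousOn_total.norm
  have h1 := hu.energy_le hk hΩ hν hγ hγ₀ hθ₀
  have h2 := hu.norm_farField_le_integral hk hΩ hν hγ hθ₀ hθ₀
  set Y := ∫ x, ‖u x + planeWave k θ₀ x‖ ∂ν with hY
  set X := ∫ x, ‖u x + planeWave k θ₀ x‖ ^ 2 ∂ν with hX
  set c := (1 + boundarySup Ω γ) / γ₀ with hc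
  have hc0 : 0 < c := by positivity
  have h3 : X ≤ c * Y := by
    have h4 : k * (γ₀ * X) ≤ k * (γ₀ * (c * Y)) := by
      refine h1.trans ((mul_le_mul_of_nonneg_left h2 (by positivity)).trans (le_of_eq ?_))
      rw [hc]
      field_simp
    exact le_of_mul_le_mul_left (le_of_mul_le_mul_left h4 hk) hγ0
  have h5 : 2 * c * Y ≤ X + c ^ 2 * ν.real univ := by
    have h6 : ∫ x, 2 * c * ‖u x + planeWave k θ₀ x‖ ∂ν ≤
        ∫ x, (‖u x + planeWave k θ₀ x‖ ^ 2 + c ^ 2) ∂ν := by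
      refine integral_mono (i2.const_mul _) (i1.add (integrable_const _)) fun x => ?_
      simp only
      nlinarith [sq_nonneg (‖u x + planeWave k θ₀ x‖ - c)]
    rw [integral_const_mul, integral_add i1 (integrable_const _), integral_const,
      smul_eq_mul] at h6
    linarith
  have h7 : c * Y ≤ c * (c * ν.real univ) := by nlinarith
  exact le_of_mul_le_mul_left h7 hc0

/-- The constant is k(1+Γ)/(4π) times (1+Γ)/γ₀ times 2S; the 2 comes from comparing the surface
measure with the area. -/
theorem norm_farField_le (hu : IsScatteredField k Ω γ θ₀ u) (hk : 0 < k) (hγ0 : 0 < γ₀)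
    (hΩ : IsObstacle Ω) (hν : IsSurfaceMeasure ℂ Ω ν) (hγ : ContinuousOn γ (frontier Ω))
    (hγ₀ : ∀ x ∈ frontier Ω, γ₀ ≤ (γ x).im) (hθ₀ : ‖θ₀‖ = 1) {θ : E3} (hθ : ‖θ‖ = 1) :
    ‖farField ν Ω k u θ‖ ≤
      k * (1 + boundarySup Ω γ) ^ 2 * surfaceArea Ω / (2 * Real.pi * γ₀) := by
  have hΓ := boundarySup_nonneg Ω γ
  have hπ := Real.pi_pos
  have h1 := hν.real_univ_le hΩ
  have h2 := hu.integral_norm_total_le hk hγ0 hΩ hν hγ hγ₀ hθ₀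
  calc ‖farField ν Ω k u θ‖
      ≤ k * (1 + boundarySup Ω γ) / (4 * Real.pi) * ∫ x, ‖u x + planeWave k θ₀ x‖ ∂ν :=
        hu.norm_farField_le_integral hk hΩ hν hγ hθ₀ hθ
    _ ≤ k * (1 + boundarySup Ω γ) / (4 * Real.pi) *
          ((1 + boundarySup Ω γ) / γ₀ * (2 * surfaceArea Ω)) := by
        gcongr
        exact h2.trans (by gcongr)
    _ = _ := by field_simp; ring

/-- The forward amplitude does not vanish: otherwise the total field would have vanishing Cauchy
data on the boundary. -/
theorem farField_ne_zero (hu : IsScatteredField k Ω γ θ₀ u) (hk : 0 < k) (hγ0 : 0 < γ₀)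
    (hΩ : IsObstacle Ω) (hν : IsSurfaceMeasure ℂ Ω ν) (hγ : ContinuousOn γ (frontier Ω))
    (hγ₀ : ∀ x ∈ frontier Ω, γ₀ ≤ (γ x).im) (hθ₀ : ‖θ₀‖ = 1) : farField ν Ω k u θ₀ ≠ 0 := by
  intro h0
  have := hν.isFiniteMeasure hΩ
  have hcl : IsClosed Ω := hΩ.isCompact.isClosed
  have i1 : Integrable (fun x => ‖u x + planeWave k θ₀ x‖ ^ 2) ν :=
    integrable_of_continuousOn_frontier hΩ hν.le (hu.continuousOn_total.norm.pow 2)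
  have h1 := hu.energy_le hk hΩ hν hγ hγ₀ hθ₀
  rw [h0, norm_zero, mul_zero] at h1
  have h2 : ∫ x, ‖u x + planeWave k θ₀ x‖ ^ 2 ∂ν = 0 :=
    le_antisymm (nonpos_of_mul_nonpos_right (nonpos_of_mul_nonpos_right h1 hk) hγ0)
      (integral_nonneg fun _ => by positivity)
  have h3 : ∀ᵐ x ∂ν, u x + planeWave k θ₀ x = 0 := by
    filter_upwards [(integral_eq_zero_iff_of_nonneg (fun _ => by positivity) i1).1 h2] with x hx
    simpa using hx
  -- On ∂Ω the total field vanishes almost everywhere and, by the impedance condition, so does its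
  -- normal derivative. The representation of u, to which the incident wave may be added at no cost,
  -- therefore gives zero.
  have h4 : ∀ r ∈ Ωᶜ, u r = 0 := by
    intro r hr
    obtain ⟨δ, hδ, hball⟩ := Metric.nhds_basis_closedBall.mem_iff.1 (hcl.isOpen_compl.mem_nhds hr)
    have hδ3 : 0 < δ / 3 := by positivity
    have hfar : ∀ x ∈ Ω, 2 * (δ / 3) < ‖x - r‖ := fun x hx => by
      have hx' : x ∉ Metric.closedBall r δ := fun h => hball h hx
      rw [Metric.mem_closedBall, dist_eq_norm, not_le] at hx'
      linarith
    have hgc := contDiff_greenCut (k := k) hδ3 r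
    have hge := IsExteriorSmooth.of_contDiff (Ω := Ω) hgc
    -- The smoothed fundamental solution is C² on all of space and equals the true one near Ω, so
    -- the same function can be used in the exterior representation and in Green's identity inside
    -- Ω.
    have e1 : u r = ∫ x, wronskian Ω u (greenCut k (δ / 3) r) x (outwardNormal Ω x) ∂ν := by
      rw [hu.isRadiatingField.representation hk hΩ hν hr]
      refine integral_congr_ae ?_
      filter_upwards [ae_mem_frontier hν.le] with x hx
      rw [wronskian_congr_right (greenCut_eventuallyEq hδ3 (hfar x (hcl.frontier_subset hx)))]
    have e2 : ∫ x, wronskian Ω (planeWave k θ₀) (greenCut k (δ / 3) r) x (outwardNormal Ω x) ∂ν =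
        0 := by
      refine hν.green_interior hΩ (contDiff_planeWave k θ₀) hgc fun x hx => ?_
      have h5 := divg_fderiv_greenCut (k := k) hδ3 r x
      rw [greenSource_of_le hδ3 (hfar x hx).le] at h5
      rw [divg_fderiv_planeWave k hθ₀]
      linear_combination planeWave k θ₀ x * h5
    have e3 := integral_add (hu.isRadiatingField.integrable_wronskian_normal hge hΩ hν)
      ((IsExteriorSmooth.of_contDiff (contDiff_planeWave k θ₀)).integrable_wronskian_normal
        hge hΩ hν)
    rw [e2, add_zero] at e3
    rw [e1, ← e3]
    refine integral_eq_zero_of_ae ?_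
    filter_upwards [ae_mem_frontier hν.le, h3] with x hx hx0
    rw [wronskian_add_planeWave, hu.extDeriv_total hx, hx0]
    simp
  have h5 : ∀ x ∈ closure Ωᶜ, u x = 0 := by
    have hc : ContinuousOn u (closure Ωᶜ) := hu.contDiffOn_closure.continuousOn
    intro x hx
    have hn : (𝓝[Ωᶜ] x).NeBot := mem_closure_iff_nhdsWithin_neBot.1 hx
    refine tendsto_nhds_unique ((hc x hx).mono_left (nhdsWithin_mono x subset_closure))
      (tendsto_const_nhds.congr' ?_)
    filter_upwards [self_mem_nhdsWithin] with y hy using (h4 y hy).symm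
  -- By continuity u vanishes up to the boundary, so there the incident wave, of modulus one, would
  -- vanish almost everywhere; the surface measure would be zero.
  refine hν.ne_zero hΩ (ae_eq_bot.1 (eventually_false_iff_eq_bot.1 ?_))
  filter_upwards [ae_mem_frontier hν.le, h3] with x hx hx0
  rw [h5 x (frontier_subset_closure_compl Ω hx), zero_add] at hx0
  have := norm_planeWave k θ₀ x
  rw [hx0, norm_zero] at this
  exact zero_ne_one this

theorem totalCrossSection_pos (hu : IsScatteredField k Ω γ θ₀ u) (hk : 0 < k) (hγ0 : 0 < γ₀)
    (hΩ : IsObstacle Ω) (hγ : ContinuousOn γ (frontier Ω))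
    (hγ₀ : ∀ x ∈ frontier Ω, γ₀ ≤ (γ x).im) (hθ₀ : ‖θ₀‖ = 1) : 0 < totalCrossSection k u := by
  obtain ⟨ν, hν⟩ := exists_isSurfaceMeasure (V := ℂ) hΩ
  have hc := hu.isRadiatingField.continuous_farField (k := k) hΩ hν
  rw [hu.isRadiatingField.totalCrossSection_eq hk hΩ hν]
  have h1 : Continuous fun θ : Metric.sphere (0 : E3) 1 => ‖farField ν Ω k u (θ : E3)‖ ^ 2 := by
    fun_prop
  refine h1.integral_pos_of_hasCompactSupport_nonneg_nonzero
    (HasCompactSupport.of_compactSpace _) (fun _ => by positivity)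
    (x := ⟨θ₀, mem_sphere_zero_iff_norm.2 hθ₀⟩) ?_
  simpa using hu.farField_ne_zero hk hγ0 hΩ hν hγ hγ₀ hθ₀

/-- Inserting the amplitude bound M into σ²/(24πM²) gives the constant π/6 and the denominator
(1+Γ)⁴. This exceeds the claim because π² > 3 and 1+Γ ≤ 1+Γ+γ₀; strictness comes from the constant
and from σ > 0. -/
theorem transportCrossSection_gt (hu : IsScatteredField k Ω γ θ₀ u) (hk : 0 < k) (hγ0 : 0 < γ₀)
    (hΩ : IsObstacle Ω) (hγ : ContinuousOn γ (frontier Ω))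
    (hγ₀ : ∀ x ∈ frontier Ω, γ₀ ≤ (γ x).im) (hθ₀ : ‖θ₀‖ = 1) :
    1 / (2 * Real.pi) * (totalCrossSection k u * γ₀ / (k * surfaceArea Ω)) ^ 2
        * (1 / ((1 + boundarySup Ω γ) ^ 2 * (1 + boundarySup Ω γ + γ₀) ^ 2))
      < transportCrossSection k θ₀ u := by
  obtain ⟨ν, hν⟩ := exists_isSurfaceMeasure (V := ℂ) hΩ
  have hr := hu.isRadiatingField
  have hσ := hu.totalCrossSection_pos hk hγ0 hΩ hγ hγ₀ hθ₀
  have hS := surfaceArea_pos hΩ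
  have hΓ := boundarySup_nonneg Ω γ
  have hπ := Real.pi_pos
  have h1 := transport_lower_bound hθ₀ (hr.continuous_farField (k := k) hΩ hν)
    (M := k * (1 + boundarySup Ω γ) ^ 2 * surfaceArea Ω / (2 * Real.pi * γ₀)) (by positivity)
    fun θ hθ => hu.norm_farField_le hk hγ0 hΩ hν hγ hγ₀ hθ₀ hθ
  rw [← hr.totalCrossSection_eq hk hΩ hν, ← hr.transportCrossSection_eq hk hΩ hν] at h1
  refine lt_of_lt_of_le ?_ h1
  set σ := totalCrossSection k u
  set S := surfaceArea Ω
  set Γ := boundarySup Ω γ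
  have h2 : σ ^ 2 / (24 * Real.pi * (k * (1 + Γ) ^ 2 * S / (2 * Real.pi * γ₀)) ^ 2) =
      Real.pi / 6 * (σ * γ₀ / (k * S)) ^ 2 * (1 / ((1 + Γ) ^ 2 * (1 + Γ) ^ 2)) := by
    field_simp
    norm_num
  rw [h2]
  have h3 : 1 / (2 * Real.pi) < Real.pi / 6 := by
    rw [div_lt_div_iff₀ (by positivity) (by norm_num)]
    nlinarith [Real.pi_gt_three]
  have h4 : 0 < (σ * γ₀ / (k * S)) ^ 2 := by positivity
  calc 1 / (2 * Real.pi) * (σ * γ₀ / (k * S)) ^ 2 * (1 / ((1 + Γ) ^ 2 * (1 + Γ + γ₀) ^ 2))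
      ≤ 1 / (2 * Real.pi) * (σ * γ₀ / (k * S)) ^ 2 * (1 / ((1 + Γ) ^ 2 * (1 + Γ) ^ 2)) := by
        have h5 : (1 + Γ) ^ 2 ≤ (1 + Γ + γ₀) ^ 2 :=
          pow_le_pow_left₀ (by positivity) (by linarith) 2
        gcongr
    _ < _ := by gcongr

end IsScatteredField

/-- The transport cross section is bounded below in terms of bounds for the obstacle. -/
theorem exists_pos_le_transportValues {k γ₀ : ℝ} (Γ σ A : ℝ) (hk : 0 < k) (hγ0 : 0 < γ₀) :
    ∃ c : ℝ, 0 < c ∧ ∀ R ∈ transportValues k γ₀ Γ σ A, c ≤ R := by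
  have hπ := Real.pi_pos
  by_cases h : 0 < σ ∧ 0 < A ∧ 0 ≤ Γ
  · obtain ⟨hσ, hA, hΓ⟩ := h
    refine ⟨1 / (2 * Real.pi) * (σ * γ₀ / (k * A)) ^ 2 *
      (1 / ((1 + Γ) ^ 2 * (1 + Γ + γ₀) ^ 2)), by positivity, ?_⟩
    rintro R ⟨Ω, γ, θ₀, u, hΩ, hγ, hγ₀, hΓ', hθ₀, hu, rfl, hA', rfl⟩
    have hS := surfaceArea_pos hΩ
    have hΓ0 := IsScatteredField.boundarySup_nonneg Ω γ
    refine le_trans ?_ (hu.transportCrossSection_gt hk hγ0 hΩ hγ hγ₀ hθ₀).le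
    gcongr
  -- Total cross section and area are positive and Γ is nonnegative for every admissible
  -- configuration, so here the set of values is empty and any positive constant serves.
  · refine ⟨1, one_pos, ?_⟩
    rintro R ⟨Ω, γ, θ₀, u, hΩ, hγ, hγ₀, hΓ', hθ₀, hu, rfl, hA', rfl⟩
    exact absurd ⟨hu.totalCrossSection_pos hk hγ0 hΩ hγ hγ₀ hθ₀, (surfaceArea_pos hΩ).trans_le hA',
      (IsScatteredField.boundarySup_nonneg Ω γ).trans hΓ'⟩ h

end

end ImpedanceScattering

end

open ImpedanceScattering in
theorem theorem4 :
    (∀ (k γ₀ : ℝ) (Ω : Set E3) (γ : E3 → ℂ) (θ₀ : E3) (u : E3 → ℂ),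
      0 < k → 0 < γ₀ → IsObstacle Ω → ContinuousOn γ (frontier Ω) →
      (∀ x ∈ frontier Ω, γ₀ ≤ (γ x).im) → ‖θ₀‖ = 1 → IsScatteredField k Ω γ θ₀ u →
        HasFarField k u (scatteringAmplitude k u) ∧
        Integrable (fun θ : Metric.sphere (0 : E3) 1 => ‖scatteringAmplitude k u θ‖ ^ 2)
          (volume : Measure E3).toSphere ∧
        1 / (2 * Real.pi) * (totalCrossSection k u * γ₀ / (k * surfaceArea Ω)) ^ 2
            * (1 / ((1 + boundarySup Ω γ) ^ 2 * (1 + boundarySup Ω γ + γ₀) ^ 2))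
          < transportCrossSection k θ₀ u) ∧
    (∀ k γ₀ Γ σ A : ℝ, 0 < k → 0 < γ₀ →
      ∃ c : ℝ, 0 < c ∧ ∀ R ∈ transportValues k γ₀ Γ σ A, c ≤ R) := by
  refine ⟨fun k γ₀ Ω γ θ₀ u hk hγ0 hΩ hγ hγ₀ hθ₀ hu => ⟨?_, ?_, ?_⟩,
    fun k γ₀ Γ σ A hk hγ0 => exists_pos_le_transportValues Γ σ A hk hγ0⟩
  · exact hu.isRadiatingField.hasFarField hk hΩ
  · exact hu.isRadiatingField.integrable_sq_scatteringAmplitude hk hΩ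
  · exact hu.transportCrossSection_gt hk hγ0 hΩ hγ hγ₀ hθ₀
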